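/- Let $V\subset\mathbb{Z}^n$ be the vertex set of a Fano polytope, i.e. a convex polytope in $\mathbb{R}^n$ containing the origin in its interior and all of whose vertices are primitive vectors of $\mathbb{Z}^n$; let $P=\{p\in\mathbb{R}^n:\langle v,p\rangle\ge -1\ \text{for all } v\in V\}$ be the dual polytope, and let $X=\operatorname{Proj}\bigoplus_{k\ge 0}\bigoplus_{m\in kP\cap\mathbb{Z}^n}\mathbb{C}\,\chi^m$ be the corresponding $n$-dimensional complex toric Fano variety (every toric Fano variety, i.e. every normal projective toric variety whose anticanonical divisor $-K_X$ is $\mathbb{Q}$-Cartier and ample, is of this form). Suppose that $X$ is singular and that $(X,-K_X)$ is K-semistable, i.e. the Donaldson–Futaki invariant of every normal test configuration for $(X,-K_X)$ is non-negative. Suppose moreover that at least one of the following conditions holds: 1. $X$ is $\mathbb{Q}$-factorial (every Weil divisor has a positive multiple that is Cartier); 2. $X$ is not Gorenstein (the canonical divisor $K_X$ is not Cartier); 3. $n=2$. Then the volume $\operatorname{vol}(-K_X):=\lim_{k\to\infty}k^{-n}\dim_{\mathbb{C}} H^0(X,-kK_X)$ (which exists) satisfies $$\operatorname{vol}(-K_X)\le\frac12\,\frac{(n+1)^n}{n!}.$$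 -/

import Mathlib

open AlgebraicGeometry CategoryTheory Filter Topology

noncomputable section

/-!
## Complex varieties: anticanonical sections, singularities, K-semistability

A complex variety is an integral scheme `X` over `Spec ℂ`. The number `n` is always its dimension.
-/

namespace ComplexVariety

section Basic

variable (X : Scheme.{0}) [X.Over (Spec (.of ℂ))]

/-- The local rings of a scheme over `ℂ` are `ℂ`-algebras, through the structure morphism. -/
instance stalkAlgebra (x : X) : Algebra ℂ (X.presheaf.stalk x) :=
  ((Scheme.ΓSpecIso (.of ℂ)).inv ≫ (X ↘ Spec (.of ℂ)).appTop ≫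
    X.presheaf.germ ⊤ x trivial).hom.toAlgebra

/-- `X` is non-singular: it is smooth over `ℂ`. -/
def IsNonsingular : Prop := Smooth (X ↘ Spec (.of ℂ))

/-- `X` is singular: it is not non-singular. -/
def IsSingular : Prop := ¬ IsNonsingular X

end Basic

/-- `X` (a normal variety) is `ℚ`-factorial: for every prime divisor `D`, given by its generic
point `ξ` (a point of codimension one), some multiple `m D` with `m ≥ 1` is a Cartier divisor.
The latter says that the ideal sheaf `𝒪_X(-m D)` of the functions that vanish to order at least `m`
along `D` is principal at every point `x` of `X`, which is nontrivial only for `x ∈ D`, that is,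
`ξ ⤳ x`. -/
def IsQFactorial (X : Scheme.{0}) : Prop :=
  ∀ ξ : X, ringKrullDim (X.presheaf.stalk ξ) = 1 →
    ∃ m : ℕ, 0 < m ∧ ∀ (x : X) (h : ξ ⤳ x),
      (((IsLocalRing.maximalIdeal (X.presheaf.stalk ξ)) ^ m).comap
        (X.presheaf.stalkSpecializes h).hom).IsPrincipal

section Anticanonical

variable (X : Scheme.{0}) [X.Over (Spec (.of ℂ))] [IsIntegral X] (n : ℕ)

/-- Rational differential forms of degree `n` on `X`. For `n = dim X` they form a one-dimensional
vector space over the function field, the generic fibre of the canonical sheaf. -/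
abbrev RationalForm : Type :=
  ⋀[X.functionField]^n (Ω[X.functionField⁄ℂ])

/-- The form `da₁ ∧ ⋯ ∧ daₙ` for functions `a₁, …, aₙ` regular at the point `x`. -/
def wedgeD (x : X) (a : Fin n → X.presheaf.stalk x) : RationalForm X n :=
  exteriorPower.ιMulti X.functionField n fun i =>
    KaehlerDifferential.D ℂ X.functionField (algebraMap (X.presheaf.stalk x) X.functionField (a i))

/-- The stalk at `x` of the reflexive sheaf `𝒪_X(-k K_X)` of a normal variety `X`. A rational
section `s` of `-k K_X` is a functional on the `k`-th tensor power of the line of rational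
`n`-forms, in other words a function `ω ↦ s(ω)`, homogeneous of degree `k`, from rational `n`-forms
to rational functions. It is regular at `x` if `s(da₁ ∧ ⋯ ∧ daₙ)` is regular at `x` for all
functions `a₁, …, aₙ` regular at `x`. The product of sections is the product of functions. -/
def anticanonicalStalk (k : ℕ) (x : X) :
    Submodule ℂ (RationalForm X n → X.functionField) where
  carrier := {s | (∀ (g : X.functionField) (ω : RationalForm X n), s (g • ω) = g ^ k * s ω) ∧
    ∀ a : Fin n → X.presheaf.stalk x,
      s (wedgeD X n x a) ∈ (algebraMap (X.presheaf.stalk x) X.functionField).range}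
  zero_mem' := ⟨fun _ _ => by simp, fun _ => by simp⟩
  add_mem' := by
    rintro s t ⟨hs, hs'⟩ ⟨ht, ht'⟩
    refine ⟨fun g ω => ?_, fun a => ?_⟩
    · simp only [Pi.add_apply, hs, ht, mul_add]
    · exact add_mem (hs' a) (ht' a)
  smul_mem' := by
    rintro c s ⟨hs, hs'⟩
    refine ⟨fun g ω => ?_, fun a => ?_⟩
    · simp only [Pi.smul_apply, hs, mul_smul_comm]
    · obtain ⟨b, hb⟩ := hs' a
      refine ⟨algebraMap ℂ (X.presheaf.stalk x) c * b, ?_⟩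
      rw [map_mul, hb, Pi.smul_apply, Algebra.smul_def]
      congr 1
      exact congrArg (fun f : CommRingCat.of ℂ ⟶ X.functionField => f.hom c)
        (show ((Scheme.ΓSpecIso (.of ℂ)).inv ≫ (X ↘ Spec (.of ℂ)).appTop ≫
            X.presheaf.germ ⊤ x trivial) ≫ X.presheaf.stalkSpecializes
              ((genericPoint_spec X).specializes trivial) =
          (Scheme.ΓSpecIso (.of ℂ)).inv ≫ (X ↘ Spec (.of ℂ)).appTop ≫
            X.presheaf.germ ⊤ (genericPoint X) trivial by
          rw [Category.assoc, Category.assoc]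
          exact congrArg (fun f => (Scheme.ΓSpecIso (.of ℂ)).inv ≫
            (X ↘ Spec (.of ℂ)).appTop ≫ f) (X.presheaf.germ_stalkSpecializes _ _))

/-- The space `H⁰(X, -k K_X)` of global sections. -/
def anticanonicalSections (k : ℕ) : Submodule ℂ (RationalForm X n → X.functionField) :=
  ⨅ x : X, anticanonicalStalk X n k x

/-- `X` (normal, Cohen-Macaulay) is Gorenstein: `K_X`, equivalently `-K_X`, is Cartier, that is,
the sheaf `𝒪_X(-K_X)` is generated by one element at every point. -/
def IsGorenstein : Prop :=
  ∀ x : X, ∃ s₀ ∈ anticanonicalStalk X n 1 x, ∀ s ∈ anticanonicalStalk X n 1 x,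
    ∃ a : X.presheaf.stalk x,
      s = fun ω => algebraMap (X.presheaf.stalk x) X.functionField a * s₀ ω

/-- The volume of `-K_X` exists and equals `v`:
`vol(-K_X) = lim_{k → ∞} k⁻ⁿ dim H⁰(X, -k K_X)`. -/
def HasAnticanonicalVolume (v : ℝ) : Prop :=
  Tendsto (fun k : ℕ => (Module.finrank ℂ (anticanonicalSections X n k) : ℝ) / (k : ℝ) ^ n)
    atTop (𝓝 v)

/-- A normal ample test configuration for `(X, -r K_X)`, given by the corresponding filtration of
the section ring `⨁ₖ H⁰(X, -r k K_X)`. Here `F k w` is the space of those sections `s` for which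
`t^(-w) s`, where `s` is viewed as a `ℂ*`-invariant rational section, extends to the total space.
The test configuration is `Proj` of the Rees algebra `⨁_{k, w} t^(-w) F k w` over `ℂ[t]`. -/
structure TestConfiguration (r : ℕ) where
  /-- The filtration. -/
  F : ℕ → ℤ → Submodule ℂ (RationalForm X n → X.functionField)
  le_sections : ∀ k w, F k w ≤ anticanonicalSections X n (r * k)
  antitone : ∀ k, Antitone (F k)
  exhaustive : ∀ k, ∃ w, F k w = anticanonicalSections X n (r * k)
  separated : ∀ k, ∃ w, F k w = ⊥
  one_mem : 1 ∈ F 0 0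
  mul_mem : ∀ {k l w v s t}, s ∈ F k w → t ∈ F l v → s * t ∈ F (k + l) (w + v)
  /-- The Rees algebra is a finitely generated `ℂ[t]`-algebra. -/
  finitelyGenerated : ∃ (N : ℕ) (deg : Fin N → ℕ) (wt : Fin N → ℤ)
    (s : Fin N → RationalForm X n → X.functionField), (∀ i, s i ∈ F (deg i) (wt i)) ∧
      ∀ k w, F k w ≤ Submodule.span ℂ {f | ∃ e : Fin N → ℕ, ∑ i, e i * deg i = k ∧
        w ≤ ∑ i, (e i : ℤ) * wt i ∧ f = ∏ i, s i ^ e i}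
  /-- The Rees algebra is integrally closed (normality of the total space). -/
  integrallyClosed : ∀ k w, ∀ s ∈ anticanonicalSections X n (r * k),
    (∃ (m : ℕ) (a : ℕ → RationalForm X n → X.functionField), 0 < m ∧
      (∀ i ∈ Finset.Icc 1 m, a i ∈ F (i * k) (i * w)) ∧
      s ^ m + ∑ i ∈ Finset.Icc 1 m, a i * s ^ (m - i) = 0) → s ∈ F k w

variable {X n} in
/-- The total weight of the `ℂ*`-action on the sections of degree `k` over the central fibre,
`∑_w w · dim (F k w / F k (w + 1))`. -/
def TestConfiguration.weight {r : ℕ} (T : TestConfiguration X n r) (k : ℕ) : ℤ :=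
  ∑ᶠ w : ℤ, w * ((Module.finrank ℂ (T.F k w) : ℤ) - Module.finrank ℂ (T.F k (w + 1)))

variable {X n} in
/-- The Donaldson-Futaki invariant is `d`: if `w_k` is the total weight and `N_k` the dimension of
the space of sections of degree `k`, then `w_k / (k N_k) = F₀ + F₁ k⁻¹ + o(k⁻¹)` for sufficiently
divisible `k → ∞`, and `d = -2 F₁`. -/
def TestConfiguration.HasDonaldsonFutaki {r : ℕ} (T : TestConfiguration X n r) (d : ℝ) : Prop :=
  ∃ (p : ℕ) (F₀ F₁ : ℝ), 0 < p ∧ d = -2 * F₁ ∧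
    Tendsto (fun j : ℕ => ((p * j : ℕ) : ℝ) * ((T.weight (p * j) : ℝ) /
      (((p * j : ℕ) : ℝ) * Module.finrank ℂ (anticanonicalSections X n (r * (p * j)))) - F₀))
      atTop (𝓝 F₁)

/-- The Fano variety `X`, polarized by `-K_X`, is K-semistable: the Donaldson-Futaki invariant of
every test configuration is non-negative. -/
def IsKSemistable : Prop :=
  ∀ r : ℕ, 0 < r → ∀ T : TestConfiguration X n r, ∀ d : ℝ, T.HasDonaldsonFutaki d → 0 ≤ d

end Anticanonical

end ComplexVariety

/-! ## Toric Fano varieties -/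

namespace ToricFano

variable {n : ℕ}

/-- `V` is the vertex set of a Fano polytope in `ℝⁿ`: a convex polytope that contains the origin in
its interior and whose vertices are primitive elements of `ℤⁿ`. -/
structure IsFanoPolytope (V : Finset (Fin n → ℤ)) : Prop where
  primitive : ∀ v ∈ V, ∀ (d : ℤ) (w : Fin n → ℤ), v = d • w → IsUnit d
  vertex : ∀ v ∈ V, (fun i => (v i : ℝ)) ∉
    convexHull ℝ ((fun (u : Fin n → ℤ) (i : Fin n) => (u i : ℝ)) '' {u | u ∈ V ∧ u ≠ v})
  zero_mem_interior : (0 : Fin n → ℝ) ∈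
    interior (convexHull ℝ ((fun (u : Fin n → ℤ) (i : Fin n) => (u i : ℝ)) '' (V : Set (Fin n → ℤ))))

/-- The lattice points `(m, k)` of the cone over the polytope
`P = {p ∈ ℝⁿ | ⟨v, p⟩ ≥ -1 for all v ∈ V}`, that is, `k ∈ ℕ` and `m ∈ k P ∩ ℤⁿ`. -/
def coneMonoid (V : Finset (Fin n → ℤ)) : AddSubmonoid ((Fin n → ℤ) × ℕ) where
  carrier := {q | ∀ v ∈ V, -(q.2 : ℤ) ≤ ∑ i, v i * q.1 i}
  zero_mem' := by simp
  add_mem' := by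
    intro a b ha hb v hv
    have h1 := ha v hv
    have h2 := hb v hv
    simp only [Prod.fst_add, Prod.snd_add, Pi.add_apply, mul_add, Finset.sum_add_distrib,
      Nat.cast_add]
    linarith

/-- The degree `(m, k) ↦ k`. -/
def coneDegree (V : Finset (Fin n → ℤ)) : coneMonoid V →+ ℕ :=
  (AddMonoidHom.snd (Fin n → ℤ) ℕ).comp (coneMonoid V).subtype

/-- The semigroup algebra of the cone over `P`, spanned by the monomials `χ^m s^k` with
`m ∈ k P ∩ ℤⁿ`. -/
abbrev coneRing (V : Finset (Fin n → ℤ)) : Type := AddMonoidAlgebra ℂ (coneMonoid V)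

/-- The grading of the semigroup algebra by `k`. -/
abbrev coneGrading (V : Finset (Fin n → ℤ)) : ℕ → Submodule ℂ (coneRing V) :=
  AddMonoidAlgebra.gradeBy ℂ (coneDegree V)

/-- The toric variety of the polytope `P` dual to the Fano polytope with vertex set `V`, in other
words the toric variety of the fan of the cones over the faces of the Fano polytope. -/
def toricVariety (V : Finset (Fin n → ℤ)) : Scheme.{0} := Proj (coneGrading V)

/-- The structure morphism of the toric variety. -/
instance toricVarietyOver (V : Finset (Fin n → ℤ)) :
    (toricVariety V).Over (Spec (.of ℂ)) where
  hom := Proj.toSpecZero (coneGrading V) ≫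
    Spec.map (CommRingCat.ofHom (algebraMap ℂ (coneGrading V 0)))

instance coneRing_isDomain (V : Finset (Fin n → ℤ)) : IsDomain (coneRing V) := by
  have : TwoUniqueSums (coneMonoid V) :=
    .of_injective_addHom (coneMonoid V).subtype.toAddHom Subtype.val_injective inferInstance
  have : NoZeroDivisors (coneRing V) := inferInstance
  exact NoZeroDivisors.to_isDomain _

/-- The generic point of the toric variety. -/
def genericPt (V : Finset (Fin n → ℤ)) : toricVariety V :=
  (⟨⊥, Ideal.isPrime_bot, fun hle => by
    have hmem : ((0, 1) : (Fin n → ℤ) × ℕ) ∈ coneMonoid V := by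
      intro v _
      simp
    have h1 : AddMonoidAlgebra.single (⟨(0, 1), hmem⟩ : coneMonoid V) (1 : ℂ) ∈
        coneGrading V 1 :=
      AddMonoidAlgebra.single_mem_gradeBy (coneDegree V) _ _
    have h2 : AddMonoidAlgebra.single (⟨(0, 1), hmem⟩ : coneMonoid V) (1 : ℂ) ∈
        HomogeneousIdeal.irrelevant (coneGrading V) := by
      rw [HomogeneousIdeal.mem_irrelevant_iff, GradedRing.proj_apply,
        DirectSum.decompose_of_mem_ne (coneGrading V) h1 one_ne_zero]
    have h3 := hle h2
    have h4 : AddMonoidAlgebra.single (⟨(0, 1), hmem⟩ : coneMonoid V) (1 : ℂ) = 0 := h3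
    simp at h4⟩ : ProjectiveSpectrum (coneGrading V))

instance toricVariety_irreducibleSpace (V : Finset (Fin n → ℤ)) :
    IrreducibleSpace (toricVariety V) := by
  have h : closure ({genericPt V} : Set (toricVariety V)) = Set.univ := by
    rw [Set.eq_univ_iff_forall]
    intro y
    let z : ProjectiveSpectrum (coneGrading V) := y
    let η : ProjectiveSpectrum (coneGrading V) := genericPt V
    have hle : η ≤ z := by
      change (⊥ : HomogeneousIdeal (coneGrading V)) ≤ z.asHomogeneousIdeal
      exact bot_le
    exact (ProjectiveSpectrum.le_iff_mem_closure (coneGrading V) η z).mp hle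
  have h2 : IsIrreducible (Set.univ : Set (toricVariety V)) := by
    rw [← h]
    exact isIrreducible_singleton.closure
  exact (irreducibleSpace_def _).mpr h2

instance toricVariety_isReduced (V : Finset (Fin n → ℤ)) : IsReduced (toricVariety V) := by
  have (x : toricVariety V) : _root_.IsReduced ((toricVariety V).presheaf.stalk x) := by
    let y : ProjectiveSpectrum (coneGrading V) := x
    let e := (Proj.stalkIso (coneGrading V) x).commRingCatIsoToRingEquiv
    have : IsDomain (Localization y.asHomogeneousIdeal.toIdeal.primeCompl) :=
      IsLocalization.isDomain_localization
        y.asHomogeneousIdeal.toIdeal.primeCompl_le_nonZeroDivisors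
    refine isReduced_of_injective
      ((algebraMap (HomogeneousLocalization (coneGrading V)
          y.asHomogeneousIdeal.toIdeal.primeCompl)
        (Localization y.asHomogeneousIdeal.toIdeal.primeCompl)).comp e.toRingHom) ?_
    exact (HomogeneousLocalization.val_injective _).comp e.injective
  exact isReduced_of_isReduced_stalk _

instance toricVariety_isIntegral (V : Finset (Fin n → ℤ)) : IsIntegral (toricVariety V) :=
  isIntegral_of_irreducibleSpace_of_isReduced _

end ToricFano

end

/-! Write `P` for the dual polytope. K-semistability enters only through the product test
configurations given by one-parameter subgroups `ξ` of the torus. The monomials of the lattice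
points of `k P` form a basis of the sections of `-k K_X`, so `vol(-K_X)` is the Euclidean volume of
`P`, and the Donaldson-Futaki invariant of `ξ` is minus the pairing of `ξ` with the barycentre of
`P`. Hence every integral lattice moment of `P` is non-positive (`polytopeMoment_nonpos`).

Take `n` vertices `v i` with determinant `d ≠ 0`. The affine map with coordinates `x i = ⟨v i, p⟩ +
1` sends `P` into the positive orthant and scales volume by `|d|`. The moment inequality for `∑ v i`
says that the volume of `P` is at most the integral over `P` of `n + 1 - ∑ x i`. Enlarging the
domain to the whole simplex where this function is non-negative bounds the volume by `|d|⁻¹ (n + 1)ⁿ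
/ n!` (`IsFanoPolytope.polytopeVolume_le`). One minor with `|d| ≥ 2` therefore proves the theorem.

Otherwise all maximal minors of the vertices are `0` or `±1`. Then `K_X` is Cartier
(`IsUnimodular.isGorenstein`), and if the cones of the fan are simplicial, each of them is generated
by part of a lattice basis, so `X` is smooth (`IsUnimodular.isNonsingular`). The cones are
simplicial if `X` is `ℚ`-factorial (`IsFanoPolytope.exists_dotProduct_eq_zero`) or `n = 2`
(`IsFanoPolytope.exists_dotProduct_eq_zero_of_plane`). So each of the three conditions contradicts
unimodularity of a singular `X`.

The dictionary between schemes and polytopes rests on one principle: rational functions are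
quotients of Laurent polynomials, and regularity at a point is a condition on the orders along the
torus-invariant divisors through it. For sections of `-k K_X`, written in terms of the logarithmic
volume form, the condition becomes a pole of order at most `k`. The Donaldson-Futaki invariant needs
lattice sums to two leading orders. These come from comparing `k P` with `(k + 1/2) P`, where the
errors at lattice points near a facet cancel in pairs
(`IsFanoPolytope.exists_abs_sum_sub_integral_le`). -/

noncomputable section

open ComplexVariety

namespace ToricFano

variable {n : ℕ} {V : Finset (Fin n → ℤ)}

/-! ### Local rings of the toric variety -/

/-- The homogeneous prime ideal of a point. -/
def primeOf (x : toricVariety V) : Ideal (coneRing V) :=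
  HomogeneousIdeal.toIdeal (ProjectiveSpectrum.asHomogeneousIdeal (𝒜 := coneGrading V) x)

instance primeOf_isPrime (x : toricVariety V) : (primeOf x).IsPrime :=
  ProjectiveSpectrum.isPrime (𝒜 := coneGrading V) x

/-- The local ring at `x` is the homogeneous localization. -/
def stalkEquiv (x : toricVariety V) : (toricVariety V).presheaf.stalk x ≃+*
    HomogeneousLocalization (coneGrading V) (primeOf x).primeCompl :=
  Proj.stalkIso' (coneGrading V) x

/-- The element `N / D` of the local ring at `x`. -/
def stalkFrac (x : toricVariety V) {j : ℕ} (N D : coneGrading V j) (hD : D.1 ∉ primeOf x) :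
    (toricVariety V).presheaf.stalk x :=
  (stalkEquiv x).symm (HomogeneousLocalization.mk ⟨j, N, D, hD⟩)

lemma exists_stalkFrac (x : toricVariety V) (a : (toricVariety V).presheaf.stalk x) :
    ∃ (j : ℕ) (N D : coneGrading V j) (hD : D.1 ∉ primeOf x), a = stalkFrac x N D hD := by
  obtain ⟨⟨j, N, D, hD⟩, h⟩ := HomogeneousLocalization.mk_surjective (stalkEquiv x a)
  exact ⟨j, N, D, hD, ((stalkEquiv x).symm_apply_eq.mpr h).symm⟩

lemma stalkFrac_specializes {x y : toricVariety V} (h : x ⤳ y) {j : ℕ} (N D : coneGrading V j)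
    (hD : D.1 ∉ primeOf y) (hD' : D.1 ∉ primeOf x) :
    ((toricVariety V).presheaf.stalkSpecializes h).hom (stalkFrac y N D hD) =
      stalkFrac x N D hD' :=
  TopCat.Presheaf.germ_stalkSpecializes_apply (C := CommRingCat) (X := Proj (coneGrading V))
    (F := (ProjectiveSpectrum.Proj.structureSheaf (coneGrading V)).presheaf)
    (U := ProjectiveSpectrum.basicOpen (coneGrading V) D.1) (y := y) hD h
    (sectionInBasicOpen (coneGrading V) y
      ⟨j, N, D, hD⟩)

lemma primeOf_le_of_specializes {x y : toricVariety V} (h : x ⤳ y) : primeOf x ≤ primeOf y :=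
  (ProjectiveSpectrum.le_iff_mem_closure (coneGrading V) x y).mpr h.mem_closure

lemma specializes_of_primeOf_le {x y : toricVariety V} (h : primeOf x ≤ primeOf y) : x ⤳ y :=
  specializes_iff_mem_closure.mpr
    ((ProjectiveSpectrum.le_iff_mem_closure (coneGrading V) x y).mp h)

lemma primeOf_genericPoint : primeOf (genericPoint (toricVariety V)) = ⊥ := by
  have := primeOf_le_of_specializes ((genericPoint_spec (toricVariety V)).specializes
    (Set.mem_univ (genericPt V)))
  exact le_bot_iff.mp this

lemma isUnit_algebraMap_of_primeCompl (x : toricVariety V) (D : (primeOf x).primeCompl) :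
    IsUnit (algebraMap (coneRing V) (FractionRing (coneRing V)) D) := by
  rw [isUnit_iff_ne_zero, Ne, IsFractionRing.to_map_eq_zero_iff]
  exact fun h => D.2 (h ▸ zero_mem _)

/-- The local ring at a point as a subring of the field of fractions of the cone ring. -/
def stalkToFrac (x : toricVariety V) :
    (toricVariety V).presheaf.stalk x →+* FractionRing (coneRing V) :=
  (IsLocalization.lift (M := (primeOf x).primeCompl) (S := Localization (primeOf x).primeCompl)
    (isUnit_algebraMap_of_primeCompl x)).comp
    ((algebraMap (HomogeneousLocalization (coneGrading V) (primeOf x).primeCompl)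
      (Localization (primeOf x).primeCompl)).comp (stalkEquiv x).toRingHom)

lemma stalkToFrac_injective (x : toricVariety V) : Function.Injective (stalkToFrac x) := by
  have h : Function.Injective (IsLocalization.lift (M := (primeOf x).primeCompl)
      (S := Localization (primeOf x).primeCompl) (isUnit_algebraMap_of_primeCompl x)) := by
    rw [IsLocalization.lift_injective_iff]
    intro a b
    rw [(IsLocalization.injective _ (primeOf x).primeCompl_le_nonZeroDivisors).eq_iff,
      (IsFractionRing.injective _ _).eq_iff]
  exact h.comp ((HomogeneousLocalization.val_injective _).comp (stalkEquiv x).injective)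

lemma stalkToFrac_stalkFrac (x : toricVariety V) {j : ℕ} (N D : coneGrading V j)
    (hD : D.1 ∉ primeOf x) : stalkToFrac x (stalkFrac x N D hD) =
      algebraMap _ (FractionRing (coneRing V)) N.1 / algebraMap _ _ D.1 := by
  have h1 : stalkToFrac x (stalkFrac x N D hD) = IsLocalization.lift
      (S := Localization (primeOf x).primeCompl) (isUnit_algebraMap_of_primeCompl x)
        (Localization.mk N.1 ⟨D.1, hD⟩) := by
    simp only [stalkToFrac, RingHom.comp_apply, stalkFrac]
    congr 1
    exact congrArg HomogeneousLocalization.val ((stalkEquiv x).apply_symm_apply _)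
  have h0 := isUnit_algebraMap_of_primeCompl x ⟨D.1, hD⟩
  rw [h1, Localization.mk_eq_mk', IsLocalization.lift_mk'_spec, mul_div_cancel₀ _ h0.ne_zero]

lemma algebraMap_stalkFrac (x : toricVariety V) {j : ℕ} (N D : coneGrading V j)
    (hD : D.1 ∉ primeOf x) :
    stalkToFrac (genericPoint (toricVariety V))
      (algebraMap _ (toricVariety V).functionField (stalkFrac x N D hD)) =
      algebraMap _ (FractionRing (coneRing V)) N.1 / algebraMap _ _ D.1 := by
  have h := (genericPoint_spec (toricVariety V)).specializes (Set.mem_univ x)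
  have hD' : D.1 ∉ primeOf (genericPoint (toricVariety V)) :=
    fun h' => hD (primeOf_le_of_specializes h h')
  rw [← stalkToFrac_stalkFrac _ N D hD']
  exact congrArg _ (stalkFrac_specializes h N D hD hD')

lemma stalkToFrac_algebraMap (x : toricVariety V) (a : (toricVariety V).presheaf.stalk x) :
    stalkToFrac (genericPoint (toricVariety V))
      (algebraMap _ (toricVariety V).functionField a) = stalkToFrac x a := by
  obtain ⟨j, N, D, hD, rfl⟩ := exists_stalkFrac x a
  rw [algebraMap_stalkFrac, stalkToFrac_stalkFrac]

lemma stalk_algebraMap_injective (x : toricVariety V) :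
    Function.Injective (algebraMap ((toricVariety V).presheaf.stalk x)
      (toricVariety V).functionField) := by
  intro a b h
  apply stalkToFrac_injective x
  rw [← stalkToFrac_algebraMap, h, stalkToFrac_algebraMap]


/-- The structure morphism of `Proj` passes through the basic open set of `1`, which equals the
whole space only up to a propositional equality. Substituting that equality turns the
identifications into identities. -/
lemma topIso_inv_isoOfEq_germ {X : Scheme.{u}} {U : X.Opens} (e : U = ⊤) (x : X) :
    U.topIso.inv ≫ (X.isoOfEq e).inv.appTop ≫ X.topIso.inv.appTop ≫
      X.presheaf.germ ⊤ x trivial = X.presheaf.germ U x (by rw [e]; trivial) := by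
  subst e
  rw [show X.isoOfEq rfl = Iso.refl _ by ext1; simp]
  have h1 : (Scheme.Opens.topIso (⊤ : X.Opens)).inv = (⊤ : X.Opens).ι.appTop := by
    rw [Scheme.Opens.topIso_inv, Scheme.Opens.ι_appTop]
    rfl
  have h2 : (⊤ : X.Opens).ι.appTop ≫ X.topIso.inv.appTop = 𝟙 _ := by
    rw [← Scheme.Hom.comp_appTop, ← Scheme.topIso_hom, Iso.inv_hom_id, Scheme.Hom.id_appTop]
  simp only [Iso.refl_inv, Scheme.Hom.id_appTop, Category.id_comp]
  rw [h1, ← Category.assoc, h2, Category.id_comp]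

lemma toSpecZero_appTop_germ {σ : Type*} {A : Type u} [CommRing A] [SetLike σ A]
    [AddSubgroupClass σ A]
    (𝒜 : ℕ → σ) [GradedRing 𝒜] (x : Proj 𝒜) {R : CommRingCat.{u}} (φ : R ⟶ .of (𝒜 0)) :
    (Scheme.ΓSpecIso R).inv ≫ (Proj.toSpecZero 𝒜 ≫ Spec.map φ).appTop ≫
      (Proj 𝒜).presheaf.germ ⊤ x trivial =
    φ ≫ CommRingCat.ofHom (HomogeneousLocalization.fromZeroRingHom 𝒜 _) ≫
      Proj.awayToSection 𝒜 1 ≫ (Proj 𝒜).presheaf.germ (Proj.basicOpen 𝒜 1) x (by simp) := by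
  rw [Proj.toSpecZero]
  simp only [Scheme.Hom.comp_appTop, Category.assoc, ← Scheme.ΓSpecIso_inv_naturality_assoc]
  rw [Scheme.Hom.appTop.eq_1 (Proj.basicOpenToSpec 𝒜 1), Proj.basicOpenToSpec_app_top]
  simp only [Category.assoc, Iso.inv_hom_id_assoc]
  rw [topIso_inv_isoOfEq_germ]

lemma one_notMem_primeOf (x : toricVariety V) : (1 : coneRing V) ∉ primeOf x :=
  fun h => (primeOf_isPrime x).ne_top ((Ideal.eq_top_iff_one _).mpr h)

/-- The scalar action on local rings is defined through the structure morphism. It has to be made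
explicit before differentials over `ℂ` can be computed with fractions. -/
lemma stalk_algebraMap_eq (x : toricVariety V) (c : ℂ) :
    algebraMap ℂ ((toricVariety V).presheaf.stalk x) c =
      stalkFrac x (algebraMap ℂ (coneGrading V 0) c) 1 (one_notMem_primeOf x) := by
  have h1 := toSpecZero_appTop_germ (coneGrading V) x
    (CommRingCat.ofHom (algebraMap ℂ (coneGrading V 0)))
  have h2 := congrArg (fun f => f.hom c) h1
  refine Eq.trans ?_ (h2.trans ?_)
  · rfl
  · have h3 := AlgebraicGeometry.ProjectiveSpectrum.Proj.awayToSection_germ (coneGrading V) 1 x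
      (one_notMem_primeOf x)
    have h4 := congrArg (fun f => (CommRingCat.ofHom
      ((HomogeneousLocalization.fromZeroRingHom (coneGrading V) _).comp
        (algebraMap ℂ (coneGrading V 0))) ≫ f).hom c) h3
    exact h4

lemma stalkToFrac_algebraMap_complex (x : toricVariety V) (c : ℂ) :
    stalkToFrac x (algebraMap ℂ _ c) = algebraMap (coneRing V) _ (algebraMap ℂ (coneRing V) c) := by
  refine (congrArg _ (stalk_algebraMap_eq x c)).trans
    ((stalkToFrac_stalkFrac x _ 1 (one_notMem_primeOf x)).trans ?_)
  have h : algebraMap (coneRing V) (FractionRing (coneRing V)) (1 : coneGrading V 0).1 = 1 :=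
    map_one _
  rw [h, div_one]
  rfl

/-! ### Laurent polynomials in the function field -/

/-- Laurent polynomials in `n` variables. -/
abbrev Laurent (n : ℕ) : Type := AddMonoidAlgebra ℂ (Fin n → ℤ)

lemma mem_coneMonoid {q : (Fin n → ℤ) × ℕ} :
    q ∈ coneMonoid V ↔ ∀ v ∈ V, -(q.2 : ℤ) ≤ v ⬝ᵥ q.1 := Iff.rfl

lemma zero_mem_coneMonoid (V : Finset (Fin n → ℤ)) (j : ℕ) : (0, j) ∈ coneMonoid V := by
  rw [mem_coneMonoid]
  intro v _
  simp

/-- A level from which on `m` belongs to the dilates of the polytope. -/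
def level (V : Finset (Fin n → ℤ)) (m : Fin n → ℤ) : ℕ := ∑ v ∈ V, (v ⬝ᵥ m).natAbs

lemma mem_coneMonoid_of_level_le {m : Fin n → ℤ} {j : ℕ} (h : level V m ≤ j) :
    (m, j) ∈ coneMonoid V := by
  rw [mem_coneMonoid]
  intro v hv
  have := Finset.single_le_sum (f := fun v => (v ⬝ᵥ m).natAbs) (fun _ _ => Nat.zero_le _) hv
  simp only [level] at h
  simp only at this ⊢
  omega

/-- The monomial of an element of the cone. -/
def coneMonomial (m : Fin n → ℤ) (j : ℕ) (h : (m, j) ∈ coneMonoid V) : coneRing V :=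
  AddMonoidAlgebra.single ⟨(m, j), h⟩ 1

lemma coneMonomial_mem (m : Fin n → ℤ) (j : ℕ) (h : (m, j) ∈ coneMonoid V) :
    coneMonomial m j h ∈ coneGrading V j :=
  AddMonoidAlgebra.single_mem_gradeBy (coneDegree V) _ _

lemma coneMonomial_ne_zero (m : Fin n → ℤ) (j : ℕ) (h : (m, j) ∈ coneMonoid V) :
    coneMonomial m j h ≠ 0 := by
  rw [coneMonomial, AddMonoidAlgebra.single_ne_zero]
  exact one_ne_zero

lemma coneMonomial_mul (m m' : Fin n → ℤ) (j j' : ℕ) (h : (m, j) ∈ coneMonoid V)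
    (h' : (m', j') ∈ coneMonoid V) :
    coneMonomial m j h * coneMonomial m' j' h' =
      coneMonomial (m + m') (j + j') ((coneMonoid V).add_mem h h') := by
  rw [coneMonomial, coneMonomial, AddMonoidAlgebra.single_mul_single, mul_one]
  rfl

lemma coneMonomial_pow (m : Fin n → ℤ) (j : ℕ) (h : (m, j) ∈ coneMonoid V) (e : ℕ) :
    coneMonomial m j h ^ e =
      coneMonomial (e • m) (e • j) ((coneMonoid V).nsmul_mem h e) := by
  rw [coneMonomial, AddMonoidAlgebra.single_pow, one_pow]
  rfl

/-- The section `s` of degree one, raised to a power. -/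
def sPow (V : Finset (Fin n → ℤ)) (j : ℕ) : coneRing V :=
  coneMonomial 0 j (zero_mem_coneMonoid V j)

lemma sPow_mem (j : ℕ) : sPow V j ∈ coneGrading V j := coneMonomial_mem _ _ _

lemma notMem_primeOf_genericPoint {D : coneRing V} (h : D ≠ 0) :
    D ∉ primeOf (genericPoint (toricVariety V)) := by
  rw [primeOf_genericPoint]
  exact h

/-- The inclusion of the function field into the fraction field of the cone ring. -/
abbrev fieldToFrac (V : Finset (Fin n → ℤ)) :
    (toricVariety V).functionField →+* FractionRing (coneRing V) :=
  stalkToFrac (genericPoint (toricVariety V))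

/-- The coordinate functions of the torus as rational functions. -/
def characterFun (V : Finset (Fin n → ℤ)) (m : Fin n → ℤ) : (toricVariety V).functionField :=
  stalkFrac (genericPoint (toricVariety V))
    ⟨coneMonomial m _ (mem_coneMonoid_of_level_le le_rfl), coneMonomial_mem _ _ _⟩
    ⟨sPow V (level V m), sPow_mem _⟩ (notMem_primeOf_genericPoint (coneMonomial_ne_zero _ _ _))

lemma algebraMap_coneMonomial_ne_zero (m : Fin n → ℤ) (j : ℕ) (h : (m, j) ∈ coneMonoid V) :
    algebraMap _ (FractionRing (coneRing V)) (coneMonomial m j h) ≠ 0 := by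
  rw [Ne, IsFractionRing.to_map_eq_zero_iff]
  exact coneMonomial_ne_zero _ _ _

/-- The fraction does not depend on the degree `j` in which the monomial is written, so any
convenient degree may be used in place of `level V m`. -/
lemma fieldToFrac_characterFun (m : Fin n → ℤ) (j : ℕ) (h : (m, j) ∈ coneMonoid V) :
    fieldToFrac V (characterFun V m) = algebraMap _ (FractionRing (coneRing V))
      (coneMonomial m j h) / algebraMap _ _ (sPow V j) := by
  refine (stalkToFrac_stalkFrac _ _ _ _).trans ?_
  refine (div_eq_div_iff (algebraMap_coneMonomial_ne_zero _ _ _)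
    (algebraMap_coneMonomial_ne_zero _ _ _)).mpr ?_
  rw [← map_mul, ← map_mul]
  congr 1
  refine (coneMonomial_mul _ _ _ _ _ _).trans (Eq.trans ?_ (coneMonomial_mul _ _ _ _ _ _).symm)
  simp only [add_zero, add_comm]

/-- The characters of the torus in the function field. -/
def character (V : Finset (Fin n → ℤ)) :
    Multiplicative (Fin n → ℤ) →* (toricVariety V).functionField where
  toFun m := characterFun V m.toAdd
  map_one' := by
    apply stalkToFrac_injective
    refine Eq.trans ?_ (map_one (fieldToFrac V)).symm
    exact (fieldToFrac_characterFun 0 0 (zero_mem_coneMonoid V 0)).trans <|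
      div_self (algebraMap_coneMonomial_ne_zero _ _ _)
  map_mul' a b := by
    apply stalkToFrac_injective
    have ha := mem_coneMonoid_of_level_le (V := V) (m := a.toAdd) le_rfl
    have hb := mem_coneMonoid_of_level_le (V := V) (m := b.toAdd) le_rfl
    refine (fieldToFrac_characterFun _ _ ((coneMonoid V).add_mem ha hb)).trans ?_
    refine Eq.trans ?_ (map_mul (fieldToFrac V) _ _).symm
    rw [fieldToFrac_characterFun _ _ ha, fieldToFrac_characterFun _ _ hb,
      div_mul_div_comm, ← map_mul, ← map_mul, coneMonomial_mul]
    simp only [sPow]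
    rw [coneMonomial_mul]
    simp only [add_zero]

/-- Laurent polynomials as rational functions. -/
def toField (V : Finset (Fin n → ℤ)) : Laurent n →ₐ[ℂ] (toricVariety V).functionField :=
  AddMonoidAlgebra.lift ℂ _ _ (character V)

/-- Setting the variable `s` to `1`. -/
def dehom (V : Finset (Fin n → ℤ)) : coneRing V →ₐ[ℂ] Laurent n :=
  AddMonoidAlgebra.mapDomainAlgHom ℂ ℂ
    ((AddMonoidHom.fst (Fin n → ℤ) ℕ).comp (coneMonoid V).subtype)

lemma dehom_single (q : coneMonoid V) (c : ℂ) :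
    dehom V (AddMonoidAlgebra.single q c) = AddMonoidAlgebra.single q.1.1 c := by
  simp [dehom]

lemma dehom_coneMonomial (m : Fin n → ℤ) (j : ℕ) (h : (m, j) ∈ coneMonoid V) :
    dehom V (coneMonomial m j h) = AddMonoidAlgebra.single m 1 := dehom_single _ _

lemma dehom_sPow (j : ℕ) : dehom V (sPow V j) = 1 := dehom_single _ _

lemma toField_single (m : Fin n → ℤ) (c : ℂ) :
    toField V (AddMonoidAlgebra.single m c) =
      algebraMap ℂ _ c * character V (Multiplicative.ofAdd m) := by
  rw [toField, AddMonoidAlgebra.lift_single, Algebra.smul_def]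

lemma homogeneous_induction {j : ℕ} {p : coneRing V → Prop} (h0 : p 0)
    (hadd : ∀ a b, p a → p b → p (a + b))
    (hs : ∀ (m : Fin n → ℤ) (h : (m, j) ∈ coneMonoid V) (c : ℂ),
      p (AddMonoidAlgebra.single ⟨(m, j), h⟩ c)) {N : coneRing V} (hN : N ∈ coneGrading V j) :
    p N := by
  rw [← AddMonoidAlgebra.sum_coeff_single N]
  refine Finset.sum_induction _ p hadd h0 fun q hq => ?_
  have : q.1.2 = j := hN q hq
  obtain ⟨⟨m, i⟩, hqm⟩ := q
  subst this
  exact hs m hqm _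

/-- By linearity it suffices to look at monomials. This is the bridge between the two models of the
function field, fractions of homogeneous elements and quotients of Laurent polynomials. -/
lemma fieldToFrac_toField_dehom {j : ℕ} {N : coneRing V} (hN : N ∈ coneGrading V j) :
    fieldToFrac V (toField V (dehom V N)) =
      algebraMap _ (FractionRing (coneRing V)) N / algebraMap _ _ (sPow V j) := by
  refine homogeneous_induction (p := fun N => fieldToFrac V (toField V (dehom V N)) =
    algebraMap _ (FractionRing (coneRing V)) N / algebraMap _ _ (sPow V j)) ?_ ?_ ?_ hN
  · simp
  · intro a b ha hb
    rw [map_add, map_add, map_add, ha, hb, map_add, add_div]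
  · intro m h c
    rw [dehom_single, toField_single, map_mul]
    refine (congrArg₂ _ (stalkToFrac_algebraMap_complex _ c)
      (fieldToFrac_characterFun m j h)).trans ?_
    rw [mul_div_assoc', ← map_mul]
    congr 2
    rw [← Algebra.smul_def, coneMonomial, AddMonoidAlgebra.smul_single, smul_eq_mul, mul_one]

lemma exists_homogeneous {j : ℕ} (g : Laurent n)
    (hg : ∀ m, g.coeff m ≠ 0 → (m, j) ∈ coneMonoid V) :
    ∃ N ∈ coneGrading V j, dehom V N = g := by
  refine ⟨∑ m ∈ g.coeff.support.attach, AddMonoidAlgebra.single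
    ⟨(m.1, j), hg m.1 (Finsupp.mem_support_iff.mp m.2)⟩ (g.coeff m.1), ?_, ?_⟩
  · exact Submodule.sum_mem _ fun m _ => AddMonoidAlgebra.single_mem_gradeBy (coneDegree V) _ _
  · rw [map_sum]
    simp only [dehom_single]
    rw [Finset.sum_attach g.coeff.support
      (fun m => AddMonoidAlgebra.single m (g.coeff m))]
    exact AddMonoidAlgebra.sum_coeff_single g

lemma exists_homogeneous_of_large (V : Finset (Fin n → ℤ)) (g : Laurent n) :
    ∃ J, ∀ j ≥ J, ∃ N ∈ coneGrading V j, dehom V N = g := by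
  refine ⟨∑ m ∈ g.coeff.support, level V m, fun j hj => exists_homogeneous g fun m hm => ?_⟩
  refine mem_coneMonoid_of_level_le (le_trans ?_ hj)
  exact Finset.single_le_sum (f := level V) (fun _ _ => Nat.zero_le _)
    (Finsupp.mem_support_iff.mpr hm)

lemma toField_injective (V : Finset (Fin n → ℤ)) : Function.Injective (toField V) := by
  rw [injective_iff_map_eq_zero]
  intro g hg
  obtain ⟨j, hj⟩ := exists_homogeneous_of_large V g
  obtain ⟨N, hN, rfl⟩ := hj j le_rfl
  have h := fieldToFrac_toField_dehom hN
  rw [hg, map_zero, eq_comm, div_eq_zero_iff] at h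
  have hN0 : N = 0 := by
    rcases h with h | h
    · exact (IsFractionRing.to_map_eq_zero_iff).mp h
    · exact absurd h (algebraMap_coneMonomial_ne_zero _ _ _)
  rw [hN0, map_zero]

lemma dehom_ne_zero {j : ℕ} {N : coneRing V} (hN : N ∈ coneGrading V j) (h0 : N ≠ 0) :
    dehom V N ≠ 0 := by
  intro h
  have h1 := fieldToFrac_toField_dehom hN
  rw [h, map_zero, map_zero, eq_comm, div_eq_zero_iff] at h1
  rcases h1 with h1 | h1
  · exact h0 ((IsFractionRing.to_map_eq_zero_iff).mp h1)
  · exact absurd h1 (algebraMap_coneMonomial_ne_zero _ _ _)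

lemma toField_dehom_ne_zero {j : ℕ} {N : coneRing V} (hN : N ∈ coneGrading V j) (h0 : N ≠ 0) :
    toField V (dehom V N) ≠ 0 := by
  rw [Ne, map_eq_zero_iff _ (toField_injective V)]
  exact dehom_ne_zero hN h0

lemma ne_zero_of_notMem_primeOf {x : toricVariety V} {D : coneRing V} (hD : D ∉ primeOf x) :
    D ≠ 0 := by
  rintro rfl
  exact hD (zero_mem _)

lemma algebraMap_stalkFrac_eq (x : toricVariety V) {j : ℕ} (N D : coneGrading V j)
    (hD : D.1 ∉ primeOf x) :
    algebraMap _ (toricVariety V).functionField (stalkFrac x N D hD) =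
      toField V (dehom V N.1) / toField V (dehom V D.1) := by
  apply stalkToFrac_injective
  rw [algebraMap_stalkFrac, map_div₀, fieldToFrac_toField_dehom N.2,
    fieldToFrac_toField_dehom D.2, div_div_div_cancel_right₀]
  exact algebraMap_coneMonomial_ne_zero _ _ _

/-- The rational functions that are regular at a point. -/
lemma mem_range_stalk_iff (x : toricVariety V) (f : (toricVariety V).functionField) :
    f ∈ (algebraMap ((toricVariety V).presheaf.stalk x) (toricVariety V).functionField).range ↔
      ∃ j, ∃ N ∈ coneGrading V j, ∃ D ∈ coneGrading V j, D ∉ primeOf x ∧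
        f = toField V (dehom V N) / toField V (dehom V D) := by
  constructor
  · rintro ⟨a, rfl⟩
    obtain ⟨j, N, D, hD, rfl⟩ := exists_stalkFrac x a
    exact ⟨j, N, N.2, D, D.2, hD, algebraMap_stalkFrac_eq _ _ _ _⟩
  · rintro ⟨j, N, hN, D, hD, hx, rfl⟩
    exact ⟨stalkFrac x ⟨N, hN⟩ ⟨D, hD⟩ hx, algebraMap_stalkFrac_eq _ _ _ _⟩

lemma exists_eq_div (f : (toricVariety V).functionField) :
    ∃ a b : Laurent n, b ≠ 0 ∧ f = toField V a / toField V b := by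
  obtain ⟨j, N, hN, D, hD, hx, h⟩ := (mem_range_stalk_iff (genericPoint (toricVariety V)) f).mp (by
    obtain ⟨j, N, D, hD, rfl⟩ := exists_stalkFrac _ f
    refine ⟨stalkFrac _ N D hD, ?_⟩
    exact stalkFrac_specializes _ N D hD hD)
  exact ⟨_, _, dehom_ne_zero hD (ne_zero_of_notMem_primeOf hx), h⟩

/-! ### Vertices of Fano polytopes -/

/-- The real point of an integral point. -/
abbrev toReal (v : Fin n → ℤ) : Fin n → ℝ := fun i => (v i : ℝ)

lemma toReal_dotProduct (v w : Fin n → ℤ) : toReal v ⬝ᵥ toReal w = ((v ⬝ᵥ w : ℤ) : ℝ) := by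
  simp [dotProduct]

/-- Otherwise the convex hull lies in the half space `⟨·, μ⟩ ≤ 0`, which contains no positive
multiple of `μ` and so is not a neighbourhood of the origin. -/
lemma IsFanoPolytope.exists_dotProduct_pos (hV : IsFanoPolytope V) {μ : Fin n → ℝ} (hμ : μ ≠ 0) :
    ∃ v ∈ V, 0 < toReal v ⬝ᵥ μ := by
  by_contra! h
  have hsub : convexHull ℝ (toReal '' (V : Set (Fin n → ℤ))) ⊆ {p | p ⬝ᵥ μ ≤ 0} := by
    refine convexHull_min ?_ ?_
    · rintro _ ⟨v, hv, rfl⟩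
      exact h v hv
    · exact convex_halfSpace_le ⟨fun a b => add_dotProduct a b μ,
        fun c a => smul_dotProduct c a μ⟩ 0
  have h0 := mem_interior_iff_mem_nhds.mp hV.zero_mem_interior
  have hc : Tendsto (fun t : ℝ => t • μ) (𝓝 0) (𝓝 0) := by
    have : Continuous fun t : ℝ => t • μ := by fun_prop
    simpa using this.tendsto 0
  have h1 : ∀ᶠ t : ℝ in 𝓝[>] 0, (t • μ) ⬝ᵥ μ ≤ 0 :=
    (hc.mono_left nhdsWithin_le_nhds).eventually (Filter.mem_of_superset h0 hsub)
  obtain ⟨t, ht, ht0⟩ := (h1.and self_mem_nhdsWithin).exists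
  have hpos : 0 < μ ⬝ᵥ μ := by
    refine lt_of_le_of_ne (Finset.sum_nonneg fun i _ => mul_self_nonneg _) fun h => hμ ?_
    exact dotProduct_self_eq_zero.mp h.symm
  rw [smul_dotProduct, smul_eq_mul] at ht
  have := mul_pos (Set.mem_Ioi.mp ht0) hpos
  linarith

lemma IsFanoPolytope.ne_zero (hV : IsFanoPolytope V) {v : Fin n → ℤ} (hv : v ∈ V) : v ≠ 0 := by
  rintro rfl
  exact not_isUnit_zero (hV.primitive 0 hv 0 0 (by simp))

/-- Finitely many strict inequalities define an open set, which contains a rational point. Clearing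
denominators keeps the signs. -/
lemma exists_int_separating {S : Finset (Fin n → ℤ)} {μ : Fin n → ℝ}
    (h : ∀ d ∈ S, 0 < toReal d ⬝ᵥ μ) : ∃ l : Fin n → ℤ, ∀ d ∈ S, 0 < d ⬝ᵥ l := by
  have hopen : IsOpen {p : Fin n → ℝ | ∀ d ∈ S, 0 < toReal d ⬝ᵥ p} := by
    have : {p : Fin n → ℝ | ∀ d ∈ S, 0 < toReal d ⬝ᵥ p} = ⋂ d ∈ S, {p | 0 < toReal d ⬝ᵥ p} := by
      ext; simp
    rw [this]
    refine isOpen_biInter_finset fun d _ => isOpen_lt continuous_const ?_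
    unfold dotProduct
    fun_prop
  have hdense : DenseRange (fun q : Fin n → ℚ => fun i => (q i : ℝ)) :=
    DenseRange.piMap fun _ => Rat.denseRange_cast
  obtain ⟨q, hq⟩ := hdense.exists_mem_open hopen ⟨μ, h⟩
  let N : ℕ := ∏ i, (q i).den
  have hN : 0 < N := Finset.prod_pos fun i _ => (q i).den_pos
  have hint : ∀ i, ∃ z : ℤ, (z : ℚ) = N * q i := by
    intro i
    obtain ⟨c, hc⟩ : (q i).den ∣ N := Finset.dvd_prod_of_mem _ (Finset.mem_univ i)
    refine ⟨c * (q i).num, ?_⟩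
    rw [hc]
    push_cast
    have := Rat.mul_den_eq_num (q i)
    linear_combination -(c : ℚ) * this
  choose z hz using hint
  refine ⟨z, fun d hd => ?_⟩
  have h1 := hq d hd
  have h2 : ((d ⬝ᵥ z : ℤ) : ℝ) = N * (toReal d ⬝ᵥ fun i => (q i : ℝ)) := by
    simp only [dotProduct, Int.cast_sum, Int.cast_mul, Finset.mul_sum]
    refine Finset.sum_congr rfl fun i _ => ?_
    have : ((z i : ℤ) : ℝ) = N * q i := by exact_mod_cast congrArg (fun t : ℚ => (t : ℝ)) (hz i)
    rw [this]
    ring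
  have h3 : (0 : ℝ) < ((d ⬝ᵥ z : ℤ) : ℝ) := by
    rw [h2]
    exact mul_pos (by exact_mod_cast hN) h1
  exact_mod_cast h3

/-- A vertex is not in the hull of the others, so Hahn-Banach separates it strictly, and the
separating functional can be made integral. Positivity at `v` holds because a nonzero functional is
positive at some vertex and `v` attains the maximum. -/
lemma IsFanoPolytope.exists_separating (hV : IsFanoPolytope V) {v : Fin n → ℤ} (hv : v ∈ V) :
    ∃ l : Fin n → ℤ, 0 < v ⬝ᵥ l ∧ ∀ v' ∈ V, v' ≠ v → v' ⬝ᵥ l < v ⬝ᵥ l := by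
  classical
  have hfin : (toReal '' {u | u ∈ V ∧ u ≠ v} : Set (Fin n → ℝ)).Finite :=
    (V.finite_toSet.subset fun u hu => hu.1).image _
  obtain ⟨f, u, hf, hu⟩ := geometric_hahn_banach_closed_point (convex_convexHull ℝ _)
    (hfin.isClosed_convexHull ℝ) (hV.vertex v hv)
  let μ : Fin n → ℝ := fun i => f (Pi.single i 1)
  have hμ : ∀ p : Fin n → ℝ, f p = p ⬝ᵥ μ := by
    intro p
    conv_lhs => rw [← Finset.univ_sum_single p]
    rw [map_sum]
    refine Finset.sum_congr rfl fun i _ => ?_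
    have : (Pi.single i (p i) : Fin n → ℝ) = p i • Pi.single i 1 := by
      rw [← Pi.single_smul, smul_eq_mul, mul_one]
    rw [this, map_smul, smul_eq_mul]
  obtain ⟨l, hl⟩ := exists_int_separating (S := (V.erase v).image fun v' => v - v') (μ := μ) (by
    intro d hd
    obtain ⟨v', hv', rfl⟩ := Finset.mem_image.mp hd
    obtain ⟨hne, hv'⟩ := Finset.mem_erase.mp hv'
    have h1 := hf _ (subset_convexHull ℝ _ ⟨v', ⟨hv', hne⟩, rfl⟩)
    have h2 : toReal (v - v') = toReal v - toReal v' := by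
      funext i; simp [toReal]
    rw [h2, sub_dotProduct, ← hμ, ← hμ]
    change f (toReal v') < u at h1
    change u < f (toReal v) at hu
    linarith)
  have hl' : ∀ v' ∈ V, v' ≠ v → v' ⬝ᵥ l < v ⬝ᵥ l := by
    intro v' hv' hne
    have := hl _ (Finset.mem_image_of_mem _ (Finset.mem_erase.mpr ⟨hne, hv'⟩))
    rw [sub_dotProduct] at this
    linarith
  refine ⟨l, ?_, hl'⟩
  -- For `l = 0` the strict inequalities leave `v` as the only vertex, and the hull cannot reach in
  -- the direction of `-v`.
  by_cases hl0 : l = 0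
  · subst hl0
    obtain ⟨v', hv', hpos⟩ := hV.exists_dotProduct_pos (μ := -toReal v) (by
      intro h
      refine hV.ne_zero hv (funext fun i => ?_)
      have := congrFun h i
      simpa using this)
    have hvv : v' = v := by
      by_contra hne
      simpa using hl' v' hv' hne
    subst hvv
    rw [dotProduct_neg] at hpos
    have : 0 ≤ toReal v' ⬝ᵥ toReal v' := Finset.sum_nonneg fun i _ => mul_self_nonneg _
    linarith
  · obtain ⟨v', hv', hpos⟩ := hV.exists_dotProduct_pos (μ := toReal l) (by
      intro h
      refine hl0 (funext fun i => ?_)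
      have := congrFun h i
      simpa using this)
    rw [toReal_dotProduct, Int.cast_pos] at hpos
    by_cases hne : v' = v
    · rwa [hne] at hpos
    · exact hpos.trans (hl' v' hv' hne)

/-- A generator of the ideal spanned by the coordinates divides `v`, so it is a unit by primitivity,
and Bézout gives `u`. -/
lemma IsFanoPolytope.exists_dotProduct_eq_one (hV : IsFanoPolytope V) {v : Fin n → ℤ} (hv : v ∈ V) :
    ∃ u : Fin n → ℤ, v ⬝ᵥ u = 1 := by
  obtain ⟨d, hd⟩ := (IsPrincipalIdealRing.principal (Ideal.span (Set.range v))).principal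
  have h1 : ∀ i, ∃ w, v i = d * w := by
    intro i
    have : v i ∈ Ideal.span (Set.range v) := Ideal.subset_span ⟨i, rfl⟩
    rw [hd] at this
    obtain ⟨w, hw⟩ := Submodule.mem_span_singleton.mp this
    exact ⟨w, by rw [← hw, smul_eq_mul, mul_comm]⟩
  choose w hw using h1
  have hu := hV.primitive v hv d w (funext hw)
  have h2 : (1 : ℤ) ∈ Ideal.span (Set.range v) := by
    rw [hd, Ideal.submodule_span_eq, Ideal.span_singleton_eq_top.mpr hu]
    trivial
  obtain ⟨c, hc⟩ := (Ideal.mem_span_range_iff_exists_fun).mp h2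
  exact ⟨c, by simpa [dotProduct, mul_comm] using hc⟩

/-- A basis of the rational vector space with vectors in a given dual cone, all but one of which
are orthogonal to `v`. -/
lemma exists_basis_of_ray {F : Finset (Fin n → ℤ)} {v u w : Fin n → ℤ}
    (hu : v ⬝ᵥ u = 1) (hw : v ⬝ᵥ w = 0) (hF : ∀ v' ∈ F, v' ≠ v → 0 < v' ⬝ᵥ w) :
    ∃ m : Fin n → Fin n → ℤ, (∀ i, ∀ v' ∈ F, 0 ≤ v' ⬝ᵥ m i) ∧ (Matrix.of m).det ≠ 0 ∧
      v ⬝ᵥ ∑ i, m i = 1 := by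
  classical
  obtain ⟨i₀, hi₀⟩ : ∃ i, v i ≠ 0 := by
    by_contra! h
    have : v = 0 := funext h
    simp [this] at hu
  -- Apart from `u`, these vectors span the orthogonal complement of `v` over `ℚ`. Adding a large
  -- multiple of `w` moves all of them into the dual cone without changing their pairing with `v`.
  let p : Fin n → Fin n → ℤ := fun i => if i = i₀ then u else
    v i₀ • Pi.single i 1 - v i • Pi.single i₀ 1
  have hvp : ∀ i, v ⬝ᵥ p i = if i = i₀ then 1 else 0 := by
    intro i
    by_cases h : i = i₀
    · simp [p, h, hu]
    · simp only [p, h, if_false, dotProduct_sub, dotProduct_smul, dotProduct_single, smul_eq_mul]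
      ring
  let B : ℤ := ∑ v' ∈ F, ∑ i, |v' ⬝ᵥ p i|
  have hB : ∀ v' ∈ F, ∀ i, -B ≤ v' ⬝ᵥ p i := by
    intro v' hv' i
    have h1 := Finset.single_le_sum (f := fun v' => ∑ i, |v' ⬝ᵥ p i|)
      (fun _ _ => Finset.sum_nonneg fun _ _ => abs_nonneg _) hv'
    have h2 := Finset.single_le_sum (f := fun i => |v' ⬝ᵥ p i|)
      (fun _ _ => abs_nonneg _) (Finset.mem_univ i)
    have h3 := neg_abs_le (v' ⬝ᵥ p i)
    beta_reduce at h1 h2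
    linarith
  have hB0 : 0 ≤ B := Finset.sum_nonneg fun _ _ => Finset.sum_nonneg fun _ _ => abs_nonneg _
  let W : ℤ := ∑ i ∈ Finset.univ.erase i₀, w i
  -- The second condition keeps the shifted vectors independent. If it fails at `B`, it holds at `B
  -- + 1`, since failure at both would give `W = 0` and then `v i₀ = 0`.
  obtain ⟨N, hN, hNW⟩ : ∃ N : ℤ, B ≤ N ∧ v i₀ + N * W ≠ 0 := by
    by_cases h : v i₀ + B * W = 0
    · refine ⟨B + 1, by linarith, fun h' => ?_⟩
      have hW : W = 0 := by linear_combination h' - h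
      rw [hW] at h
      exact hi₀ (by simpa using h)
    · exact ⟨B, le_rfl, h⟩
  refine ⟨fun i => p i + N • w, fun i v' hv' => ?_, ?_, ?_⟩
  · rw [dotProduct_add, dotProduct_smul, smul_eq_mul]
    by_cases h : v' = v
    · subst h
      rw [hw, hvp]
      split_ifs <;> simp
    · have h1 := hF v' hv' h
      have h2 := hB v' hv' i
      nlinarith
  · intro hdet
    obtain ⟨c, hc0, hc⟩ := Matrix.exists_vecMul_eq_zero_iff.mpr hdet
    have hck : ∀ k, ∑ i, c i * (p i k + N * w k) = 0 := by
      intro k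
      have := congrFun hc k
      simpa [Matrix.vecMul, dotProduct] using this
    have hci : c i₀ = 0 := by
      have h1 : ∑ i, c i * (v ⬝ᵥ (p i + N • w)) = 0 := by
        have : ∑ k, v k * ∑ i, c i * (p i k + N * w k) = 0 := by simp [hck]
        rw [← this]
        simp only [dotProduct, Finset.mul_sum, Pi.add_apply, Pi.smul_apply, smul_eq_mul]
        rw [Finset.sum_comm]
        refine Finset.sum_congr rfl fun i _ => Finset.sum_congr rfl fun k _ => by ring
      have h2 : ∀ i, v ⬝ᵥ (p i + N • w) = if i = i₀ then 1 else 0 := by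
        intro i
        rw [dotProduct_add, dotProduct_smul, hw, hvp, smul_zero, add_zero]
      simpa only [h2, mul_ite, mul_one, mul_zero, Finset.sum_ite_eq', Finset.mem_univ,
        if_true] using h1
    have hsum : ∀ k, k ≠ i₀ → c k * v i₀ + N * w k * ∑ i, c i = 0 := by
      intro k hk
      have h1 := hck k
      have h2 : ∑ i, c i * p i k = c k * v i₀ := by
        rw [Finset.sum_eq_single k]
        · simp [p, hk]
        · intro i _ hik
          by_cases h : i = i₀
          · rw [h, hci, zero_mul]
          · simp [p, h, hk, Ne.symm hik]
        · simp
      simp only [mul_add, Finset.sum_add_distrib] at h1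
      rw [h2, ← Finset.sum_mul] at h1
      linear_combination h1
    -- Summing the relations over `k ≠ i₀` isolates the sum of the coefficients; its factor is
    -- nonzero by the choice of `N`.
    have hC : (∑ i, c i) * (v i₀ + N * W) = 0 := by
      have h1 : ∑ k ∈ Finset.univ.erase i₀, (c k * v i₀ + N * w k * ∑ i, c i) = 0 :=
        Finset.sum_eq_zero fun k hk => hsum k (Finset.ne_of_mem_erase hk)
      rw [Finset.sum_add_distrib, ← Finset.sum_mul, ← Finset.sum_mul, ← Finset.mul_sum] at h1
      have h2 : ∑ k ∈ Finset.univ.erase i₀, c k = ∑ i, c i := by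
        rw [← Finset.add_sum_erase _ _ (Finset.mem_univ i₀), hci, zero_add]
      rw [h2] at h1
      linear_combination h1
    have hC0 := (mul_eq_zero.mp hC).resolve_right hNW
    refine hc0 (funext fun k => ?_)
    by_cases hk : k = i₀
    · rw [hk, hci]; rfl
    · have := hsum k hk
      rw [hC0, mul_zero, add_zero] at this
      exact (mul_eq_zero.mp this).resolve_right hi₀
  · rw [dotProduct_sum]
    simp only [dotProduct_add, dotProduct_smul, hw, hvp, smul_zero, add_zero]
    simp

/-! ### Orders of Laurent polynomials along divisors -/

/-- Laurent polynomials of order at least `k` along the divisor of `v`. -/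
def ordGE (v : Fin n → ℤ) (k : ℤ) : Submodule ℂ (Laurent n) where
  carrier := {g | ∀ m, g.coeff m ≠ 0 → k ≤ v ⬝ᵥ m}
  zero_mem' := by simp
  add_mem' := by
    intro a b ha hb m hm
    by_cases h : a.coeff m = 0
    · exact hb m fun h' => hm (by simp [h, h'])
    · exact ha m h
  smul_mem' := by
    intro c a ha m hm
    exact ha m fun h => hm (by simp [h])

lemma mem_ordGE {v : Fin n → ℤ} {k : ℤ} {g : Laurent n} :
    g ∈ ordGE v k ↔ ∀ m, g.coeff m ≠ 0 → k ≤ v ⬝ᵥ m := Iff.rfl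

lemma single_mem_ordGE {v m : Fin n → ℤ} {k : ℤ} (c : ℂ) (h : k ≤ v ⬝ᵥ m) :
    AddMonoidAlgebra.single m c ∈ ordGE v k := by
  intro m' hm'
  rw [AddMonoidAlgebra.coeff_single, Finsupp.single_apply] at hm'
  split_ifs at hm' with h'
  · rwa [← h']
  · exact absurd rfl hm'

lemma one_mem_ordGE (v : Fin n → ℤ) : (1 : Laurent n) ∈ ordGE v 0 :=
  single_mem_ordGE 1 (by simp)

lemma ordGE_mono {v : Fin n → ℤ} {k l : ℤ} (h : k ≤ l) : ordGE v l ≤ ordGE v k :=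
  fun _ hg m hm => h.trans (hg m hm)

lemma eq_sum_single (g : Laurent n) :
    g = ∑ m ∈ g.coeff.support, AddMonoidAlgebra.single m (g.coeff m) :=
  (AddMonoidAlgebra.sum_coeff_single g).symm

lemma mul_mem_ordGE {v : Fin n → ℤ} {k l : ℤ} {a b : Laurent n} (ha : a ∈ ordGE v k)
    (hb : b ∈ ordGE v l) : a * b ∈ ordGE v (k + l) := by
  rw [eq_sum_single a, eq_sum_single b, Finset.sum_mul_sum]
  refine Submodule.sum_mem _ fun m hm => Submodule.sum_mem _ fun m' hm' => ?_
  rw [AddMonoidAlgebra.single_mul_single]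
  refine single_mem_ordGE _ ?_
  rw [dotProduct_add]
  exact add_le_add (ha m (Finsupp.mem_support_iff.mp hm)) (hb m' (Finsupp.mem_support_iff.mp hm'))

lemma pow_mem_ordGE {v : Fin n → ℤ} {k : ℤ} {a : Laurent n} (ha : a ∈ ordGE v k) (e : ℕ) :
    a ^ e ∈ ordGE v (e * k) := by
  induction e with
  | zero => simpa using one_mem_ordGE v
  | succ e ih =>
    rw [pow_succ]
    convert mul_mem_ordGE ih ha using 2
    push_cast
    ring

/-- The part of a Laurent polynomial of weight `k`. -/
def weightPart (v : Fin n → ℤ) (k : ℤ) (g : Laurent n) : Laurent n :=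
  AddMonoidAlgebra.ofCoeff (g.coeff.filter fun m => v ⬝ᵥ m = k)

lemma coeff_weightPart (v : Fin n → ℤ) (k : ℤ) (g : Laurent n) (m : Fin n → ℤ) :
    (weightPart v k g).coeff m = if v ⬝ᵥ m = k then g.coeff m else 0 :=
  Finsupp.filter_apply _ _ _

lemma sub_weightPart_mem {v : Fin n → ℤ} {k : ℤ} {g : Laurent n} (hg : g ∈ ordGE v k) :
    g - weightPart v k g ∈ ordGE v (k + 1) := by
  intro m hm
  rw [AddMonoidAlgebra.coeff_sub, Finsupp.sub_apply, coeff_weightPart] at hm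
  split_ifs at hm with h
  · exact absurd (sub_self _) hm
  · have := hg m (by simpa using hm)
    omega

lemma weightPart_eq_zero_iff {v : Fin n → ℤ} {k : ℤ} {g : Laurent n} (hg : g ∈ ordGE v k) :
    weightPart v k g = 0 ↔ g ∈ ordGE v (k + 1) := by
  constructor
  · intro h
    have := sub_weightPart_mem hg
    rwa [h, sub_zero] at this
  · intro h
    ext m
    rw [coeff_weightPart, AddMonoidAlgebra.coeff_zero, Finsupp.zero_apply]
    split_ifs with hm
    · by_contra hne
      have := h m hne
      omega
    · rfl

lemma weightPart_mem {v : Fin n → ℤ} {k : ℤ} {g : Laurent n} {m : Fin n → ℤ}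
    (hm : (weightPart v k g).coeff m ≠ 0) : v ⬝ᵥ m = k := by
  rw [coeff_weightPart] at hm
  by_contra h
  rw [if_neg h] at hm
  exact hm rfl

/-- Orders along a divisor are additive. -/
lemma mul_notMem_ordGE {v : Fin n → ℤ} {k l : ℤ} {a b : Laurent n} (ha : a ∈ ordGE v k)
    (hb : b ∈ ordGE v l) (ha' : a ∉ ordGE v (k + 1)) (hb' : b ∉ ordGE v (l + 1)) :
    a * b ∉ ordGE v (k + l + 1) := by
  have hwa := (weightPart_eq_zero_iff ha).not.mpr ha'
  have hwb := (weightPart_eq_zero_iff hb).not.mpr hb'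
  have hmem : ∀ {k : ℤ} {g : Laurent n}, weightPart v k g ∈ ordGE v k := fun m hm =>
    (weightPart_mem hm).ge
  have hne : weightPart v k a * weightPart v l b ≠ 0 := mul_ne_zero hwa hwb
  intro hab
  -- Only the leading parts matter. Their product is nonzero because Laurent polynomials form a
  -- domain.
  have h1 : weightPart v k a * weightPart v l b ∈ ordGE v (k + l + 1) := by
    have h2 : weightPart v k a * weightPart v l b = a * b - (a - weightPart v k a) * b -
        weightPart v k a * (b - weightPart v l b) := by ring
    rw [h2]
    refine sub_mem (sub_mem hab ?_) ?_
    · convert mul_mem_ordGE (sub_weightPart_mem ha) hb using 2; ring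
    · convert mul_mem_ordGE (hmem (k := k) (g := a)) (sub_weightPart_mem hb) using 2; ring
  refine hne ?_
  ext m
  rw [AddMonoidAlgebra.coeff_zero, Finsupp.zero_apply]
  by_contra hm
  have h3 := h1 m hm
  -- The order with respect to `-v` bounds the weights from above, so every term of the product has
  -- weight exactly `k + l`.
  have h4 : weightPart v k a * weightPart v l b ∈ ordGE (-v) (-(k + l)) := by
    rw [neg_add]
    refine mul_mem_ordGE (fun m hm => ?_) (fun m hm => ?_) <;>
    · rw [neg_dotProduct, weightPart_mem hm]
  have h5 := h4 m hm
  rw [neg_dotProduct] at h5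
  omega

lemma exists_ord {v : Fin n → ℤ} {g : Laurent n} (hg : g ≠ 0) :
    ∃ k, g ∈ ordGE v k ∧ g ∉ ordGE v (k + 1) := by
  have hs : g.coeff.support.Nonempty := by
    rw [Finsupp.support_nonempty_iff]
    exact fun h => hg (AddMonoidAlgebra.coeff_eq_zero.mp h)
  obtain ⟨m, hm, hmin⟩ := g.coeff.support.exists_min_image (fun m => v ⬝ᵥ m) hs
  refine ⟨v ⬝ᵥ m, fun m' hm' => hmin m' (Finsupp.mem_support_iff.mpr hm'), fun h => ?_⟩
  have := h m (Finsupp.mem_support_iff.mp hm)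
  omega

lemma mem_ordGE_of_mul {v : Fin n → ℤ} {k l : ℤ} {a b : Laurent n} (hb : b ∈ ordGE v l)
    (hb' : b ∉ ordGE v (l + 1)) (hab : a * b ∈ ordGE v (k + l)) : a ∈ ordGE v k := by
  by_cases h0 : a = 0
  · rw [h0]; exact zero_mem _
  obtain ⟨i, hi, hi'⟩ := exists_ord (v := v) h0
  by_contra ha
  have hik : i < k := by
    by_contra! h
    exact ha (ordGE_mono h hi)
  exact mul_notMem_ordGE hi hb hi' hb' (ordGE_mono (by omega) hab)

lemma dehom_mem_ordGE {j : ℕ} {N : coneRing V} (hN : N ∈ coneGrading V j) {v : Fin n → ℤ}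
    (hv : v ∈ V) : dehom V N ∈ ordGE v (-j) := by
  refine homogeneous_induction (p := fun N => dehom V N ∈ ordGE v (-j)) ?_ ?_ ?_ hN
  · rw [map_zero]; exact zero_mem _
  · intro a b ha hb
    rw [map_add]
    exact add_mem ha hb
  · intro m h c
    rw [dehom_single]
    exact single_mem_ordGE _ (h v hv)

/-! ### The divisors through a point -/

open Classical in
/-- The vertices `v` such that the point lies on the divisor of `v`. -/
def facetSet (x : toricVariety V) : Finset (Fin n → ℤ) :=
  V.filter fun v => ∀ (m : Fin n → ℤ) (j : ℕ) (h : (m, j) ∈ coneMonoid V),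
    coneMonomial m j h ∉ primeOf x → v ⬝ᵥ m = -j

lemma mem_facetSet {x : toricVariety V} {v : Fin n → ℤ} : v ∈ facetSet x ↔
    v ∈ V ∧ ∀ (m : Fin n → ℤ) (j : ℕ) (h : (m, j) ∈ coneMonoid V),
      coneMonomial m j h ∉ primeOf x → v ⬝ᵥ m = -j := by
  simp [facetSet]

lemma mem_of_mem_facetSet {x : toricVariety V} {v : Fin n → ℤ} (hv : v ∈ facetSet x) : v ∈ V :=
  (mem_facetSet.mp hv).1

lemma dotProduct_of_mem_facetSet {x : toricVariety V} {v : Fin n → ℤ} (hv : v ∈ facetSet x)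
    {m : Fin n → ℤ} {j : ℕ} (h : (m, j) ∈ coneMonoid V) (hx : coneMonomial m j h ∉ primeOf x) :
    v ⬝ᵥ m = -j :=
  (mem_facetSet.mp hv).2 m j h hx

/-- Otherwise the prime contains all monomials of positive degree, hence the irrelevant ideal,
contrary to the definition of `Proj`. -/
lemma exists_coneMonomial_notMem (x : toricVariety V) :
    ∃ (b : Fin n → ℤ) (i : ℕ) (h : (b, i) ∈ coneMonoid V), 0 < i ∧
      coneMonomial b i h ∉ primeOf x := by
  by_contra! hcon
  refine ProjectiveSpectrum.not_irrelevant_le (𝒜 := coneGrading V) x ?_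
  refine (HomogeneousIdeal.toIdeal_irrelevant_le (coneGrading V) (I := primeOf x)).mpr
    fun i hi N hN => ?_
  refine homogeneous_induction (p := fun N => N ∈ primeOf x) (zero_mem _)
    (fun a b => add_mem) (fun m h c => ?_) hN
  have h1 := hcon m i h hi
  have h2 : (AddMonoidAlgebra.single ⟨(m, i), h⟩ c : coneRing V) =
      algebraMap ℂ (coneRing V) c * coneMonomial m i h := by
    rw [← Algebra.smul_def, coneMonomial, AddMonoidAlgebra.smul_single, smul_eq_mul, mul_one]
  rw [h2]
  exact Ideal.mul_mem_left _ _ h1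

/-- A monomial that does not vanish at `x` but vanishes along all divisors not through `x`. -/
lemma exists_witness (x : toricVariety V) :
    ∃ (b : Fin n → ℤ) (i : ℕ) (h : (b, i) ∈ coneMonoid V), 0 < i ∧
      coneMonomial b i h ∉ primeOf x ∧ ∀ v ∈ V, v ∉ facetSet x → -(i : ℤ) < v ⬝ᵥ b := by
  classical
  suffices H : ∀ S ⊆ V, ∃ (b : Fin n → ℤ) (i : ℕ) (h : (b, i) ∈ coneMonoid V), 0 < i ∧
      coneMonomial b i h ∉ primeOf x ∧ ∀ v ∈ S, v ∉ facetSet x → -(i : ℤ) < v ⬝ᵥ b from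
    H V subset_rfl
  intro S
  induction S using Finset.induction_on with
  | empty =>
    intro _
    obtain ⟨b, i, h, hi, hx⟩ := exists_coneMonomial_notMem x
    exact ⟨b, i, h, hi, hx, by simp⟩
  | insert v S _ ih =>
    intro hS
    obtain ⟨b, i, h, hi, hx, hb⟩ := ih ((Finset.subset_insert _ _).trans hS)
    by_cases hv : v ∈ facetSet x
    · refine ⟨b, i, h, hi, hx, fun v' hv' hv'x => ?_⟩
      rcases Finset.mem_insert.mp hv' with rfl | hv'
      · exact absurd hv hv'x
      · exact hb v' hv' hv'x
    · have hvV : v ∈ V := hS (Finset.mem_insert_self _ _)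
      obtain ⟨m, j, hm, hmx, hne⟩ : ∃ (m : Fin n → ℤ) (j : ℕ) (h : (m, j) ∈ coneMonoid V),
          coneMonomial m j h ∉ primeOf x ∧ v ⬝ᵥ m ≠ -j := by
        by_contra! hcon
        exact hv (mem_facetSet.mpr ⟨hvV, hcon⟩)
      -- A product of monomials that do not vanish at `x` does not vanish there, and its slack along
      -- each divisor is the sum of the slacks of the factors.
      refine ⟨b + m, i + j, (coneMonoid V).add_mem h hm, by omega, ?_, fun v' hv' hv'x => ?_⟩
      · rw [← coneMonomial_mul b m i j h hm]
        exact fun h' => ((primeOf_isPrime x).mem_or_mem h').elim hx hmx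
      · have hv'V : v' ∈ V := hS hv'
        have h1 := h v' hv'V
        have h2 := hm v' hv'V
        change -(i : ℤ) ≤ v' ⬝ᵥ b at h1
        change -(j : ℤ) ≤ v' ⬝ᵥ m at h2
        rw [dotProduct_add]
        push_cast
        rcases Finset.mem_insert.mp hv' with rfl | hv'
        · have : -(j : ℤ) < v' ⬝ᵥ m := lt_of_le_of_ne h2 (Ne.symm hne)
          omega
        · have := hb v' hv' hv'x
          omega

/-- If the order along `v` were larger than `-j`, every monomial of `D` would lie off the facet of
`v`. All of them would then vanish at `x`, and so would `D`. -/
lemma dehom_notMem_ordGE {x : toricVariety V} {v : Fin n → ℤ} (hv : v ∈ facetSet x) {j : ℕ}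
    {D : coneRing V} (hD : D ∈ coneGrading V j) (hx : D ∉ primeOf x) :
    dehom V D ∉ ordGE v (-j + 1) := by
  intro h
  refine hx ?_
  rw [← AddMonoidAlgebra.sum_coeff_single D]
  refine Ideal.sum_mem _ fun q hq => ?_
  have hj : q.1.2 = j := hD q hq
  obtain ⟨⟨m, i⟩, hqm⟩ := q
  obtain rfl : i = j := hj
  have h2 : (AddMonoidAlgebra.single ⟨(m, i), hqm⟩ (D.coeff ⟨(m, i), hqm⟩) : coneRing V) =
      algebraMap ℂ (coneRing V) (D.coeff ⟨(m, i), hqm⟩) * coneMonomial m i hqm := by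
    rw [← Algebra.smul_def, coneMonomial, AddMonoidAlgebra.smul_single, smul_eq_mul, mul_one]
  rw [h2]
  refine Ideal.mul_mem_left _ _ ?_
  by_contra hmx
  have h3 := dotProduct_of_mem_facetSet hv hqm hmx
  have h4 : (dehom V D).coeff m = D.coeff ⟨(m, i), hqm⟩ := by
    conv_lhs => rw [← AddMonoidAlgebra.sum_coeff_single D]
    rw [Finsupp.sum, map_sum, AddMonoidAlgebra.coeff_sum,
      Finsupp.finsetSum_apply, Finset.sum_eq_single ⟨(m, i), hqm⟩]
    · rw [dehom_single, AddMonoidAlgebra.coeff_single, Finsupp.single_eq_same]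
    · intro q' hq' hne
      rw [dehom_single, AddMonoidAlgebra.coeff_single, Finsupp.single_apply, if_neg]
      intro hm
      refine hne (Subtype.ext (Prod.ext hm (hD q' hq')))
    · intro hq'
      exact absurd hq hq'
  have h5 := h m (by rw [h4]; exact Finsupp.mem_support_iff.mp hq)
  omega

/-- A Laurent polynomial becomes homogeneous after multiplication by a power of a monomial as in
`exists_witness`. -/
lemma exists_homogeneous_mul {x : toricVariety V} {b : Fin n → ℤ} {i : ℕ}
    (h : (b, i) ∈ coneMonoid V) (hbx : coneMonomial b i h ∉ primeOf x)
    (hb : ∀ v ∈ V, v ∉ facetSet x → -(i : ℤ) < v ⬝ᵥ b) {j : ℕ} {L : Laurent n}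
    (hL : ∀ v ∈ facetSet x, L ∈ ordGE v (-j)) :
    ∃ e, ∃ N ∈ coneGrading V (e * i + j),
      dehom V N = AddMonoidAlgebra.single (e • b) 1 * L := by
  -- Each factor `χ^b` gains at least one order along every divisor not through `x`, so `e` factors
  -- compensate any pole of `L` there. Along the divisors through `x` the slack of `b` is zero and
  -- nothing changes.
  obtain ⟨e, he⟩ : ∃ e : ℕ, ∀ m ∈ L.coeff.support, ∀ v ∈ V, |v ⬝ᵥ m| ≤ e := by
    refine ⟨∑ m ∈ L.coeff.support, level V m, fun m hm v hv => ?_⟩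
    have h1 := Finset.single_le_sum (f := level V) (fun _ _ => Nat.zero_le _) hm
    have h2 := Finset.single_le_sum (f := fun v => (v ⬝ᵥ m).natAbs) (fun _ _ => Nat.zero_le _) hv
    rw [← level] at h2
    beta_reduce at h1 h2
    rw [Int.abs_eq_natAbs]
    exact_mod_cast h2.trans h1
  refine ⟨e, exists_homogeneous (V := V) (j := e * i + j)
    (AddMonoidAlgebra.single (e • b) 1 * L) (by
      intro m hm
      rw [mem_coneMonoid]
      intro v hv
      have h0 : m = e • b + (m - e • b) := by ring
      rw [h0, AddMonoidAlgebra.coeff_single_mul_add, one_mul] at hm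
      set m' := m - e • b with hm'
      rw [h0]
      have h4 : v ⬝ᵥ (e • b + m') = e * (v ⬝ᵥ b) + v ⬝ᵥ m' := by
        rw [dotProduct_add, dotProduct_smul, nsmul_eq_mul]
      rw [h4]
      push_cast
      by_cases hvx : v ∈ facetSet x
      · have h1 := hL v hvx m' hm
        have h2 := dotProduct_of_mem_facetSet hvx h hbx
        rw [h2]
        linarith
      · have h1 := hb v hv hvx
        have h2 := (abs_le.mp (he m' (Finsupp.mem_support_iff.mpr hm) v hv)).1
        have h3 : (e : ℤ) * (v ⬝ᵥ b + i) ≥ e * 1 :=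
          mul_le_mul_of_nonneg_left (by omega) (by positivity)
        nlinarith)⟩

/-- Regularity at a point in terms of orders along the divisors through the point. -/
lemma mem_range_stalk_of_ordGE {x : toricVariety V} {j : ℕ} {L : Laurent n} {D : coneRing V}
    (hD : D ∈ coneGrading V j) (hx : D ∉ primeOf x) (hL : ∀ v ∈ facetSet x, L ∈ ordGE v (-j)) :
    toField V L / toField V (dehom V D) ∈
      (algebraMap ((toricVariety V).presheaf.stalk x) (toricVariety V).functionField).range := by
  obtain ⟨b, i, h, hi, hbx, hb⟩ := exists_witness x
  obtain ⟨e, N, hN, hNL⟩ := exists_homogeneous_mul h hbx hb hL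
  rw [mem_range_stalk_iff]
  refine ⟨e * i + j, N, hN, coneMonomial b i h ^ e * D, ?_, ?_, ?_⟩
  · exact SetLike.mul_mem_graded
      (by simpa using SetLike.pow_mem_graded e (coneMonomial_mem b i h)) hD
  · intro h'
    rcases (primeOf_isPrime x).mem_or_mem h' with h' | h'
    · exact hbx ((primeOf_isPrime x).mem_of_pow_mem _ h')
    · exact hx h'
  · rw [hNL, map_mul (dehom V), coneMonomial_pow, dehom_coneMonomial, map_mul, map_mul,
      mul_div_mul_left]
    rw [Ne, map_eq_zero_iff _ (toField_injective V), AddMonoidAlgebra.single_eq_zero]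
    exact one_ne_zero

/-- Regular functions have non-negative order along every divisor through the point. Writing this as
a statement about `a = f b` avoids extending the valuation to the function field. -/
lemma ordGE_of_mem_range_stalk {x : toricVariety V} {v : Fin n → ℤ} (hv : v ∈ facetSet x)
    {f : (toricVariety V).functionField}
    (hf : f ∈ (algebraMap ((toricVariety V).presheaf.stalk x)
      (toricVariety V).functionField).range) {a b : Laurent n} {k : ℤ}
    (hb : b ∈ ordGE v k) (hab : toField V a = f * toField V b) : a ∈ ordGE v k := by
  obtain ⟨j, N, hN, D, hD, hx, rfl⟩ := (mem_range_stalk_iff x f).mp hf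
  have hD0 := toField_dehom_ne_zero hD (ne_zero_of_notMem_primeOf hx)
  have h1 : a * dehom V D = dehom V N * b := by
    apply toField_injective V
    rw [map_mul, map_mul, hab]
    field_simp
  have hvV := mem_of_mem_facetSet hv
  refine mem_ordGE_of_mul (dehom_mem_ordGE hD hvV) (dehom_notMem_ordGE hv hD hx) ?_
  rw [h1, add_comm]
  exact mul_mem_ordGE (dehom_mem_ordGE hN hvV) hb

/-- The divisors through a point are simple in the sense that their rays are extremal. -/
lemma IsFanoPolytope.exists_ray (hV : IsFanoPolytope V) {x : toricVariety V} {v : Fin n → ℤ}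
    (hv : v ∈ facetSet x) :
    ∃ w : Fin n → ℤ, v ⬝ᵥ w = 0 ∧ ∀ v' ∈ facetSet x, v' ≠ v → 0 < v' ⬝ᵥ w := by
  obtain ⟨b, i, h, hi, hbx, -⟩ := exists_witness x
  obtain ⟨l, -, hl⟩ := hV.exists_separating (mem_of_mem_facetSet hv)
  -- All `v'` through `x` take the value `-i` on `b`, so the pairing with `v'` is `i (⟨v, l⟩ - ⟨v',
  -- l⟩)`.
  refine ⟨-(v ⬝ᵥ l) • b - (i : ℤ) • l, ?_, fun v' hv' hne => ?_⟩
  · rw [dotProduct_sub, dotProduct_smul, dotProduct_smul, dotProduct_of_mem_facetSet hv h hbx,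
      smul_eq_mul, smul_eq_mul]
    ring
  · rw [dotProduct_sub, dotProduct_smul, dotProduct_smul, dotProduct_of_mem_facetSet hv' h hbx,
      smul_eq_mul, smul_eq_mul]
    have h1 := hl v' (mem_of_mem_facetSet hv') hne
    have h2 : (0 : ℤ) < i := by exact_mod_cast hi
    nlinarith

/-! ### Logarithmic differentials -/

/-- Polynomials as Laurent polynomials. -/
def polyToLaurent (n : ℕ) : MvPolynomial (Fin n) ℂ →ₐ[ℂ] Laurent n :=
  AddMonoidAlgebra.mapDomainAlgHom ℂ ℂ
    ((AddMonoidHom.pi fun i => (Nat.castAddMonoidHom ℤ).comp (Finsupp.applyAddHom i)) :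
      (Fin n →₀ ℕ) →+ (Fin n → ℤ))

lemma polyToLaurent_monomial (s : Fin n →₀ ℕ) (c : ℂ) :
    polyToLaurent n (MvPolynomial.monomial s c) =
      AddMonoidAlgebra.single (fun i => (s i : ℤ)) c :=
  AddMonoidAlgebra.mapDomain_single

lemma polyToLaurent_injective (n : ℕ) : Function.Injective (polyToLaurent n) := by
  refine AddMonoidAlgebra.mapDomain_injective (fun s t h => Finsupp.ext fun i => ?_)
  exact Int.ofNat_injective (congrFun h i)

lemma polyToLaurent_X (i : Fin n) :
    polyToLaurent n (MvPolynomial.X i) = AddMonoidAlgebra.single (Pi.single i 1) 1 := by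
  rw [MvPolynomial.X, polyToLaurent_monomial]
  congr 1
  funext j
  by_cases h : j = i
  · subst h; simp
  · simp [h]

lemma exists_monomial_mul_eq (g : Laurent n) : ∃ (t : Fin n →₀ ℕ) (p : MvPolynomial (Fin n) ℂ),
    polyToLaurent n (MvPolynomial.monomial t 1) * g = polyToLaurent n p := by
  induction g using AddMonoidAlgebra.induction_linear with
  | zero => exact ⟨0, 0, by simp⟩
  | add f g hf hg =>
    obtain ⟨t, p, hp⟩ := hf
    obtain ⟨t', p', hp'⟩ := hg
    refine ⟨t + t', MvPolynomial.monomial t' 1 * p + MvPolynomial.monomial t 1 * p', ?_⟩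
    rw [map_add, map_mul, map_mul, ← hp, ← hp',
      show (MvPolynomial.monomial (t + t')) (1 : ℂ) = MvPolynomial.monomial t 1 *
        MvPolynomial.monomial t' 1 by rw [MvPolynomial.monomial_mul, one_mul], map_mul]
    ring
  | single m c =>
    refine ⟨Finsupp.equivFunOnFinite.symm fun i => (-m i).toNat, MvPolynomial.monomial
      (Finsupp.equivFunOnFinite.symm fun i => (m i).toNat) c, ?_⟩
    rw [polyToLaurent_monomial, polyToLaurent_monomial, AddMonoidAlgebra.single_mul_single, one_mul]
    congr 1
    funext i
    simp only [Finsupp.equivFunOnFinite_symm_apply_apply, Pi.add_apply]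
    omega

section Differential

variable {K : Type} [Field K] [Algebra ℂ K] (Φ : Laurent n →ₐ[ℂ] K)

/-- Monomial factors clear the negative exponents of numerator and denominator. This presents `K` as
the fraction field of a polynomial ring, whose differentials are known. -/
lemma isFractionRing_of_laurent (hinj : Function.Injective Φ)
    (hfrac : ∀ f : K, ∃ a b : Laurent n, b ≠ 0 ∧ f = Φ a / Φ b) :
    let := (Φ.comp (polyToLaurent n)).toRingHom.toAlgebra
    IsFractionRing (MvPolynomial (Fin n) ℂ) K := by
  let := (Φ.comp (polyToLaurent n)).toRingHom.toAlgebra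
  have hinj' : Function.Injective (algebraMap (MvPolynomial (Fin n) ℂ) K) :=
    hinj.comp (polyToLaurent_injective n)
  have : FaithfulSMul (MvPolynomial (Fin n) ℂ) K :=
    (faithfulSMul_iff_algebraMap_injective _ _).mpr hinj'
  refine IsFractionRing.of_field _ K fun f => ?_
  obtain ⟨a, b, hb, rfl⟩ := hfrac f
  obtain ⟨t, p, hp⟩ := exists_monomial_mul_eq a
  obtain ⟨t', p', hp'⟩ := exists_monomial_mul_eq b
  have hmon : ∀ t : Fin n →₀ ℕ, Φ (polyToLaurent n (MvPolynomial.monomial t 1)) ≠ 0 := by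
    intro t
    rw [Ne, map_eq_zero_iff _ hinj, map_eq_zero_iff _ (polyToLaurent_injective n)]
    simp
  have hb' : Φ b ≠ 0 := by rwa [Ne, map_eq_zero_iff _ hinj]
  refine ⟨p * MvPolynomial.monomial t' 1, p' * MvPolynomial.monomial t 1, ?_⟩
  change _ = Φ (polyToLaurent n (p * _)) / Φ (polyToLaurent n (p' * _))
  simp only [map_mul]
  rw [← hp, ← hp', map_mul, map_mul]
  have h1 := hmon t
  have h2 := hmon t'
  field_simp

/-- The monomial `χ^m` as a rational function. -/
abbrev chi (m : Fin n → ℤ) : K := Φ (AddMonoidAlgebra.single m 1)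

lemma chi_add (m m' : Fin n → ℤ) : chi Φ (m + m') = chi Φ m * chi Φ m' := by
  rw [chi, chi, chi, ← map_mul, AddMonoidAlgebra.single_mul_single, one_mul]

lemma chi_zero : chi Φ 0 = 1 := map_one Φ

lemma chi_ne_zero (m : Fin n → ℤ) : chi Φ m ≠ 0 := by
  intro h
  have := chi_add Φ m (-m)
  rw [add_neg_cancel, chi_zero, h, zero_mul] at this
  exact one_ne_zero this

lemma chi_neg (m : Fin n → ℤ) : chi Φ (-m) = (chi Φ m)⁻¹ := by
  refine eq_inv_of_mul_eq_one_left ?_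
  rw [← chi_add, neg_add_cancel, chi_zero]

lemma chi_sum {ι : Type*} (s : Finset ι) (m : ι → Fin n → ℤ) :
    chi Φ (∑ i ∈ s, m i) = ∏ i ∈ s, chi Φ (m i) := by
  classical
  induction s using Finset.induction_on with
  | empty => simp [chi_zero]
  | insert i s hi ih => rw [Finset.sum_insert hi, Finset.prod_insert hi, chi_add, ih]

/-- The logarithmic differential of a monomial. -/
def dlog : (Fin n → ℤ) →+ Ω[K⁄ℂ] where
  toFun m := chi Φ (-m) • KaehlerDifferential.D ℂ K (chi Φ m)
  map_zero' := by rw [chi_zero, Derivation.map_one_eq_zero, smul_zero]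
  map_add' m m' := by
    rw [chi_add, Derivation.leibniz, smul_add, smul_smul, smul_smul, neg_add, chi_add, add_comm]
    congr 2
    · rw [chi_neg Φ m', mul_assoc, inv_mul_cancel₀ (chi_ne_zero Φ m'), mul_one]
    · rw [chi_neg Φ m, mul_comm, ← mul_assoc, mul_inv_cancel₀ (chi_ne_zero Φ m), one_mul]

lemma D_chi (m : Fin n → ℤ) : KaehlerDifferential.D ℂ K (chi Φ m) = chi Φ m • dlog Φ m := by
  change _ = chi Φ m • chi Φ (-m) • KaehlerDifferential.D ℂ K (chi Φ m)
  rw [smul_smul, ← chi_add, add_neg_cancel, chi_zero, one_smul]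

lemma dlog_eq_sum (m : Fin n → ℤ) : dlog Φ m = ∑ i, (m i : K) • dlog Φ (Pi.single i 1) := by
  have h : m = ∑ i, m i • (Pi.single i 1 : Fin n → ℤ) := by
    conv_lhs => rw [← Finset.univ_sum_single m]
    refine Finset.sum_congr rfl fun i _ => ?_
    rw [← Pi.single_smul, smul_eq_mul, mul_one]
  conv_lhs => rw [h]
  rw [map_sum]
  refine Finset.sum_congr rfl fun i _ => ?_
  rw [map_zsmul, Int.cast_smul_eq_zsmul]

/-- Kähler differentials commute with localization, so the coordinate differentials remain a basis
over `K`, and the logarithmic ones differ from them by units. -/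
lemma exists_dlogBasis (hinj : Function.Injective Φ)
    (hfrac : ∀ f : K, ∃ a b : Laurent n, b ≠ 0 ∧ f = Φ a / Φ b) :
    ∃ b : Module.Basis (Fin n) K (Ω[K⁄ℂ]), ∀ i, b i = dlog Φ (Pi.single i 1) := by
  let := (Φ.comp (polyToLaurent n)).toRingHom.toAlgebra
  have hfr : IsFractionRing (MvPolynomial (Fin n) ℂ) K := isFractionRing_of_laurent Φ hinj hfrac
  have : IsScalarTower ℂ (MvPolynomial (Fin n) ℂ) K :=
    IsScalarTower.of_algebraMap_eq fun c => ((Φ.comp (polyToLaurent n)).commutes c).symm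
  let b := (KaehlerDifferential.mvPolynomialBasis ℂ (Fin n)).ofIsLocalizedModule K
    (nonZeroDivisors (MvPolynomial (Fin n) ℂ))
    (KaehlerDifferential.map ℂ ℂ (MvPolynomial (Fin n) ℂ) K)
  refine ⟨b.isUnitSMul (w := fun i => chi Φ (-Pi.single i 1))
    (fun i => (chi_ne_zero Φ _).isUnit), fun i => ?_⟩
  rw [Module.Basis.isUnitSMul_apply]
  change _ = chi Φ (-Pi.single i 1) • KaehlerDifferential.D ℂ K (chi Φ (Pi.single i 1))
  congr 1
  rw [Module.Basis.ofIsLocalizedModule_apply, KaehlerDifferential.mvPolynomialBasis_apply,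
    KaehlerDifferential.map_D, chi, ← polyToLaurent_X]
  rfl

end Differential

/-! ### Logarithmic derivatives and the orders of their determinants -/

/-- The derivation `∂_j` with `∂_j χ^m = m_j χ^m`. -/
def logDeriv (j : Fin n) (g : Laurent n) : Laurent n :=
  AddMonoidAlgebra.ofCoeff (Finsupp.onFinset g.coeff.support (fun m => (m j : ℂ) * g.coeff m)
    fun _ hm => Finsupp.mem_support_iff.mpr (right_ne_zero_of_mul hm))

lemma coeff_logDeriv (j : Fin n) (g : Laurent n) (m : Fin n → ℤ) :
    (logDeriv j g).coeff m = (m j : ℂ) * g.coeff m := rfl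

lemma logDeriv_add (j : Fin n) (g h : Laurent n) :
    logDeriv j (g + h) = logDeriv j g + logDeriv j h := by
  ext m
  simp only [coeff_logDeriv, AddMonoidAlgebra.coeff_add, Finsupp.add_apply, mul_add]

lemma logDeriv_single (j : Fin n) (m : Fin n → ℤ) (c : ℂ) :
    logDeriv j (AddMonoidAlgebra.single m c) = AddMonoidAlgebra.single m ((m j : ℂ) * c) := by
  ext m'
  simp only [coeff_logDeriv, AddMonoidAlgebra.coeff_single, Finsupp.single_apply]
  split_ifs with h
  · rw [h]
  · rw [mul_zero]

lemma logDeriv_mem_ordGE {j : Fin n} {g : Laurent n} {v : Fin n → ℤ} {k : ℤ}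
    (hg : g ∈ ordGE v k) : logDeriv j g ∈ ordGE v k :=
  fun m hm => hg m (right_ne_zero_of_mul hm)

/-- This is Euler's relation: the operator `∑ v_j ∂_j` multiplies `χ^m` by `⟨v, m⟩`, so the
difference has no part of weight `k`. -/
lemma sum_logDeriv_mem_ordGE {g : Laurent n} {v : Fin n → ℤ} {k : ℤ} (hg : g ∈ ordGE v k) :
    ∑ j, (v j : ℂ) • logDeriv j g - (k : ℂ) • g ∈ ordGE v (k + 1) := by
  intro m hm
  have h1 : (∑ j, (v j : ℂ) • logDeriv j g - (k : ℂ) • g).coeff m =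
      (((v ⬝ᵥ m : ℤ) : ℂ) - k) * g.coeff m := by
    rw [AddMonoidAlgebra.coeff_sub, Finsupp.sub_apply, AddMonoidAlgebra.coeff_sum,
      Finsupp.finsetSum_apply]
    simp only [AddMonoidAlgebra.coeff_smul_apply, coeff_logDeriv, dotProduct, smul_eq_mul,
      Int.cast_sum, Int.cast_mul, sub_mul, Finset.sum_mul, mul_assoc]
  rw [h1] at hm
  have h2 := hg m (right_ne_zero_of_mul hm)
  have h3 : v ⬝ᵥ m ≠ k := by
    rintro h
    rw [h, sub_self, zero_mul] at hm
    exact hm rfl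
  omega

lemma D_eq_sum {K : Type} [Field K] [Algebra ℂ K] (Φ : Laurent n →ₐ[ℂ] K) (g : Laurent n) :
    KaehlerDifferential.D ℂ K (Φ g) =
      ∑ j, Φ (logDeriv j g) • dlog Φ (Pi.single j 1) := by
  induction g using AddMonoidAlgebra.induction_linear with
  | zero =>
    have : ∀ j : Fin n, logDeriv j 0 = 0 := fun j => by ext; simp [coeff_logDeriv]
    simp [this]
  | add f g hf hg =>
    simp only [map_add, logDeriv_add, hf, hg, add_smul, Finset.sum_add_distrib]
  | single m c =>
    have h1 : ∀ c : ℂ, Φ (AddMonoidAlgebra.single m c) = c • chi Φ m := by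
      intro c
      rw [chi, ← map_smul, AddMonoidAlgebra.smul_single, smul_eq_mul, mul_one]
    rw [h1, Derivation.map_smul, D_chi, dlog_eq_sum, Finset.smul_sum, Finset.smul_sum]
    refine Finset.sum_congr rfl fun j _ => ?_
    rw [logDeriv_single, h1, smul_smul, ← smul_assoc, mul_smul]
    congr 1
    rw [Algebra.smul_def, Algebra.smul_def, Algebra.smul_def, map_intCast]
    ring

/-- Modulo functions of positive order along `v`, the nonzero vector `v` lies in the kernel of `M`.
Multiplying by the adjugate shows that the determinant times each coordinate of `v` has positive
order. -/
lemma det_mem_ordGE_zero {v : Fin n → ℤ} {M : Matrix (Fin n) (Fin n) (Laurent n)}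
    (hv : v ≠ 0) (hM : ∀ i j, M i j ∈ ordGE v 0)
    (hMv : ∀ i, ∑ j, (v j : ℂ) • M i j ∈ ordGE v 1) : M.det ∈ ordGE v 1 := by
  let S : Subring (Laurent n) :=
    { carrier := ordGE v 0
      mul_mem' := fun ha hb => by simpa using mul_mem_ordGE ha hb
      one_mem' := one_mem_ordGE v
      add_mem' := add_mem
      zero_mem' := zero_mem _
      neg_mem' := neg_mem }
  let M' : Matrix (Fin n) (Fin n) S := Matrix.of fun i j => ⟨M i j, hM i j⟩
  have hM' : M = S.subtype.mapMatrix M' := rfl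
  have hadj : ∀ i j, M.adjugate i j ∈ ordGE v 0 := by
    intro i j
    rw [hM', ← RingHom.map_adjugate]
    exact (M'.adjugate i j).2
  let y : Fin n → Laurent n := fun j => algebraMap ℂ _ (v j : ℂ)
  have h1 : M.adjugate.mulVec (M.mulVec y) = M.det • y := by
    rw [Matrix.mulVec_mulVec, Matrix.adjugate_mul, Matrix.smul_mulVec, Matrix.one_mulVec]
  obtain ⟨j, hj⟩ : ∃ j, v j ≠ 0 := by
    by_contra! h
    exact hv (funext h)
  have h2 := congrFun h1 j
  have h3 : M.det = ((v j : ℂ)⁻¹) • (M.adjugate.mulVec (M.mulVec y)) j := by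
    rw [h2, Pi.smul_apply, smul_eq_mul, mul_comm, ← Algebra.smul_def, smul_smul,
      inv_mul_cancel₀ (by exact_mod_cast hj), one_smul]
  rw [h3]
  have h4 : (M.adjugate.mulVec (M.mulVec y)) j = ∑ i, M.adjugate j i * (M.mulVec y) i := rfl
  rw [h4]
  refine (ordGE v 1).smul_mem _ ((ordGE v 1).sum_mem (t := Finset.univ) fun i _ => ?_)
  rw [← zero_add (1 : ℤ)]
  refine mul_mem_ordGE (hadj j i) ?_
  convert hMv i using 1
  change ∑ k, M i k * y k = _
  refine Finset.sum_congr rfl fun k _ => ?_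
  rw [Algebra.smul_def, mul_comm]

/-- Multiplying row `i` by the monomial of `-d i • u`, which has order `-d i`, reduces to the case
of order zero. -/
lemma det_mem_ordGE {v u : Fin n → ℤ} (hu : v ⬝ᵥ u = 1) {M : Matrix (Fin n) (Fin n) (Laurent n)}
    {d : Fin n → ℤ} (hM : ∀ i j, M i j ∈ ordGE v (d i))
    (hMv : ∀ i, ∑ j, (v j : ℂ) • M i j ∈ ordGE v (d i + 1)) :
    M.det ∈ ordGE v (∑ i, d i + 1) := by
  have hv : v ≠ 0 := by
    rintro rfl
    simp at hu
  have hs : ∀ e : ℤ, (AddMonoidAlgebra.single (e • u) 1 : Laurent n) ∈ ordGE v e := fun e =>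
    single_mem_ordGE 1 (by rw [dotProduct_smul, hu, smul_eq_mul, mul_one])
  have h1 := det_mem_ordGE_zero (v := v)
    (M := Matrix.of fun i j => AddMonoidAlgebra.single (-d i • u) 1 * M i j) hv
    (fun i j => by simpa using mul_mem_ordGE (hs (-d i)) (hM i j))
    (fun i => by
      have := mul_mem_ordGE (hs (-d i)) (hMv i)
      rw [neg_add_cancel_left, Finset.mul_sum] at this
      simpa only [Matrix.of_apply, mul_smul_comm] using this)
  rw [Matrix.det_mul_column] at h1
  have h2 : (∏ i, AddMonoidAlgebra.single (-d i • u) 1 : Laurent n) =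
      AddMonoidAlgebra.single (-(∑ i, d i) • u) 1 := by
    rw [AddMonoidAlgebra.prod_single, Finset.prod_const_one, ← Finset.sum_smul,
      Finset.sum_neg_distrib]
  rw [h2] at h1
  have h3 := mul_mem_ordGE (hs (∑ i, d i)) h1
  rwa [← mul_assoc, AddMonoidAlgebra.single_mul_single, mul_one, ← add_smul, add_neg_cancel,
    zero_smul, ← AddMonoidAlgebra.one_def, one_mul] at h3

/-! ### Top forms in coordinates -/

/-- The coordinate of a form of top degree with respect to a basis. -/
def formCoord {K M : Type*} [Field K] [AddCommGroup M] [Module K M]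
    (b : Module.Basis (Fin n) K M) : ⋀[K]^n M →ₗ[K] K :=
  exteriorPower.alternatingMapLinearEquiv b.det

lemma formCoord_ιMulti {K M : Type*} [Field K] [AddCommGroup M] [Module K M]
    (b : Module.Basis (Fin n) K M) (a : Fin n → M) :
    formCoord b (exteriorPower.ιMulti K n a) = b.det a :=
  exteriorPower.alternatingMapLinearEquiv_apply_ιMulti _ _

lemma eq_formCoord_smul {K M : Type*} [Field K] [AddCommGroup M] [Module K M]
    (b : Module.Basis (Fin n) K M) (ω : ⋀[K]^n M) :
    ω = formCoord b ω • exteriorPower.ιMulti K n b := by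
  have h : (LinearMap.id : ⋀[K]^n M →ₗ[K] ⋀[K]^n M) =
      (LinearMap.toSpanSingleton K _ (exteriorPower.ιMulti K n b)).comp (formCoord b) := by
    refine exteriorPower.linearMap_ext (Module.Basis.ext_alternating b fun σ hσ => ?_)
    let e := Equiv.ofBijective σ (Finite.injective_iff_bijective.mp hσ)
    have h1 : (fun i => b (σ i)) = fun i => b (e i) := rfl
    rw [h1]
    simp only [LinearMap.compAlternatingMap_apply, LinearMap.id_apply, LinearMap.comp_apply,
      formCoord_ιMulti, LinearMap.toSpanSingleton_apply]
    rw [show (fun i => b (e i)) = b ∘ e from rfl, AlternatingMap.map_perm, AlternatingMap.map_perm,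
      b.det_self, Units.smul_def, Units.smul_def, zsmul_one, Int.cast_smul_eq_zsmul]
  exact congrArg (fun f => f ω) h

/-! ### Sections of the anticanonical sheaf -/

/-- The basis of logarithmic differentials of the function field. -/
def dlogBasis (V : Finset (Fin n → ℤ)) : Module.Basis (Fin n) (toricVariety V).functionField
    (Ω[(toricVariety V).functionField⁄ℂ]) :=
  (exists_dlogBasis (toField V) (toField_injective V) exists_eq_div).choose

lemma dlogBasis_apply (i : Fin n) : dlogBasis V i = dlog (toField V) (Pi.single i 1) :=
  (exists_dlogBasis (toField V) (toField_injective V) exists_eq_div).choose_spec i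

lemma dlogBasis_det_sum (A : Fin n → Fin n → (toricVariety V).functionField) :
    (dlogBasis V).det (fun i => ∑ j, A i j • dlogBasis V j) = (Matrix.of A).det := by
  rw [Module.Basis.det_apply, ← Matrix.det_transpose]
  congr 1
  ext i j
  rw [Matrix.transpose_apply, Module.Basis.toMatrix_apply, map_sum, Finsupp.finsetSum_apply,
    Finset.sum_eq_single j]
  · simp
  · intro k _ hk
    simp [hk]
  · simp

lemma dlogBasis_det_D_chi (m : Fin n → Fin n → ℤ) :
    (dlogBasis V).det (fun i => KaehlerDifferential.D ℂ _ (chi (toField V) (m i))) =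
      chi (toField V) (∑ i, m i) * ((Matrix.of m).det : ℤ) := by
  have h1 : ∀ i, KaehlerDifferential.D ℂ _ (chi (toField V) (m i)) =
      chi (toField V) (m i) • ∑ j, ((m i j : ℤ) : (toricVariety V).functionField) •
        dlogBasis V j := by
    intro i
    rw [D_chi, dlog_eq_sum]
    simp only [dlogBasis_apply]
  simp only [h1]
  rw [AlternatingMap.map_smul_univ, chi_sum, smul_eq_mul,
    dlogBasis_det_sum (fun i j => ((m i j : ℤ) : (toricVariety V).functionField))]
  congr 1
  exact ((Int.castRingHom (toricVariety V).functionField).map_det (Matrix.of m)).symm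

lemma dlogBasis_det_D_div (α β : Fin n → Laurent n) :
    (dlogBasis V).det (fun i => KaehlerDifferential.D ℂ _ (toField V (α i) / toField V (β i))) =
      toField V (Matrix.of fun i j => β i * logDeriv j (α i) - α i * logDeriv j (β i)).det /
        toField V (∏ i, β i ^ 2) := by
  have h1 : ∀ i, KaehlerDifferential.D ℂ _ (toField V (α i) / toField V (β i)) =
      (toField V (β i) ^ 2)⁻¹ • ∑ j, toField V (β i * logDeriv j (α i) - α i * logDeriv j (β i)) •
        dlogBasis V j := by
    intro i
    rw [Derivation.leibniz_div, D_eq_sum, D_eq_sum, inv_pow, Finset.smul_sum, Finset.smul_sum,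
      ← Finset.sum_sub_distrib]
    congr 1
    refine Finset.sum_congr rfl fun j _ => ?_
    rw [smul_smul, smul_smul, ← sub_smul, map_sub, map_mul, map_mul, dlogBasis_apply]
  simp only [h1]
  rw [AlternatingMap.map_smul_univ, smul_eq_mul,
    dlogBasis_det_sum (fun i j =>
      toField V (β i * logDeriv j (α i) - α i * logDeriv j (β i)))]
  rw [map_prod, Finset.prod_inv_distrib, div_eq_inv_mul]
  congr 1
  · simp only [map_pow]
  · exact ((toField V).toRingHom.map_det _).symm

/-- The rational section of `-k K_X` given by a rational function. -/
def sectionOf (V : Finset (Fin n → ℤ)) (k : ℕ) (f : (toricVariety V).functionField) :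
    RationalForm (toricVariety V) n → (toricVariety V).functionField :=
  fun ω => formCoord (dlogBasis V) ω ^ k * f

lemma sectionOf_smul (k : ℕ) (f g : (toricVariety V).functionField)
    (ω : RationalForm (toricVariety V) n) :
    sectionOf V k f (g • ω) = g ^ k * sectionOf V k f ω := by
  rw [sectionOf, sectionOf, map_smul, smul_eq_mul, mul_pow, mul_assoc]

lemma formCoord_volume :
    formCoord (dlogBasis V) (exteriorPower.ιMulti _ n (dlogBasis V)) = 1 := by
  rw [formCoord_ιMulti, Module.Basis.det_self]

lemma sectionOf_injective (V : Finset (Fin n → ℤ)) (k : ℕ) :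
    Function.Injective (sectionOf V k) := by
  intro f g h
  have := congrFun h (exteriorPower.ιMulti _ n (dlogBasis V))
  simpa only [sectionOf, formCoord_volume, one_pow, one_mul] using this

/-- Top forms are a line spanned by the logarithmic volume form, so a homogeneous function is
determined by its value there. -/
lemma eq_sectionOf {k : ℕ} {s : RationalForm (toricVariety V) n → (toricVariety V).functionField}
    (hs : ∀ (g : (toricVariety V).functionField) (ω : RationalForm (toricVariety V) n),
      s (g • ω) = g ^ k * s ω) :
    s = sectionOf V k (s (exteriorPower.ιMulti _ n (dlogBasis V))) := by
  funext ω
  conv_lhs => rw [eq_formCoord_smul (dlogBasis V) ω]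
  rw [hs]
  rfl

lemma sectionOf_mem_stalk_iff {x : toricVariety V} {k : ℕ} {f : (toricVariety V).functionField} :
    sectionOf V k f ∈ anticanonicalStalk (toricVariety V) n k x ↔
      ∀ a : Fin n → (toricVariety V).presheaf.stalk x,
        (dlogBasis V).det (fun i => KaehlerDifferential.D ℂ _
          (algebraMap _ (toricVariety V).functionField (a i))) ^ k * f ∈
          (algebraMap ((toricVariety V).presheaf.stalk x)
            (toricVariety V).functionField).range := by
  have h : ∀ a : Fin n → (toricVariety V).presheaf.stalk x,
      sectionOf V k f (wedgeD (toricVariety V) n x a) = (dlogBasis V).det (fun i =>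
        KaehlerDifferential.D ℂ _ (algebraMap _ (toricVariety V).functionField (a i))) ^ k * f := by
    intro a
    rw [sectionOf, wedgeD, formCoord_ιMulti]
  constructor
  · intro hs a
    rw [← h]
    exact hs.2 a
  · intro hs
    refine ⟨fun g ω => sectionOf_smul k f g ω, fun a => ?_⟩
    rw [h]
    exact hs a

lemma toField_mem_range_stalk {x : toricVariety V} {g : Laurent n}
    (hg : ∀ v ∈ facetSet x, g ∈ ordGE v 0) : toField V g ∈
      (algebraMap ((toricVariety V).presheaf.stalk x) (toricVariety V).functionField).range := by
  have := mem_range_stalk_of_ordGE (x := x) (j := 0) (L := g) (D := 1)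
    SetLike.GradedOne.one_mem (one_notMem_primeOf x) (by simpa using hg)
  rwa [map_one, map_one, div_one] at this

/-- In terms of the logarithmic volume form, `da₁ ∧ ⋯ ∧ daₙ` vanishes along every divisor through
`x` if the `a i` are regular. Its `k`-th power absorbs a pole of order `k`. -/
lemma sectionOf_mem_stalk (hV : IsFanoPolytope V) {x : toricVariety V} {k j : ℕ} {L : Laurent n}
    {D : coneRing V} (hD : D ∈ coneGrading V j) (hx : D ∉ primeOf x)
    (hL : ∀ v ∈ facetSet x, L ∈ ordGE v (-k - j)) :
    sectionOf V k (toField V L / toField V (dehom V D)) ∈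
      anticanonicalStalk (toricVariety V) n k x := by
  rw [sectionOf_mem_stalk_iff]
  intro a
  have ha : ∀ i, ∃ j, ∃ N ∈ coneGrading V j, ∃ D ∈ coneGrading V j, D ∉ primeOf x ∧
      algebraMap _ (toricVariety V).functionField (a i) =
        toField V (dehom V N) / toField V (dehom V D) := fun i =>
    (mem_range_stalk_iff x _).mp ⟨a i, rfl⟩
  choose d N hN D' hD' hx' ha using ha
  simp only [ha]
  rw [dlogBasis_det_D_div, div_pow, div_mul_div_comm,
    ← map_pow, ← map_pow, ← map_mul, ← map_mul]
  have hden : (∏ i, dehom V (D' i) ^ 2) ^ k * dehom V D =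
      dehom V ((∏ i, D' i ^ 2) ^ k * D) := by
    simp only [map_mul, map_pow, map_prod]
  rw [hden]
  refine mem_range_stalk_of_ordGE (j := k * ∑ i, 2 * d i + j) ?_ ?_ fun v hv => ?_
  · refine SetLike.mul_mem_graded ?_ hD
    have h1 := SetLike.prod_mem_graded (coneGrading V) (fun i => 2 * d i) (fun i => D' i ^ 2)
      (F := Finset.univ) fun i _ => by simpa using SetLike.pow_mem_graded 2 (hD' i)
    simpa using SetLike.pow_mem_graded k h1
  · intro h
    rcases (primeOf_isPrime x).mem_or_mem h with h | h
    · have h1 := (primeOf_isPrime x).mem_of_pow_mem _ h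
      obtain ⟨i, -, hi⟩ := ((primeOf_isPrime x).prod_mem_iff).mp h1
      exact hx' i ((primeOf_isPrime x).mem_of_pow_mem _ hi)
    · exact hx h
  · have hvV := mem_of_mem_facetSet hv
    obtain ⟨u, hu⟩ := hV.exists_dotProduct_eq_one hvV
    have hNv := fun i => dehom_mem_ordGE (hN i) hvV
    have hDv := fun i => dehom_mem_ordGE (hD' i) hvV
    -- The row order `-2 d i` comes from the quotient rule. The extra order arises because the
    -- leading parts `-d i N D` in the two Euler relations cancel.
    have hdet := det_mem_ordGE (v := v) hu (d := fun i => -(2 * d i : ℤ))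
      (M := Matrix.of fun i j => dehom V (D' i) * logDeriv j (dehom V (N i)) -
        dehom V (N i) * logDeriv j (dehom V (D' i))) (fun i j => by
        rw [show -(2 * d i : ℤ) = -d i + -d i by ring]
        exact sub_mem (mul_mem_ordGE (hDv i) (logDeriv_mem_ordGE (hNv i)))
          (mul_mem_ordGE (hNv i) (logDeriv_mem_ordGE (hDv i)))) (fun i => by
        have h1 := mul_mem_ordGE (hDv i) (sum_logDeriv_mem_ordGE (hNv i))
        have h2 := mul_mem_ordGE (hNv i) (sum_logDeriv_mem_ordGE (hDv i))
        rw [show -(2 * d i : ℤ) + 1 = -d i + (-d i + 1) by ring]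
        convert sub_mem h1 h2 using 1
        simp only [Matrix.of_apply, smul_sub, Finset.sum_sub_distrib, mul_sub, Finset.mul_sum,
          mul_smul_comm]
        rw [mul_comm (dehom V (N i)) (dehom V (D' i))]
        ring)
    have h3 := mul_mem_ordGE (pow_mem_ordGE hdet k) (hL v hv)
    convert h3 using 2
    push_cast
    rw [Finset.sum_neg_distrib]
    ring

/-- The section is tested on forms `dχ^(m₁) ∧ ⋯ ∧ dχ^(mₙ)` with regular monomials. For each divisor
through `x`, `exists_basis_of_ray` supplies such a form that vanishes there to order exactly one,
which limits the pole to order `k`. The fraction depends on the divisor, but all of them represent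
the same function. -/
lemma exists_of_mem_stalk (hV : IsFanoPolytope V) {x : toricVariety V} {k : ℕ}
    {f : (toricVariety V).functionField}
    (hf : sectionOf V k f ∈ anticanonicalStalk (toricVariety V) n k x) :
    ∃ (j : ℕ) (L : Laurent n) (D : coneRing V), D ∈ coneGrading V j ∧ D ∉ primeOf x ∧
      f = toField V L / toField V (dehom V D) ∧ ∀ v ∈ facetSet x, L ∈ ordGE v (-k - j) := by
  rw [sectionOf_mem_stalk_iff] at hf
  have key : ∀ m : Fin n → Fin n → ℤ, (∀ i, ∀ v ∈ facetSet x, 0 ≤ v ⬝ᵥ m i) →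
      (Matrix.of m).det ≠ 0 → ∃ (j : ℕ) (L : Laurent n) (D : coneRing V), D ∈ coneGrading V j ∧
        D ∉ primeOf x ∧ f = toField V L / toField V (dehom V D) ∧
        ∀ v ∈ facetSet x, L ∈ ordGE v (-(k * (v ⬝ᵥ ∑ i, m i)) - j) := by
    intro m hm hdet
    have h1 : ∀ i, ∃ a, algebraMap ((toricVariety V).presheaf.stalk x)
        (toricVariety V).functionField a = chi (toField V) (m i) := fun i =>
      toField_mem_range_stalk fun v hv => single_mem_ordGE 1 (hm i v hv)
    choose a ha using h1
    have h2 := hf a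
    simp only [ha] at h2
    rw [dlogBasis_det_D_chi, mem_range_stalk_iff] at h2
    obtain ⟨j, N, hN, D, hD, hx, h3⟩ := h2
    have hdet' : (((Matrix.of m).det : ℤ) : ℂ) ^ k ≠ 0 := pow_ne_zero _ (by exact_mod_cast hdet)
    refine ⟨j, ((((Matrix.of m).det : ℤ) : ℂ) ^ k)⁻¹ • (AddMonoidAlgebra.single
      (-((k : ℤ) • ∑ i, m i)) 1 * dehom V N), D, hD, hx, ?_, fun v hv => ?_⟩
    · have hdK : (((Matrix.of m).det : ℤ) : (toricVariety V).functionField) =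
          algebraMap ℂ (toricVariety V).functionField (((Matrix.of m).det : ℤ) : ℂ) :=
        (map_intCast (algebraMap ℂ (toricVariety V).functionField) _).symm
      have hD0 := toField_dehom_ne_zero hD (ne_zero_of_notMem_primeOf hx)
      have hchi : chi (toField V) ((k : ℤ) • ∑ i, m i) = chi (toField V) (∑ i, m i) ^ k := by
        rw [natCast_zsmul, chi, ← map_pow, AddMonoidAlgebra.single_pow, one_pow]
      rw [map_smul, Algebra.smul_def, map_mul, map_inv₀, map_pow, ← hdK]
      change f = _ * (chi (toField V) (-((k : ℤ) • ∑ i, m i)) * _) / _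
      rw [chi_neg, hchi, mul_div_assoc, mul_div_assoc, ← h3]
      have h4 := pow_ne_zero k (chi_ne_zero (toField V) (∑ i, m i))
      have h5 : (((Matrix.of m).det : ℤ) : (toricVariety V).functionField) ^ k ≠ 0 := by
        rw [hdK, ← map_pow]
        exact (map_ne_zero _).mpr hdet'
      rw [mul_pow]
      field_simp
    · refine Submodule.smul_mem _ _ ?_
      have h4 : (AddMonoidAlgebra.single (-((k : ℤ) • ∑ i, m i)) 1 : Laurent n) ∈
          ordGE v (-(k * (v ⬝ᵥ ∑ i, m i))) :=
        single_mem_ordGE 1 (by rw [dotProduct_neg, dotProduct_smul, smul_eq_mul])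
      exact mul_mem_ordGE h4 (dehom_mem_ordGE hN (mem_of_mem_facetSet hv))
  have key' : ∀ v ∈ facetSet x, ∃ (j : ℕ) (L : Laurent n) (D : coneRing V),
      D ∈ coneGrading V j ∧ D ∉ primeOf x ∧ f = toField V L / toField V (dehom V D) ∧
        L ∈ ordGE v (-k - j) := by
    intro v hv
    obtain ⟨w, hvw, hw⟩ := hV.exists_ray hv
    obtain ⟨u, hu⟩ := hV.exists_dotProduct_eq_one (mem_of_mem_facetSet hv)
    obtain ⟨m, hm, hdet, hsum⟩ := exists_basis_of_ray hu hvw hw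
    obtain ⟨j, L, D, hD, hx, hf, hL⟩ := key m hm hdet
    refine ⟨j, L, D, hD, hx, hf, ?_⟩
    have := hL v hv
    rwa [hsum, mul_one] at this
  obtain ⟨j₀, L₀, D₀, hD₀, hx₀, hf₀⟩ : ∃ (j : ℕ) (L : Laurent n) (D : coneRing V),
      D ∈ coneGrading V j ∧ D ∉ primeOf x ∧ f = toField V L / toField V (dehom V D) := by
    by_cases hne : (facetSet x).Nonempty
    · obtain ⟨v, hv⟩ := hne
      obtain ⟨j, L, D, hD, hx, hf, -⟩ := key' v hv
      exact ⟨j, L, D, hD, hx, hf⟩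
    -- With no divisor through `x` every monomial is regular, and the standard basis serves as test
    -- form.
    · rw [Finset.not_nonempty_iff_eq_empty] at hne
      obtain ⟨j, L, D, hD, hx, hf, -⟩ := key (fun i => Pi.single i 1) (by simp [hne]) (by
        have : (Matrix.of fun i : Fin n => (Pi.single i 1 : Fin n → ℤ)) = 1 := by
          ext i j
          simp [Matrix.one_apply, Pi.single_apply, eq_comm]
        rw [this, Matrix.det_one]
        exact one_ne_zero)
      exact ⟨j, L, D, hD, hx, hf⟩
  refine ⟨j₀, L₀, D₀, hD₀, hx₀, hf₀, fun v hv => ?_⟩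
  obtain ⟨j, L, D, hD, hx, hf', hL⟩ := key' v hv
  have hvV := mem_of_mem_facetSet hv
  have h0 := toField_dehom_ne_zero hD₀ (ne_zero_of_notMem_primeOf hx₀)
  have h1 := toField_dehom_ne_zero hD (ne_zero_of_notMem_primeOf hx)
  have h2 : L₀ * dehom V D = L * dehom V D₀ := by
    apply toField_injective V
    rw [map_mul, map_mul]
    rw [hf₀, div_eq_div_iff h0 h1] at hf'
    exact hf'
  refine mem_ordGE_of_mul (dehom_mem_ordGE hD hvV) (dehom_notMem_ordGE hv hD hx) ?_
  rw [h2]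
  convert mul_mem_ordGE hL (dehom_mem_ordGE hD₀ hvV) using 2
  ring

/-! ### Construction of points -/

/-- A family of subspaces that behaves like the homogeneous components of a relevant prime ideal
gives a point. -/
lemma exists_point (p : ℕ → Submodule ℂ (Laurent n))
    (hmul : ∀ i j, ∀ a ∈ coneGrading V i, ∀ b ∈ p j, dehom V a * b ∈ p (i + j))
    (hprime : ∀ i j, ∀ a ∈ coneGrading V i, ∀ b ∈ coneGrading V j,
      dehom V a * dehom V b ∈ p (i + j) → dehom V a ∈ p i ∨ dehom V b ∈ p j)
    (hirr : ∃ j > 0, ∃ a ∈ coneGrading V j, dehom V a ∉ p j) :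
    ∃ x : toricVariety V, ∀ j, ∀ N ∈ coneGrading V j, (N ∈ primeOf x ↔ dehom V N ∈ p j) := by
  let I : Ideal (coneRing V) :=
    { carrier := {N | ∀ j, dehom V (DirectSum.decompose (coneGrading V) N j) ∈ p j}
      zero_mem' := by
        intro j
        simp
      add_mem' := by
        intro a b ha hb j
        rw [DirectSum.decompose_add, DirectSum.add_apply, Submodule.coe_add, map_add]
        exact add_mem (ha j) (hb j)
      smul_mem' := by
        intro c N hN
        induction c using DirectSum.Decomposition.inductionOn (coneGrading V) with
        | zero =>
          intro j
          simp
        | @homogeneous i c =>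
          intro j
          rw [smul_eq_mul, DirectSum.coe_decompose_mul_of_left_mem (coneGrading V) j c.2]
          split_ifs with h
          · rw [map_mul]
            have := hmul i (j - i) c c.2 _ (hN (j - i))
            rwa [Nat.add_sub_cancel' h] at this
          · rw [map_zero]
            exact zero_mem _
        | add a b ha hb =>
          intro j
          rw [add_smul, DirectSum.decompose_add, DirectSum.add_apply, Submodule.coe_add, map_add]
          exact add_mem (ha j) (hb j) }
  have hI : ∀ j, ∀ N ∈ coneGrading V j, (N ∈ I ↔ dehom V N ∈ p j) := by
    intro j N hN
    constructor
    · intro h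
      have := h j
      rwa [DirectSum.decompose_of_mem_same _ hN] at this
    · intro h i
      by_cases hij : j = i
      · subst hij
        rwa [DirectSum.decompose_of_mem_same _ hN]
      · rw [DirectSum.decompose_of_mem_ne _ hN hij, map_zero]
        exact zero_mem _
  have hhom : I.IsHomogeneous (coneGrading V) := by
    intro i N hN
    exact (hI i _ (SetLike.coe_mem _)).mpr (hN i)
  obtain ⟨j₀, hj₀, a₀, ha₀, hap⟩ := hirr
  have hne : I ≠ ⊤ := by
    intro h
    exact hap ((hI j₀ a₀ ha₀).mp (h ▸ Submodule.mem_top))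
  have hIp : I.IsPrime := by
    refine hhom.isPrime_of_homogeneous_mem_or_mem hne ?_
    rintro a b ⟨i, ha⟩ ⟨j, hb⟩ hab
    rw [hI i a ha, hI j b hb]
    refine hprime i j a ha b hb ?_
    rw [← map_mul]
    exact (hI _ _ (SetLike.mul_mem_graded ha hb)).mp hab
  let x : ProjectiveSpectrum (coneGrading V) := ⟨⟨I, hhom⟩, hIp, fun hle => hap <| by
    refine (hI j₀ a₀ ha₀).mp (hle ?_)
    rw [HomogeneousIdeal.mem_irrelevant_iff, GradedRing.proj_apply,
      DirectSum.decompose_of_mem_ne _ ha₀ hj₀.ne']⟩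
  exact ⟨x, hI⟩

/-- The point of the torus given by a prime ideal of the ring of Laurent polynomials. -/
lemma exists_torus_point (M : Ideal (Laurent n)) [hM : M.IsPrime] :
    ∃ x : toricVariety V, ∀ j, ∀ N ∈ coneGrading V j, (N ∈ primeOf x ↔ dehom V N ∈ M) := by
  refine exists_point (fun _ => M.restrictScalars ℂ) ?_ ?_ ?_
  · intro i j a _ b hb
    exact M.mul_mem_left _ hb
  · intro i j a _ b _ hab
    exact hM.mem_or_mem hab
  · refine ⟨1, one_pos, sPow V 1, sPow_mem 1, ?_⟩
    rw [dehom_sPow]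
    exact fun h => hM.ne_top ((Ideal.eq_top_iff_one M).mpr h)

/-- The generic point of the divisor of a vertex. -/
lemma IsFanoPolytope.exists_divisor_point (hV : IsFanoPolytope V) {v : Fin n → ℤ} (hv : v ∈ V) :
    ∃ ξ : toricVariety V, facetSet ξ = {v} ∧
      ∀ j, ∀ N ∈ coneGrading V j, (N ∈ primeOf ξ ↔ dehom V N ∈ ordGE v (-j + 1)) := by
  obtain ⟨l, hl0, hl⟩ := hV.exists_separating hv
  -- The monomial of `(-l, e)` has zero slack at `v` and positive slack at every other vertex. It
  -- shows both that the prime is relevant and that no other divisor passes through the point.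
  lift v ⬝ᵥ l to ℕ using hl0.le with e he
  have hcone : (-l, e) ∈ coneMonoid V := by
    rw [mem_coneMonoid]
    intro v' hv'
    simp only [dotProduct_neg]
    by_cases h : v' = v
    · rw [h, ← he]
    · have := hl v' hv' h
      omega
  have hnot : dehom V (coneMonomial (-l) e hcone) ∉ ordGE v (-e + 1) := by
    rw [dehom_coneMonomial, mem_ordGE]
    intro h
    have := h (-l) (by simp)
    rw [dotProduct_neg, ← he] at this
    omega
  obtain ⟨ξ, hξ⟩ := exists_point (V := V) (fun j : ℕ => ordGE v (-j + 1)) (by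
      intro i j a ha b hb
      convert mul_mem_ordGE (dehom_mem_ordGE ha hv) hb using 2
      push_cast
      ring) (by
      intro i j a ha b hb hab
      by_contra! hcon
      refine mul_notMem_ordGE (dehom_mem_ordGE ha hv) (dehom_mem_ordGE hb hv) hcon.1 hcon.2 ?_
      convert hab using 2
      push_cast
      ring) ⟨e, by exact_mod_cast hl0, _, coneMonomial_mem _ _ _, hnot⟩
  refine ⟨ξ, ?_, hξ⟩
  ext v'
  rw [Finset.mem_singleton]
  constructor
  · intro hv'
    by_contra hne
    have h1 := dotProduct_of_mem_facetSet hv' hcone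
      (by rwa [hξ e _ (coneMonomial_mem _ _ _)])
    have := hl v' (mem_of_mem_facetSet hv') hne
    rw [dotProduct_neg] at h1
    omega
  · rintro rfl
    rw [mem_facetSet]
    refine ⟨hv, fun m j h hm => ?_⟩
    rw [hξ j _ (coneMonomial_mem _ _ _), dehom_coneMonomial] at hm
    by_contra hne
    have h1 := h v' hv
    change -(j : ℤ) ≤ v' ⬝ᵥ m at h1
    exact hm (single_mem_ordGE 1 (by omega))

/-! ### Global sections -/

/-- The `k`-th multiple of the polytope, in the lattice. -/
def latticePoints (V : Finset (Fin n → ℤ)) (k : ℕ) : Set (Fin n → ℤ) :=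
  {m | ∀ v ∈ V, -(k : ℤ) ≤ v ⬝ᵥ m}

lemma mem_latticePoints {k : ℕ} {m : Fin n → ℤ} :
    m ∈ latticePoints V k ↔ ∀ v ∈ V, -(k : ℤ) ≤ v ⬝ᵥ m := Iff.rfl

/-- On the torus there is no pole condition, so regularity at all its closed points makes `f` a
Laurent polynomial. The generic points of the divisors then bound the exponents, one inequality for
each vertex. -/
lemma sectionOf_mem_sections_iff (hV : IsFanoPolytope V) {k : ℕ}
    {f : (toricVariety V).functionField} :
    sectionOf V k f ∈ anticanonicalSections (toricVariety V) n k ↔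
      ∃ g ∈ AddMonoidAlgebra.supported ℂ ℂ (latticePoints V k), f = toField V g := by
  rw [anticanonicalSections, Submodule.mem_iInf]
  constructor
  · intro h
    choose j L D hD hx hf hL using fun x => exists_of_mem_stalk hV (h x)
    obtain ⟨g, hg⟩ : ∃ g, f = toField V g := by
      -- This is the ideal of denominators of `f`. A maximal ideal containing it would give a point
      -- of the torus at which no denominator is invertible.
      let I : Ideal (Laurent n) :=
        { carrier := {g | ∃ a, toField V g * f = toField V a}
          zero_mem' := ⟨0, by simp⟩
          add_mem' := by
            rintro a b ⟨a', ha⟩ ⟨b', hb⟩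
            exact ⟨a' + b', by rw [map_add, map_add, add_mul, ha, hb]⟩
          smul_mem' := by
            rintro c a ⟨a', ha⟩
            exact ⟨c * a', by rw [smul_eq_mul, map_mul, map_mul, mul_assoc, ha]⟩ }
      have hI : ∀ x, dehom V (D x) ∈ I := by
        intro x
        refine ⟨L x, ?_⟩
        have h0 := toField_dehom_ne_zero (hD x) (ne_zero_of_notMem_primeOf (hx x))
        rw [hf x]
        field_simp
      by_cases htop : I = ⊤
      · obtain ⟨a, ha⟩ : (1 : Laurent n) ∈ I := htop ▸ Submodule.mem_top
        exact ⟨a, by rw [← ha, map_one, one_mul]⟩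
      · obtain ⟨M, hM, hIM⟩ := Ideal.exists_le_maximal I htop
        have := hM.isPrime
        obtain ⟨x, hxM⟩ := exists_torus_point (V := V) M
        exact absurd ((hxM _ _ (hD x)).mpr (hIM (hI x))) (hx x)
    refine ⟨g, ?_, hg⟩
    rw [AddMonoidAlgebra.mem_supported]
    intro m hm
    rw [mem_latticePoints]
    intro v hv
    obtain ⟨ξ, hξ, -⟩ := hV.exists_divisor_point hv
    have hvξ : v ∈ facetSet ξ := by rw [hξ]; exact Finset.mem_singleton_self v
    have h0 := toField_dehom_ne_zero (hD ξ) (ne_zero_of_notMem_primeOf (hx ξ))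
    have h1 : g * dehom V (D ξ) = L ξ := by
      apply toField_injective V
      rw [map_mul, ← hg, hf ξ, div_mul_cancel₀ _ h0]
    have h2 : g ∈ ordGE v (-k) := by
      refine mem_ordGE_of_mul (dehom_mem_ordGE (hD ξ) hv) (dehom_notMem_ordGE hvξ (hD ξ) (hx ξ)) ?_
      rw [h1]
      convert hL ξ v hvξ using 2
      ring
    exact h2 m (Finsupp.mem_support_iff.mp hm)
  · rintro ⟨g, hg, rfl⟩ x
    have h1 := sectionOf_mem_stalk hV (x := x) (k := k) (j := 0) (L := g) (D := 1)
      SetLike.GradedOne.one_mem (one_notMem_primeOf x) (by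
        intro v hv m hm
        have := hg (Finsupp.mem_support_iff.mpr hm) v (mem_of_mem_facetSet hv)
        simpa using this)
    rwa [map_one, map_one, div_one] at h1

/-- The section given by a Laurent polynomial. -/
def laurentSection (V : Finset (Fin n → ℤ)) (k : ℕ) :
    Laurent n →ₗ[ℂ] (RationalForm (toricVariety V) n → (toricVariety V).functionField) where
  toFun g := sectionOf V k (toField V g)
  map_add' a b := by
    funext ω
    simp only [sectionOf, map_add, mul_add, Pi.add_apply]
  map_smul' c a := by
    funext ω
    simp only [sectionOf, map_smul, mul_smul_comm, Pi.smul_apply, RingHom.id_apply]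

lemma laurentSection_apply (k : ℕ) (g : Laurent n) :
    laurentSection V k g = sectionOf V k (toField V g) := rfl

lemma laurentSection_injective (V : Finset (Fin n → ℤ)) (k : ℕ) :
    Function.Injective (laurentSection V k) :=
  (sectionOf_injective V k).comp (toField_injective V)

lemma laurentSection_mul (k l : ℕ) (a b : Laurent n) :
    laurentSection V k a * laurentSection V l b = laurentSection V (k + l) (a * b) := by
  funext ω
  simp only [laurentSection_apply, sectionOf, Pi.mul_apply, map_mul]
  ring

lemma laurentSection_one : laurentSection V 0 1 = 1 := by
  funext ω
  simp only [laurentSection_apply, sectionOf, pow_zero, map_one, mul_one, Pi.one_apply]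

lemma laurentSection_pow (k : ℕ) (a : Laurent n) (e : ℕ) :
    laurentSection V k a ^ e = laurentSection V (e * k) (a ^ e) := by
  induction e with
  | zero => rw [pow_zero, pow_zero, zero_mul, laurentSection_one]
  | succ e ih => rw [pow_succ, ih, laurentSection_mul, pow_succ, add_mul, one_mul]

lemma anticanonicalSections_eq (hV : IsFanoPolytope V) (k : ℕ) :
    anticanonicalSections (toricVariety V) n k =
      (AddMonoidAlgebra.supported ℂ ℂ (latticePoints V k)).map (laurentSection V k) := by
  ext s
  rw [Submodule.mem_map]
  constructor
  · intro hs
    have hs' := hs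
    rw [anticanonicalSections, Submodule.mem_iInf] at hs'
    have h1 := eq_sectionOf (hs' (genericPoint (toricVariety V))).1
    rw [h1] at hs
    obtain ⟨g, hg, hfg⟩ := (sectionOf_mem_sections_iff hV).mp hs
    exact ⟨g, hg, by rw [h1, hfg]; rfl⟩
  · rintro ⟨g, hg, rfl⟩
    exact (sectionOf_mem_sections_iff hV).mpr ⟨g, hg, rfl⟩

lemma finrank_map_supported (S : Set (Fin n → ℤ)) (hS : S.Finite) (k : ℕ) :
    Module.finrank ℂ ((AddMonoidAlgebra.supported ℂ ℂ S).map (laurentSection V k)) = S.ncard := by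
  have : Fintype S := hS.fintype
  rw [← (Submodule.equivMapOfInjective _ (laurentSection_injective V k) _).finrank_eq,
    AddMonoidAlgebra.supported_eq_map]
  rw [← (Submodule.equivMapOfInjective _
      (AddMonoidAlgebra.coeffLinearEquiv ℂ).symm.injective _).finrank_eq,
    (Finsupp.supportedEquivFinsupp S).finrank_eq, Module.finrank_finsupp_self,
    Set.ncard_eq_toFinset_card', Set.toFinset_card]

/-! ### Boundedness of the polytope and finite generation of the cone -/

/-- The convex hull contains a ball about the origin, hence small multiples of the vectors `± e_i`,
and the inequalities extend from the vertices to the hull. -/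
lemma IsFanoPolytope.exists_bound (hV : IsFanoPolytope V) : ∃ R : ℝ, 0 < R ∧
    ∀ (t : ℝ) (p : Fin n → ℝ), (∀ v ∈ V, -t ≤ toReal v ⬝ᵥ p) → ∀ i, |p i| ≤ R * t := by
  obtain ⟨ε, hε, hball⟩ := Metric.mem_nhds_iff.mp
    (mem_interior_iff_mem_nhds.mp hV.zero_mem_interior)
  refine ⟨2 / ε, by positivity, fun t p hp i => ?_⟩
  have hsub : convexHull ℝ (toReal '' (V : Set (Fin n → ℤ))) ⊆ {q | -t ≤ q ⬝ᵥ p} := by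
    refine convexHull_min ?_ ?_
    · rintro _ ⟨v, hv, rfl⟩
      exact hp v hv
    · exact convex_halfSpace_ge ⟨fun a b => add_dotProduct a b p,
        fun c a => smul_dotProduct c a p⟩ _
  have key : ∀ c : ℝ, |c| < ε → -t ≤ c * p i := by
    intro c hc
    have h1 : (Pi.single i c : Fin n → ℝ) ∈ Metric.ball (0 : Fin n → ℝ) ε := by
      rw [mem_ball_zero_iff, Pi.norm_single]
      exact hc
    have h2 : -t ≤ (Pi.single i c : Fin n → ℝ) ⬝ᵥ p := hsub (hball h1)
    rwa [single_dotProduct] at h2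
  have h1 := key (ε / 2) (by rw [abs_of_pos (by positivity)]; linarith)
  have h2 := key (-(ε / 2)) (by rw [abs_neg, abs_of_pos (by positivity)]; linarith)
  rw [abs_le]
  have h3 : 2 / ε * t * (ε / 2) = t := by field_simp
  have h4 : 0 < ε / 2 := by positivity
  constructor <;> by_contra! hlt
  · nlinarith [mul_lt_mul_of_pos_right hlt h4]
  · nlinarith [mul_lt_mul_of_pos_right hlt h4]

lemma IsFanoPolytope.finite_latticePoints (hV : IsFanoPolytope V) (k : ℕ) :
    (latticePoints V k).Finite := by
  obtain ⟨R, hR, hb⟩ := hV.exists_bound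
  refine (Set.finite_Icc (fun _ : Fin n => -⌈R * k⌉) fun _ => ⌈R * k⌉).subset fun m hm => ?_
  have h1 := hb k (toReal m) fun v hv => by
    rw [toReal_dotProduct]
    exact_mod_cast hm v hv
  have h2 : ∀ i, |m i| ≤ ⌈R * k⌉ := fun i => by
    have h3 : ((|m i| : ℤ) : ℝ) ≤ ⌈R * k⌉ := by
      rw [Int.cast_abs]
      exact (h1 i).trans (Int.le_ceil _)
    exact_mod_cast h3
  exact ⟨fun i => (abs_le.mp (h2 i)).1, fun i => (abs_le.mp (h2 i)).2⟩

/-- The lattice points in the multiples of the polytope are finitely generated. -/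
lemma IsFanoPolytope.exists_generators (hV : IsFanoPolytope V) :
    ∃ (N : ℕ) (q : Fin N → (Fin n → ℤ) × ℕ), (∀ i, q i ∈ coneMonoid V) ∧
      ∀ p ∈ coneMonoid V, ∃ e : Fin N → ℕ, p = ∑ i, e i • q i := by
  -- The distances to the facets, together with the degree, embed the cone in a power of `ℕ`.
  let slack : coneMonoid V →+ (V → ℕ) × ℕ :=
    { toFun := fun p => (fun v => (v.1 ⬝ᵥ p.1.1 + p.1.2).toNat, p.1.2)
      map_zero' := by
        refine Prod.ext (funext fun v => ?_) rfl
        simp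
      map_add' := by
        intro a b
        refine Prod.ext (funext fun v => ?_) rfl
        have ha := a.2 v v.2
        have hb := b.2 v v.2
        change -(a.1.2 : ℤ) ≤ v.1 ⬝ᵥ a.1.1 at ha
        change -(b.1.2 : ℤ) ≤ v.1 ⬝ᵥ b.1.1 at hb
        simp only [AddSubmonoid.coe_add, Prod.fst_add, Prod.snd_add, dotProduct_add, Pi.add_apply]
        omega }
  have hslack : ∀ (p : coneMonoid V) (v : V),
      (((slack p).1 v : ℕ) : ℤ) = v.1 ⬝ᵥ p.1.1 + p.1.2 := by
    intro p v
    have h := p.2 v v.2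
    change -(p.1.2 : ℤ) ≤ v.1 ⬝ᵥ p.1.1 at h
    exact Int.toNat_of_nonneg (by omega)
  have hslack2 : ∀ p : coneMonoid V, (slack p).2 = p.1.2 := fun _ => rfl
  have hinj : Function.Injective slack := by
    intro a b hab
    have h2 : a.1.2 = b.1.2 := by rw [← hslack2, ← hslack2, hab]
    have h1 : ∀ v ∈ V, v ⬝ᵥ (a.1.1 - b.1.1) = 0 := by
      intro v hv
      have ha := hslack a ⟨v, hv⟩
      have hb := hslack b ⟨v, hv⟩
      rw [hab, h2] at ha
      rw [dotProduct_sub]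
      linarith
    refine Subtype.ext (Prod.ext (sub_eq_zero.mp ?_) h2)
    by_contra hne
    have hne' : toReal (a.1.1 - b.1.1) ≠ 0 := by
      intro h
      refine hne (funext fun i => ?_)
      exact Int.cast_eq_zero.mp (congrFun h i)
    obtain ⟨v, hv, hpos⟩ := hV.exists_dotProduct_pos hne'
    rw [toReal_dotProduct, h1 v hv] at hpos
    simp at hpos
  -- If one slack vector dominates another, the difference of the lattice points lies in the cone
  -- again. The image is thus closed under subtraction within the power of `ℕ`, which makes it
  -- finitely generated.
  have hfg : (AddMonoidHom.mrange slack).FG := by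
    refine AddSubmonoid.fg_of_subtractive ?_
    rintro _ ⟨a, rfl⟩ y ⟨b, hb⟩
    have hle : slack a ≤ slack b := by
      rw [hb]
      exact le_self_add
    have hab2 : a.1.2 ≤ b.1.2 := hle.2
    have hab : ∀ v ∈ V, v ⬝ᵥ a.1.1 + a.1.2 ≤ v ⬝ᵥ b.1.1 + b.1.2 := by
      intro v hv
      rw [← hslack a ⟨v, hv⟩, ← hslack b ⟨v, hv⟩]
      exact_mod_cast hle.1 ⟨v, hv⟩
    have hc : (b.1.1 - a.1.1, b.1.2 - a.1.2) ∈ coneMonoid V := by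
      rw [mem_coneMonoid]
      intro v hv
      have := hab v hv
      simp only [dotProduct_sub]
      omega
    refine ⟨⟨_, hc⟩, ?_⟩
    have h1 : a + ⟨_, hc⟩ = b := by
      refine Subtype.ext (Prod.ext ?_ ?_)
      · simp
      · change a.1.2 + (b.1.2 - a.1.2) = b.1.2
        omega
    have h2 := congrArg slack h1
    rw [map_add, hb] at h2
    exact add_left_cancel h2
  obtain ⟨S, hS, hfin⟩ := (AddSubmonoid.fg_iff _).mp hfg
  have := hfin.fintype
  let e := (Fintype.equivFin S).symm
  have hmem : ∀ s : S, ∃ a, slack a = s.1 := fun s => by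
    have : s.1 ∈ AddMonoidHom.mrange slack := hS ▸ AddSubmonoid.subset_closure s.2
    exact this
  choose a ha using hmem
  refine ⟨Fintype.card S, fun i => (a (e i)).1, fun i => (a (e i)).2, fun p hp => ?_⟩
  have h1 : slack ⟨p, hp⟩ ∈ AddSubmonoid.closure S := by
    rw [hS]
    exact ⟨_, rfl⟩
  obtain ⟨f, hf⟩ := AddSubmonoid.mem_closure_iff_of_fintype.mp h1
  refine ⟨fun i => f (e i), ?_⟩
  have h2 : (⟨p, hp⟩ : coneMonoid V) = ∑ i, f (e i) • a (e i) := by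
    apply hinj
    rw [hf, Equiv.sum_comp e (fun s => f s • a s), map_sum]
    simp only [map_nsmul, ha]
  have h3 := congrArg Subtype.val h2
  rw [AddSubmonoid.coe_finsetSum] at h3
  exact h3

/-! ### Test configurations of one-parameter subgroups of the torus -/

/-- The part of the lattice points in a multiple of the polytope on which `ξ` is at least `w`. -/
def latticePointsGE (V : Finset (Fin n → ℤ)) (ξ : Fin n → ℤ) (k : ℕ) (w : ℤ) :
    Set (Fin n → ℤ) :=
  {m | m ∈ latticePoints V k ∧ w ≤ ξ ⬝ᵥ m}

lemma supported_latticePointsGE {ξ : Fin n → ℤ} {k : ℕ} {w : ℤ} {g : Laurent n} :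
    g ∈ AddMonoidAlgebra.supported ℂ ℂ (latticePointsGE V ξ k w) ↔
      g ∈ AddMonoidAlgebra.supported ℂ ℂ (latticePoints V k) ∧ g ∈ ordGE ξ w := by
  rw [AddMonoidAlgebra.mem_supported, AddMonoidAlgebra.mem_supported, mem_ordGE]
  constructor
  · intro h
    exact ⟨fun m hm => (h hm).1, fun m hm => (h (Finsupp.mem_support_iff.mpr hm)).2⟩
  · intro h m hm
    exact ⟨h.1 hm, h.2 m (Finsupp.mem_support_iff.mp hm)⟩

lemma mul_mem_supported_latticePoints {k l : ℕ} {a b : Laurent n}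
    (ha : a ∈ AddMonoidAlgebra.supported ℂ ℂ (latticePoints V k))
    (hb : b ∈ AddMonoidAlgebra.supported ℂ ℂ (latticePoints V l)) :
    a * b ∈ AddMonoidAlgebra.supported ℂ ℂ (latticePoints V (k + l)) := by
  rw [AddMonoidAlgebra.mem_supported] at ha hb ⊢
  have hord : ∀ v ∈ V, a * b ∈ ordGE v (-k + -l) := fun v hv =>
    mul_mem_ordGE (fun m hm => ha (Finsupp.mem_support_iff.mpr hm) v hv)
      (fun m hm => hb (Finsupp.mem_support_iff.mpr hm) v hv)
  intro m hm v hv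
  have := hord v hv m (Finsupp.mem_support_iff.mp hm)
  change -((k + l : ℕ) : ℤ) ≤ v ⬝ᵥ m
  push_cast
  linarith

lemma single_mem_supported {S : Set (Fin n → ℤ)} {m : Fin n → ℤ} (hm : m ∈ S) (c : ℂ) :
    (AddMonoidAlgebra.single m c : Laurent n) ∈ AddMonoidAlgebra.supported ℂ ℂ S := by
  rw [AddMonoidAlgebra.mem_supported']
  intro m' hm'
  rw [AddMonoidAlgebra.coeff_single, Finsupp.single_apply, if_neg]
  rintro rfl
  exact hm' hm

lemma pow_notMem_ordGE {v : Fin n → ℤ} {k : ℤ} {a : Laurent n} (ha : a ∈ ordGE v k)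
    (ha' : a ∉ ordGE v (k + 1)) (e : ℕ) : a ^ e ∉ ordGE v (e * k + 1) := by
  induction e with
  | zero =>
    intro h
    have := h 0 (by rw [pow_zero, AddMonoidAlgebra.one_def]; simp)
    simp at this
  | succ e ih =>
    intro h
    refine mul_notMem_ordGE (pow_mem_ordGE ha e) ha ih ha' ?_
    rw [← pow_succ]
    convert h using 2
    push_cast
    ring

/-- If `g` had order `d < w`, each term `α i * g ^ (e - i)` would have order at least `i w + (e - i)
d > e d`, while `g ^ e` has order exactly `e d`. -/
lemma mem_ordGE_of_integral {v : Fin n → ℤ} {w : ℤ} {g : Laurent n} {e : ℕ} {α : ℕ → Laurent n}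
    (hα : ∀ i ∈ Finset.Icc 1 e, α i ∈ ordGE v (i * w))
    (h : g ^ e + ∑ i ∈ Finset.Icc 1 e, α i * g ^ (e - i) = 0) : g ∈ ordGE v w := by
  by_contra hg
  have hg0 : g ≠ 0 := by
    rintro rfl
    exact hg (zero_mem _)
  obtain ⟨d, hd, hd'⟩ := exists_ord (v := v) hg0
  have hdw : d < w := by
    by_contra! hle
    exact hg (ordGE_mono hle hd)
  refine pow_notMem_ordGE hd hd' e ?_
  rw [eq_neg_of_add_eq_zero_left h]
  refine neg_mem (Submodule.sum_mem _ fun i hi => ?_)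
  refine ordGE_mono ?_ (mul_mem_ordGE (hα i hi) (pow_mem_ordGE hd (e - i)))
  obtain ⟨hi1, hi2⟩ := Finset.mem_Icc.mp hi
  rw [Nat.cast_sub hi2]
  have hi1' : (1 : ℤ) ≤ i := by exact_mod_cast hi1
  nlinarith

/-- The filtration of a one-parameter subgroup of the torus. -/
def weightFiltration (V : Finset (Fin n → ℤ)) (ξ : Fin n → ℤ) (k : ℕ) (w : ℤ) :
    Submodule ℂ (RationalForm (toricVariety V) n → (toricVariety V).functionField) :=
  (AddMonoidAlgebra.supported ℂ ℂ (latticePointsGE V ξ k w)).map (laurentSection V k)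

/-- The filtration is spanned by monomials, and the weight of a monomial is additive, so generators
of the lattice cone generate the Rees algebra. -/
lemma weightFiltration_generated (hV : IsFanoPolytope V) (ξ : Fin n → ℤ) :
    ∃ (N : ℕ) (deg : Fin N → ℕ) (wt : Fin N → ℤ)
    (s : Fin N → RationalForm (toricVariety V) n → (toricVariety V).functionField),
    (∀ i, s i ∈ weightFiltration V ξ (deg i) (wt i)) ∧
      ∀ k w, weightFiltration V ξ k w ≤ Submodule.span ℂ {f | ∃ e : Fin N → ℕ,
        ∑ i, e i * deg i = k ∧ w ≤ ∑ i, (e i : ℤ) * wt i ∧ f = ∏ i, s i ^ e i} := by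
  obtain ⟨N, q, hq, hgen⟩ := hV.exists_generators
  refine ⟨N, fun i => (q i).2, fun i => ξ ⬝ᵥ (q i).1,
    fun i => laurentSection V (q i).2 (AddMonoidAlgebra.single (q i).1 1), fun i => ?_,
    fun k w => ?_⟩
  · have h : (q i).1 ∈ latticePointsGE V ξ (q i).2 (ξ ⬝ᵥ (q i).1) := ⟨hq i, le_rfl⟩
    exact Submodule.mem_map_of_mem (single_mem_supported h 1)
  · rw [weightFiltration, Submodule.map_le_iff_le_comap]
    intro g hg
    rw [eq_sum_single g]
    refine Submodule.sum_mem _ fun m hm => ?_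
    obtain ⟨hm1, hm2⟩ := hg hm
    rw [Submodule.mem_comap, ← mul_one (g.coeff m), ← smul_eq_mul, ← AddMonoidAlgebra.smul_single,
      map_smul]
    refine Submodule.smul_mem _ _ (Submodule.subset_span ?_)
    obtain ⟨e, he⟩ := hgen (m, k) hm1
    have he1 : m = ∑ i, e i • (q i).1 := by
      have := congrArg Prod.fst he
      rwa [Prod.fst_sum] at this
    have he2 : k = ∑ i, e i * (q i).2 := by
      have := congrArg Prod.snd he
      rwa [Prod.snd_sum] at this
    refine ⟨e, he2.symm, ?_, ?_⟩
    · refine hm2.trans (le_of_eq ?_)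
      rw [he1, dotProduct_sum]
      refine Finset.sum_congr rfl fun i _ => ?_
      rw [dotProduct_smul, nsmul_eq_mul]
    · have h1 : ∀ S : Finset (Fin N), ∏ i ∈ S, laurentSection V (q i).2
          (AddMonoidAlgebra.single (q i).1 1) ^ e i = laurentSection V (∑ i ∈ S, e i * (q i).2)
            (AddMonoidAlgebra.single (∑ i ∈ S, e i • (q i).1) 1) := by
        classical
        intro S
        induction S using Finset.induction_on with
        | empty => exact laurentSection_one.symm
        | insert i S hi ih =>
          rw [Finset.prod_insert hi, Finset.sum_insert hi, Finset.sum_insert hi, ih,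
            laurentSection_pow, laurentSection_mul, AddMonoidAlgebra.single_pow, one_pow,
            AddMonoidAlgebra.single_mul_single, one_mul]
      rw [h1, ← he1, ← he2]

/-- The product test configuration of a one-parameter subgroup of the torus. -/
def productConfiguration (hV : IsFanoPolytope V) (ξ : Fin n → ℤ) :
    TestConfiguration (toricVariety V) n 1 where
  F := weightFiltration V ξ
  le_sections k w := by
    rw [one_mul, anticanonicalSections_eq hV]
    exact Submodule.map_mono fun g hg => (supported_latticePointsGE.mp hg).1
  antitone k w w' h := by
    refine Submodule.map_mono fun g hg => ?_
    rw [supported_latticePointsGE] at hg ⊢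
    exact ⟨hg.1, ordGE_mono h hg.2⟩
  exhaustive k := by
    obtain ⟨w, hw⟩ := ((hV.finite_latticePoints k).image fun m => ξ ⬝ᵥ m).bddBelow
    refine ⟨w, ?_⟩
    rw [one_mul, anticanonicalSections_eq hV, weightFiltration]
    congr 2
    ext m
    exact ⟨fun h => h.1, fun h => ⟨h, hw ⟨m, h, rfl⟩⟩⟩
  separated k := by
    obtain ⟨w, hw⟩ := ((hV.finite_latticePoints k).image fun m => ξ ⬝ᵥ m).bddAbove
    refine ⟨w + 1, ?_⟩
    have h1 : latticePointsGE V ξ k (w + 1) = ∅ := by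
      rw [Set.eq_empty_iff_forall_notMem]
      rintro m ⟨h1, h2⟩
      have := hw ⟨m, h1, rfl⟩
      simp only at this
      omega
    rw [weightFiltration, h1, eq_bot_iff]
    rintro _ ⟨g, hg, rfl⟩
    rw [SetLike.mem_coe, AddMonoidAlgebra.mem_supported, Set.subset_empty_iff, Finset.coe_eq_empty,
      Finsupp.support_eq_empty, AddMonoidAlgebra.coeff_eq_zero] at hg
    rw [hg, map_zero]
    exact zero_mem _
  one_mem := by
    rw [← laurentSection_one]
    have h : (0 : Fin n → ℤ) ∈ latticePointsGE V ξ 0 0 := ⟨zero_mem_coneMonoid V 0, by simp⟩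
    exact Submodule.mem_map_of_mem (single_mem_supported h 1)
  mul_mem := by
    rintro k l w w' _ _ ⟨a, ha, rfl⟩ ⟨b, hb, rfl⟩
    rw [laurentSection_mul]
    refine Submodule.mem_map_of_mem ?_
    rw [SetLike.mem_coe, supported_latticePointsGE] at ha hb
    rw [supported_latticePointsGE]
    exact ⟨mul_mem_supported_latticePoints ha.1 hb.1, mul_mem_ordGE ha.2 hb.2⟩
  finitelyGenerated := weightFiltration_generated hV ξ
  integrallyClosed := by
    rintro k w s hs ⟨e, a, -, ha, h⟩
    rw [one_mul, anticanonicalSections_eq hV] at hs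
    obtain ⟨g, hg, rfl⟩ := hs
    refine Submodule.mem_map_of_mem ?_
    rw [supported_latticePointsGE]
    refine ⟨hg, ?_⟩
    have h1 : ∀ i, ∃ α, i ∈ Finset.Icc 1 e →
        α ∈ AddMonoidAlgebra.supported ℂ ℂ (latticePointsGE V ξ (i * k) (i * w)) ∧
          laurentSection V (i * k) α = a i := by
      intro i
      by_cases hi : i ∈ Finset.Icc 1 e
      · obtain ⟨α, hα⟩ := ha i hi
        exact ⟨α, fun _ => hα⟩
      · exact ⟨0, fun h => absurd h hi⟩
    choose α hα using h1
    refine mem_ordGE_of_integral (e := e) (α := α)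
      (fun i hi => (supported_latticePointsGE.mp (hα i hi).1).2) ?_
    apply laurentSection_injective V (e * k)
    rw [map_zero, map_add, map_sum, ← h, laurentSection_pow]
    congr 1
    refine Finset.sum_congr rfl fun i hi => ?_
    rw [← (hα i hi).2, laurentSection_pow, laurentSection_mul, ← add_mul,
      Nat.add_sub_cancel' (Finset.mem_Icc.mp hi).2]

/-! ### Dimensions and weights as lattice sums -/

/-- The lattice points in a multiple of the polytope. -/
def latticeFinset (hV : IsFanoPolytope V) (k : ℕ) : Finset (Fin n → ℤ) :=
  (hV.finite_latticePoints k).toFinset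

lemma mem_latticeFinset (hV : IsFanoPolytope V) {k : ℕ} {m : Fin n → ℤ} :
    m ∈ latticeFinset hV k ↔ ∀ v ∈ V, -(k : ℤ) ≤ v ⬝ᵥ m := by
  rw [latticeFinset, Set.Finite.mem_toFinset]
  rfl

lemma finrank_anticanonicalSections (hV : IsFanoPolytope V) (k : ℕ) :
    Module.finrank ℂ (anticanonicalSections (toricVariety V) n k) = (latticeFinset hV k).card := by
  rw [anticanonicalSections_eq hV, finrank_map_supported _ (hV.finite_latticePoints k),
    latticeFinset, Set.ncard_eq_toFinset_card _ (hV.finite_latticePoints k)]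

/-- The jump of the filtration at `w` counts the lattice points with `⟨ξ, m⟩ = w`. -/
lemma weight_productConfiguration (hV : IsFanoPolytope V) (ξ : Fin n → ℤ) (k : ℕ) :
    (productConfiguration hV ξ).weight k = ∑ m ∈ latticeFinset hV k, ξ ⬝ᵥ m := by
  classical
  have h1 : ∀ w, Module.finrank ℂ (weightFiltration V ξ k w) =
      ((latticeFinset hV k).filter fun m => w ≤ ξ ⬝ᵥ m).card := by
    intro w
    have hfin : (latticePointsGE V ξ k w).Finite :=
      (hV.finite_latticePoints k).subset fun m hm => hm.1
    rw [weightFiltration, finrank_map_supported _ hfin, ← Set.ncard_coe_finset]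
    congr 1
    ext m
    simp [latticePointsGE, mem_latticeFinset, mem_latticePoints]
  have h2 : ∀ w, (Module.finrank ℂ (weightFiltration V ξ k w) : ℤ) -
      Module.finrank ℂ (weightFiltration V ξ k (w + 1)) =
        ((latticeFinset hV k).filter fun m => ξ ⬝ᵥ m = w).card := by
    intro w
    rw [h1, h1, sub_eq_iff_eq_add, ← Nat.cast_add, ← Finset.card_union_of_disjoint]
    · congr 2
      ext m
      simp only [Finset.mem_filter, Finset.mem_union, ← and_or_left]
      refine and_congr_right fun _ => ?_
      omega
    · rw [Finset.disjoint_filter]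
      intro m _ h
      omega
  change ∑ᶠ w : ℤ, w * ((Module.finrank ℂ (weightFiltration V ξ k w) : ℤ) -
    Module.finrank ℂ (weightFiltration V ξ k (w + 1))) = _
  simp only [h2]
  rw [finsum_eq_sum_of_support_subset (s := (latticeFinset hV k).image fun m => ξ ⬝ᵥ m)]
  · have := Finset.sum_comp (s := latticeFinset hV k) (fun w : ℤ => w) (fun m => ξ ⬝ᵥ m)
    rw [this]
    refine Finset.sum_congr rfl fun w _ => ?_
    rw [nsmul_eq_mul, mul_comm]
  · intro w hw
    rw [Function.mem_support] at hw
    by_contra hnot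
    refine hw ?_
    rw [Finset.filter_eq_empty_iff.mpr, Finset.card_empty, Nat.cast_zero, mul_zero]
    intro m hm h
    exact hnot (by simpa using ⟨m, hm, h⟩)

/-! ### Integrals over dilates of the polytope -/

section Dilate

open MeasureTheory
open scoped Pointwise

/-- The dilates of the polytope. -/
def dilate (V : Finset (Fin n → ℤ)) (t : ℝ) : Set (Fin n → ℝ) :=
  {p | ∀ v ∈ V, -t ≤ toReal v ⬝ᵥ p}

lemma mem_dilate {t : ℝ} {p : Fin n → ℝ} : p ∈ dilate V t ↔ ∀ v ∈ V, -t ≤ toReal v ⬝ᵥ p := Iff.rfl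

lemma continuous_dotProduct_right (a : Fin n → ℝ) : Continuous fun p : Fin n → ℝ => a ⬝ᵥ p := by
  unfold dotProduct
  fun_prop

lemma isClosed_dilate (V : Finset (Fin n → ℤ)) (t : ℝ) : IsClosed (dilate V t) := by
  have : dilate V t = ⋂ v ∈ V, {p | -t ≤ toReal v ⬝ᵥ p} := by
    ext
    simp [mem_dilate]
  rw [this]
  exact isClosed_biInter fun v _ => isClosed_le continuous_const (continuous_dotProduct_right _)

lemma IsFanoPolytope.isCompact_dilate (hV : IsFanoPolytope V) (t : ℝ) :
    IsCompact (dilate V t) := by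
  refine Metric.isCompact_of_isClosed_isBounded (isClosed_dilate V t) ?_
  obtain ⟨R, -, hb⟩ := hV.exists_bound
  refine (isCompact_Icc (a := fun _ : Fin n => -(R * t)) (b := fun _ => R * t)).isBounded.subset
    fun p hp => ?_
  exact ⟨fun i => (abs_le.mp (hb t p hp i)).1, fun i => (abs_le.mp (hb t p hp i)).2⟩

lemma dilate_eq_smul {t : ℝ} (ht : 0 < t) : dilate V t = t • dilate V 1 := by
  ext p
  rw [Set.mem_smul_set_iff_inv_smul_mem₀ ht.ne', mem_dilate, mem_dilate]
  refine forall₂_congr fun v _ => ?_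
  rw [dotProduct_smul, smul_eq_mul, ← div_eq_inv_mul, le_div_iff₀ ht, neg_one_mul]

lemma volume_dilate {t : ℝ} (ht : 0 < t) :
    volume.real (dilate V t) = t ^ n * volume.real (dilate V 1) := by
  rw [dilate_eq_smul ht, Measure.real, Measure.addHaar_smul, ENNReal.toReal_mul,
    ENNReal.toReal_ofReal (abs_nonneg _), Module.finrank_fin_fun, abs_of_pos (by positivity)]
  rfl

lemma integral_dilate {t : ℝ} (ht : 0 < t) (a : Fin n → ℝ) :
    ∫ p in dilate V t, a ⬝ᵥ p = t ^ (n + 1) * ∫ p in dilate V 1, a ⬝ᵥ p := by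
  have h := Measure.setIntegral_comp_smul_of_pos volume (fun p : Fin n → ℝ => a ⬝ᵥ p)
    (dilate V 1) ht
  rw [← dilate_eq_smul ht, Module.finrank_fin_fun] at h
  simp only [dotProduct_smul, smul_eq_mul, integral_const_mul] at h
  have ht' : t ^ n ≠ 0 := by positivity
  field_simp at h
  rw [← h]
  ring

/-! ### Unit cubes around lattice points -/

/-- The unit cube centred at the origin. -/
def centredCube (n : ℕ) : Set (Fin n → ℝ) := Set.Icc (fun _ => -(1 / 2)) (fun _ => 1 / 2)

lemma volume_centredCube : volume (centredCube n) = 1 := by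
  rw [centredCube, Real.volume_Icc_pi]
  norm_num

lemma volume_real_centredCube : volume.real (centredCube n) = 1 := by
  rw [Measure.real, volume_centredCube, ENNReal.toReal_one]

lemma isCompact_centredCube : IsCompact (centredCube n) := isCompact_Icc

lemma abs_le_of_mem_centredCube {c : Fin n → ℝ} (hc : c ∈ centredCube n) (i : Fin n) :
    |c i| ≤ 1 / 2 :=
  abs_le.mpr ⟨hc.1 i, hc.2 i⟩

lemma abs_dotProduct_le_of_mem_centredCube (a : Fin n → ℝ) {c : Fin n → ℝ}
    (hc : c ∈ centredCube n) : |a ⬝ᵥ c| ≤ (∑ i, |a i|) / 2 := by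
  rw [dotProduct, Finset.sum_div]
  refine (Finset.abs_sum_le_sum_abs _ _).trans (Finset.sum_le_sum fun i _ => ?_)
  rw [abs_mul]
  have := mul_le_mul_of_nonneg_left (abs_le_of_mem_centredCube hc i) (abs_nonneg (a i))
  linarith

lemma integral_centredCube_neg (g : (Fin n → ℝ) → ℝ) :
    ∫ c in centredCube n, g (-c) = ∫ c in centredCube n, g c := by
  have h := (Measure.measurePreserving_neg (volume : Measure (Fin n → ℝ))).setIntegral_preimage_emb
    (MeasurableEquiv.neg (Fin n → ℝ)).measurableEmbedding g (centredCube n)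
  rw [← h]
  congr 2
  ext c
  simp only [centredCube, Set.mem_preimage, Set.mem_Icc, Pi.le_def, Pi.neg_apply]
  constructor
  · rintro ⟨h1, h2⟩
    exact ⟨fun i => by linarith [h2 i], fun i => by linarith [h1 i]⟩
  · rintro ⟨h1, h2⟩
    exact ⟨fun i => by linarith [h2 i], fun i => by linarith [h1 i]⟩

lemma setIntegral_eq_sum_centredCube {K : Set (Fin n → ℝ)} (hK : MeasurableSet K)
    {g : (Fin n → ℝ) → ℝ} (hg : IntegrableOn g K) (F : Finset (Fin n → ℤ))
    (hF : ∀ m : Fin n → ℤ, ∀ c ∈ centredCube n, toReal m + c ∈ K → m ∈ F) :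
    ∫ p in K, g p = ∑ m ∈ F, ∫ c in centredCube n, K.indicator g (toReal m + c) := by
  -- Half-open cubes partition the space, and they differ from the closed ones by null sets.
  let cube : (Fin n → ℤ) → Set (Fin n → ℝ) := fun m =>
    Set.univ.pi fun i => Set.Ico (toReal m i - 1 / 2) (toReal m i + 1 / 2)
  have hmem : ∀ p : Fin n → ℝ, p ∈ cube fun i => ⌊p i + 1 / 2⌋ := by
    intro p i _
    have h1 := Int.floor_le (p i + 1 / 2)
    have h2 := Int.lt_floor_add_one (p i + 1 / 2)
    exact ⟨by simp only [toReal]; linarith, by simp only [toReal]; linarith⟩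
  have hsub : ∀ m p, p ∈ cube m → p - toReal m ∈ centredCube n := by
    intro m p hp
    refine ⟨fun i => ?_, fun i => ?_⟩
    · have := (hp i trivial).1
      simp only [Pi.sub_apply]
      linarith
    · have := (hp i trivial).2
      simp only [Pi.sub_apply]
      linarith
  have hint : Integrable (K.indicator g) := (integrable_indicator_iff hK).mpr hg
  rw [← integral_indicator hK, ← setIntegral_eq_integral_of_forall_compl_eq_zero
    (s := ⋃ m ∈ F, cube m)]
  · rw [integral_biUnion_finset]
    · refine Finset.sum_congr rfl fun m _ => ?_
      have h1 : cube m =ᵐ[volume]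
          Set.Icc (fun i => toReal m i - 1 / 2) (fun i => toReal m i + 1 / 2) :=
        Measure.univ_pi_Ico_ae_eq_Icc
      rw [setIntegral_congr_set h1]
      have h2 := (measurePreserving_add_left (volume : Measure (Fin n → ℝ))
        (toReal m)).setIntegral_preimage_emb (measurableEmbedding_addLeft (toReal m))
        (K.indicator g) (Set.Icc (fun i => toReal m i - 1 / 2) (fun i => toReal m i + 1 / 2))
      rw [← h2]
      congr 2
      ext c
      simp only [centredCube, Set.mem_preimage, Set.mem_Icc, Pi.le_def, Pi.add_apply]
      constructor
      · rintro ⟨h1, h2⟩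
        exact ⟨fun i => by linarith [h1 i], fun i => by linarith [h2 i]⟩
      · rintro ⟨h1, h2⟩
        exact ⟨fun i => by linarith [h1 i], fun i => by linarith [h2 i]⟩
    · exact fun m _ => MeasurableSet.univ_pi fun i => measurableSet_Ico
    · intro m _ m' _ hne
      rw [Function.onFun, Set.disjoint_left]
      intro p hp hp'
      refine hne (funext fun i => ?_)
      have h1 := hp i trivial
      have h2 := hp' i trivial
      simp only [toReal, Set.mem_Ico] at h1 h2
      have h3 : (m i : ℝ) < m' i + 1 := by linarith
      have h4 : (m' i : ℝ) < m i + 1 := by linarith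
      have h3' : m i < m' i + 1 := by exact_mod_cast h3
      have h4' : m' i < m i + 1 := by exact_mod_cast h4
      omega
    · exact fun m _ => hint.integrableOn
  · intro p hp
    refine Set.indicator_of_notMem (fun hpK => hp ?_) _
    refine Set.mem_biUnion (hF _ _ (hsub _ _ (hmem p)) ?_) (hmem p)
    rwa [add_sub_cancel]

lemma volume_hyperplane {v : Fin n → ℝ} (hv : v ≠ 0) (b : ℝ) :
    volume {c : Fin n → ℝ | v ⬝ᵥ c = b} = 0 := by
  let f : (Fin n → ℝ) →ₗ[ℝ] ℝ := dotProductBilin ℝ ℝ v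
  have hf : f ≠ 0 := by
    intro h
    refine hv (dotProduct_self_eq_zero.mp ?_)
    exact LinearMap.congr_fun h v
  by_cases hne : ∃ c₀, v ⬝ᵥ c₀ = b
  · obtain ⟨c₀, hc₀⟩ := hne
    have h1 : {c : Fin n → ℝ | v ⬝ᵥ c = b} = (fun c => c + -c₀) ⁻¹' (LinearMap.ker f : Set _) := by
      ext c
      change v ⬝ᵥ c = b ↔ v ⬝ᵥ (c + -c₀) = 0
      rw [dotProduct_add, dotProduct_neg, hc₀, add_neg_eq_zero]
    rw [h1, measure_preimage_add_right]
    exact Measure.addHaar_submodule volume _ fun h => hf (LinearMap.ker_eq_top.mp h)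
  · push Not at hne
    have h1 : {c : Fin n → ℝ | v ⬝ᵥ c = b} = ∅ := by
      ext c
      simp [hne c]
    rw [h1, measure_empty]

end Dilate

/-! ### Counting lattice points near the boundary -/

lemma card_le_of_injOn {S : Finset (Fin n → ℤ)} {φ : (Fin n → ℤ) → Fin n → ℤ}
    (hφ : Set.InjOn φ S) (I : Finset (Fin n)) (L M : ℕ)
    (hL : ∀ m ∈ S, ∀ i ∈ I, |φ m i| ≤ L) (hM : ∀ m ∈ S, ∀ i ∉ I, |φ m i| ≤ M) :
    S.card ≤ (2 * L + 1) ^ I.card * (2 * M + 1) ^ (n - I.card) := by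
  have h1 : S.card ≤ (Fintype.piFinset fun i => if i ∈ I then Finset.Icc (-(L : ℤ)) L else
      Finset.Icc (-(M : ℤ)) M).card := by
    refine Finset.card_le_card_of_injOn φ (fun m hm => ?_) hφ
    rw [Finset.mem_coe, Fintype.mem_piFinset]
    intro i
    split_ifs with h
    · exact Finset.mem_Icc.mpr (abs_le.mp (hL m hm i h))
    · exact Finset.mem_Icc.mpr (abs_le.mp (hM m hm i h))
  refine h1.trans (le_of_eq ?_)
  have h2 : ∀ T : ℕ, (Finset.Icc (-(T : ℤ)) T).card = 2 * T + 1 := by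
    intro T
    rw [Int.card_Icc]
    omega
  rw [Fintype.card_piFinset]
  simp only [apply_ite Finset.card, h2]
  rw [Finset.prod_ite, Finset.prod_const, Finset.prod_const, Finset.filter_univ_mem,
    Finset.filter_not, Finset.filter_univ_mem, ← Finset.compl_eq_univ_sdiff, Finset.card_compl,
    Fintype.card_fin]

/-- As `v i₀ ≠ 0`, the height `⟨v, m⟩ + k` may replace the coordinate `i₀`: a lattice point is still
determined, and one coordinate now has range `L` instead of `M`. -/
lemma card_slab_le {S : Finset (Fin n → ℤ)} {v : Fin n → ℤ} {i₀ : Fin n} (hv : v i₀ ≠ 0)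
    (k L M : ℕ) (hL : ∀ m ∈ S, |v ⬝ᵥ m + k| ≤ L) (hM : ∀ m ∈ S, ∀ i, |m i| ≤ M) :
    S.card ≤ (2 * L + 1) * (2 * M + 1) ^ (n - 1) := by
  have := card_le_of_injOn (S := S) (φ := fun m i => if i = i₀ then v ⬝ᵥ m + k else m i) ?_
    {i₀} L M (fun m hm i hi => ?_) (fun m hm i hi => ?_)
  · simpa using this
  · intro m _ m' _ h
    have h1 : ∀ i, i ≠ i₀ → m i = m' i := fun i hi => by simpa [hi] using congrFun h i
    have h2 : v ⬝ᵥ (m - m') = 0 := by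
      have := congrFun h i₀
      simp only [if_true] at this
      rw [dotProduct_sub]
      linarith
    have h3 : v ⬝ᵥ (m - m') = v i₀ * (m - m') i₀ :=
      Fintype.sum_eq_single i₀ fun i hi => by simp [h1 i hi]
    funext i
    by_cases hi : i = i₀
    · rw [h3, mul_eq_zero] at h2
      rw [hi]
      exact sub_eq_zero.mp (h2.resolve_left hv)
    · exact h1 i hi
  · rw [Finset.mem_singleton.mp hi]
    simpa using hL m hm
  · have : i ≠ i₀ := by simpa using hi
    simpa [this] using hM m hm i

/-- Two heights replace two coordinates. By Cramer's rule the nonzero minor keeps the lattice point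
determined. -/
lemma card_two_slabs_le {S : Finset (Fin n → ℤ)} {v v' : Fin n → ℤ} {i₀ j₀ : Fin n}
    (hv : v i₀ * v' j₀ - v j₀ * v' i₀ ≠ 0) (k L M : ℕ) (hL : ∀ m ∈ S, |v ⬝ᵥ m + k| ≤ L)
    (hL' : ∀ m ∈ S, |v' ⬝ᵥ m + k| ≤ L) (hM : ∀ m ∈ S, ∀ i, |m i| ≤ M) :
    S.card ≤ (2 * L + 1) ^ 2 * (2 * M + 1) ^ (n - 2) := by
  have hij : i₀ ≠ j₀ := by
    rintro rfl
    exact hv (by ring)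
  have := card_le_of_injOn (S := S)
    (φ := fun m i => if i = i₀ then v ⬝ᵥ m + k else if i = j₀ then v' ⬝ᵥ m + k else m i) ?_
    {i₀, j₀} L M (fun m hm i hi => ?_) (fun m hm i hi => ?_)
  · rwa [Finset.card_pair hij] at this
  · intro m _ m' _ h
    have h1 : ∀ i, i ≠ i₀ ∧ i ≠ j₀ → m i = m' i := fun i hi => by
      simpa [hi.1, hi.2] using congrFun h i
    have h2 : v ⬝ᵥ (m - m') = 0 := by
      have := congrFun h i₀
      simp only [if_true] at this
      rw [dotProduct_sub]
      linarith
    have h2' : v' ⬝ᵥ (m - m') = 0 := by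
      have := congrFun h j₀
      simp only [if_true, if_neg hij.symm] at this
      rw [dotProduct_sub]
      linarith
    have h3 : ∀ w : Fin n → ℤ, w ⬝ᵥ (m - m') = w i₀ * (m - m') i₀ + w j₀ * (m - m') j₀ :=
      fun w => Fintype.sum_eq_add i₀ j₀ hij fun i hi => by simp [h1 i hi]
    rw [h3] at h2 h2'
    have h4 : (m - m') i₀ = 0 := by
      have : (v i₀ * v' j₀ - v j₀ * v' i₀) * (m - m') i₀ = 0 := by
        linear_combination v' j₀ * h2 - v j₀ * h2'
      exact (mul_eq_zero.mp this).resolve_left hv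
    have h5 : (m - m') j₀ = 0 := by
      have : (v i₀ * v' j₀ - v j₀ * v' i₀) * (m - m') j₀ = 0 := by
        linear_combination v i₀ * h2' - v' i₀ * h2
      exact (mul_eq_zero.mp this).resolve_left hv
    funext i
    by_cases hi : i = i₀
    · rw [hi]
      exact sub_eq_zero.mp h4
    · by_cases hj : i = j₀
      · rw [hj]
        exact sub_eq_zero.mp h5
      · exact h1 i ⟨hi, hj⟩
  · rcases Finset.mem_insert.mp hi with rfl | hi
    · simpa using hL m hm
    · rw [Finset.mem_singleton.mp hi]
      simpa [hij.symm] using hL' m hm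
  · have : i ≠ i₀ ∧ i ≠ j₀ := by simpa using hi
    simpa [this.1, this.2] using hM m hm i

/-- Two distinct vertices are opposite or linearly independent. -/
lemma IsFanoPolytope.eq_neg_or_exists_minor (hV : IsFanoPolytope V) {v v' : Fin n → ℤ}
    (hv : v ∈ V) (hv' : v' ∈ V) (hne : v ≠ v') :
    v' = -v ∨ ∃ i j, v i * v' j - v j * v' i ≠ 0 := by
  by_contra! hcon
  obtain ⟨hneg, hminor⟩ := hcon
  obtain ⟨u, hu⟩ := hV.exists_dotProduct_eq_one hv
  have h1 : v' = (v' ⬝ᵥ u) • v := by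
    funext i
    have h2 : ∑ j, u j * (v i * v' j - v j * v' i) = 0 :=
      Finset.sum_eq_zero fun j _ => by rw [hminor, mul_zero]
    have h3 : ∑ j, u j * (v i * v' j - v j * v' i) = v i * (v' ⬝ᵥ u) - (v ⬝ᵥ u) * v' i := by
      rw [dotProduct, dotProduct, Finset.mul_sum, Finset.sum_mul, ← Finset.sum_sub_distrib]
      exact Finset.sum_congr rfl fun j _ => by ring
    rw [h2, hu] at h3
    rw [Pi.smul_apply, smul_eq_mul]
    linarith
  rcases Int.isUnit_iff.mp (hV.primitive v' hv' _ _ h1) with h | h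
  · rw [h, one_smul] at h1
    exact hne h1.symm
  · rw [h, neg_one_smul] at h1
    exact hneg h1

lemma IsFanoPolytope.exists_bound_latticeFinset (hV : IsFanoPolytope V) :
    ∃ B : ℕ, ∀ k, ∀ m ∈ latticeFinset hV k, ∀ i, |m i| ≤ (B * k : ℕ) := by
  obtain ⟨R, hR, hb⟩ := hV.exists_bound
  refine ⟨⌈R⌉₊, fun k m hm i => ?_⟩
  rw [mem_latticeFinset] at hm
  have h1 := hb k (toReal m) (fun v hv => by
    rw [toReal_dotProduct]
    exact_mod_cast hm v hv) i
  have h2 : ((|m i| : ℤ) : ℝ) ≤ ((⌈R⌉₊ * k : ℕ) : ℝ) := by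
    rw [Int.cast_abs]
    refine h1.trans ?_
    push_cast
    exact mul_le_mul_of_nonneg_right (Nat.le_ceil R) (Nat.cast_nonneg k)
  exact_mod_cast h2

/-- Lattice points at bounded distance from a facet. -/
lemma IsFanoPolytope.exists_card_slab_le (hV : IsFanoPolytope V) {v : Fin n → ℤ} (hv : v ∈ V)
    (R L : ℕ) : ∃ C : ℕ, ∀ k, ∀ S ⊆ latticeFinset hV (k + R), (∀ m ∈ S, v ⬝ᵥ m + k ≤ L) →
      S.card ≤ C * (k + 1) ^ (n - 1) := by
  obtain ⟨B, hB⟩ := hV.exists_bound_latticeFinset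
  obtain ⟨i₀, hi₀⟩ : ∃ i, v i ≠ 0 := by
    by_contra! h
    exact hV.ne_zero hv (funext h)
  refine ⟨(2 * (R + L) + 1) * (2 * (B * (R + 1)) + 1) ^ (n - 1), fun k S hS hL => ?_⟩
  refine (card_slab_le hi₀ k (R + L) (B * (k + R)) (fun m hm => ?_)
    fun m hm => hB _ m (hS hm)).trans ?_
  · have h1 := (mem_latticeFinset hV).mp (hS hm) v hv
    have h2 := hL m hm
    rw [abs_le]
    push_cast at h1 ⊢
    constructor <;> linarith
  · rw [mul_assoc, ← mul_pow]
    gcongr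
    nlinarith [Nat.zero_le (B * R * k), Nat.zero_le k, Nat.zero_le (B * k * R)]

/-- Lattice points at bounded distance from two facets. -/
lemma IsFanoPolytope.exists_card_two_slabs_le (hV : IsFanoPolytope V) {v v' : Fin n → ℤ}
    (hv : v ∈ V) (hv' : v' ∈ V) (hne : v ≠ v') (R L : ℕ) : ∃ C : ℕ, ∀ k,
      ∀ S ⊆ latticeFinset hV (k + R), (∀ m ∈ S, v ⬝ᵥ m + k ≤ L ∧ v' ⬝ᵥ m + k ≤ L) →
      S.card * (k + 1) ≤ C * (k + 1) ^ (n - 1) := by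
  obtain ⟨B, hB⟩ := hV.exists_bound_latticeFinset
  rcases hV.eq_neg_or_exists_minor hv hv' hne with rfl | ⟨i₀, j₀, hij⟩
  -- The heights over two opposite facets add up to `2 k`, so both can be at most `L` only for `k ≤
  -- L`. These finitely many cases are absorbed into the constant.
  · refine ⟨∑ k ∈ Finset.range (L + 1), (latticeFinset hV (k + R)).card * (k + 1),
      fun k S hS hL => ?_⟩
    by_cases hk : k < L + 1
    · have h1 := Finset.single_le_sum
        (f := fun k => (latticeFinset hV (k + R)).card * (k + 1)) (fun _ _ => Nat.zero_le _)
        (Finset.mem_range.mpr hk)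
      refine le_trans (Nat.mul_le_mul_right _ (Finset.card_le_card hS)) (h1.trans ?_)
      exact Nat.le_mul_of_pos_right _ (by positivity)
    · have : S = ∅ := by
        rw [Finset.eq_empty_iff_forall_notMem]
        intro m hm
        obtain ⟨h1, h2⟩ := hL m hm
        rw [neg_dotProduct] at h2
        omega
      rw [this, Finset.card_empty, zero_mul]
      exact Nat.zero_le _
  -- A nonzero minor needs two distinct indices, so `n - 2` is a true difference. The factor `k + 1`
  -- on the left of the estimate covers the case `n = 1` without a negative exponent.
  · have hn : 2 ≤ n := by
      have hne' : i₀ ≠ j₀ := by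
        rintro rfl
        exact hij (by ring)
      have h1 := i₀.2
      have h2 := j₀.2
      have h3 : i₀.1 ≠ j₀.1 := fun h => hne' (Fin.ext h)
      omega
    refine ⟨(2 * (R + L) + 1) ^ 2 * (2 * (B * (R + 1)) + 1) ^ (n - 2), fun k S hS hL => ?_⟩
    have key : ∀ w ∈ V, ∀ m ∈ S, w ⬝ᵥ m + k ≤ L → |w ⬝ᵥ m + k| ≤ (R + L : ℕ) := by
      intro w hw m hm h
      have h1 := (mem_latticeFinset hV).mp (hS hm) w hw
      rw [abs_le]
      push_cast at h1 ⊢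
      constructor <;> linarith
    have h1 := card_two_slabs_le hij k (R + L) (B * (k + R))
      (fun m hm => key v hv m hm (hL m hm).1) (fun m hm => key v' hv' m hm (hL m hm).2)
      fun m hm => hB _ m (hS hm)
    have h2 : (k + 1) ^ (n - 1) = (k + 1) ^ (n - 2) * (k + 1) := by
      rw [← pow_succ]
      congr 1
      omega
    rw [h2, ← mul_assoc, mul_assoc ((2 * (R + L) + 1) ^ 2), ← mul_pow]
    refine Nat.mul_le_mul_right _ (h1.trans ?_)
    gcongr
    nlinarith [Nat.zero_le (B * R * k), Nat.zero_le k, Nat.zero_le (B * k * R)]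

/-! ### Comparison of sums over lattice points with integrals -/

section Comparison

open MeasureTheory

/-- The half space of the cube that is cut out by a facet near a lattice point. -/
def halfSpace (v : Fin n → ℤ) (s : ℤ) : Set (Fin n → ℝ) :=
  {c | 0 ≤ (s : ℝ) + 1 / 2 + toReal v ⬝ᵥ c}

lemma measurableSet_halfSpace (v : Fin n → ℤ) (s : ℤ) : MeasurableSet (halfSpace v s) :=
  (isClosed_le continuous_const
    (continuous_const.add (continuous_dotProduct_right _))).measurableSet

lemma integrableOn_indicator_affine {H : Set (Fin n → ℝ)} (hH : MeasurableSet H) (y : ℝ)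
    (a : Fin n → ℝ) : IntegrableOn (H.indicator fun c => y + a ⬝ᵥ c) (centredCube n) :=
  IntegrableOn.indicator (ContinuousOn.integrableOn_compact isCompact_centredCube
    (continuous_const.add (continuous_dotProduct_right a)).continuousOn) hH

lemma integral_affine_centredCube (y : ℝ) (a : Fin n → ℝ) :
    ∫ c in centredCube n, (y + a ⬝ᵥ c) = y := by
  have h1 : IntegrableOn (fun c => a ⬝ᵥ c) (centredCube n) :=
    ContinuousOn.integrableOn_compact isCompact_centredCube
      (continuous_dotProduct_right a).continuousOn
  have h2 : ∫ c in centredCube n, a ⬝ᵥ c = 0 := by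
    have := integral_centredCube_neg fun c : Fin n → ℝ => a ⬝ᵥ c
    simp only [dotProduct_neg, integral_neg] at this
    linarith
  rw [integral_add _ h1, h2, setIntegral_const, volume_real_centredCube, one_smul, add_zero]
  exact integrableOn_const (by rw [volume_centredCube]; exact ENNReal.one_ne_top)

/-- The reflection `c ↦ -c` of the cube exchanges the half space of height `-1 - s` with the
complement of that of height `s`, up to a hyperplane of measure zero. -/
lemma integral_halfSpace_reflect {v : Fin n → ℤ} (hv : v ≠ 0) (s : ℤ) (y : ℝ) (a : Fin n → ℝ) :
    ∫ c in centredCube n, (halfSpace v (-1 - s)).indicator (fun c => y + a ⬝ᵥ c) c =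
      ∫ c in centredCube n, (halfSpace v s)ᶜ.indicator (fun c => y + -a ⬝ᵥ c) c := by
  rw [← integral_centredCube_neg]
  refine integral_congr_ae (ae_restrict_of_ae ?_)
  have hv' : toReal v ≠ 0 := fun h => hv (funext fun i => Int.cast_eq_zero.mp (congrFun h i))
  have h0 := volume_hyperplane hv' (-((s : ℝ) + 1 / 2))
  rw [measure_eq_zero_iff_ae_notMem] at h0
  filter_upwards [h0] with c hc
  have hc' : toReal v ⬝ᵥ c ≠ -((s : ℝ) + 1 / 2) := hc
  have h1 : -c ∈ halfSpace v (-1 - s) ↔ c ∈ (halfSpace v s)ᶜ := by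
    simp only [halfSpace, Set.mem_ofPred_eq, Set.mem_compl_iff, not_le, dotProduct_neg]
    push_cast
    constructor
    · intro h
      refine lt_of_le_of_ne (by linarith) fun h => hc' (by linarith)
    · intro h
      linarith
  by_cases h : c ∈ (halfSpace v s)ᶜ
  · rw [Set.indicator_of_mem (h1.mpr h), Set.indicator_of_mem h, dotProduct_neg, neg_dotProduct]
  · rw [Set.indicator_of_notMem (h1.not.mpr h), Set.indicator_of_notMem h]

/-- The errors at two lattice points that are reflected in a facet cancel. -/
lemma abs_add_reflect_le {v : Fin n → ℤ} (hv : v ≠ 0) (s : ℤ) (y y' : ℝ) (a : Fin n → ℝ) :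
    |((if 0 ≤ s then y else 0) -
        ∫ c in centredCube n, (halfSpace v s).indicator (fun c => y + a ⬝ᵥ c) c) +
      ((if 0 ≤ -1 - s then y' else 0) -
        ∫ c in centredCube n, (halfSpace v (-1 - s)).indicator (fun c => y' + a ⬝ᵥ c) c)| ≤
      |y - y'| + ∑ i, |a i| := by
  have hA : 0 ≤ ∑ i, |a i| := Finset.sum_nonneg fun _ _ => abs_nonneg _
  have hH := measurableSet_halfSpace v s
  have hi1 := integrableOn_indicator_affine hH y a
  have hi2 := integrableOn_indicator_affine hH.compl y' (-a)
  rw [integral_halfSpace_reflect hv]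
  -- Exactly one of `s` and `-1 - s` is non-negative, so the two lattice points contribute a single
  -- value `z`. The two half spaces together cover the cube once, so only variations of the affine
  -- function remain.
  set z : ℝ := if 0 ≤ s then y else y' with hz
  have h1 : (if 0 ≤ s then y else 0) + (if 0 ≤ -1 - s then y' else 0) = z := by
    rw [hz]
    split_ifs <;> first | omega | simp
  have h2 : ∫ c in centredCube n, z = z := by
    rw [setIntegral_const, volume_real_centredCube, one_smul]
  have h3 : ((if 0 ≤ s then y else 0) -
        ∫ c in centredCube n, (halfSpace v s).indicator (fun c => y + a ⬝ᵥ c) c) +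
      ((if 0 ≤ -1 - s then y' else 0) -
        ∫ c in centredCube n, (halfSpace v s)ᶜ.indicator (fun c => y' + -a ⬝ᵥ c) c) =
      ∫ c in centredCube n, (z - ((halfSpace v s).indicator (fun c => y + a ⬝ᵥ c) c +
        (halfSpace v s)ᶜ.indicator (fun c => y' + -a ⬝ᵥ c) c)) := by
    have h4 : IntegrableOn (fun _ => z) (centredCube n) :=
      integrableOn_const (by rw [volume_centredCube]; exact ENNReal.one_ne_top)
    refine Eq.trans ?_ ((integral_sub h4 (hi1.add hi2)).trans
      (congrArg₂ (· - ·) h2 (integral_add hi1 hi2))).symm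
    rw [← h1]
    ring
  rw [h3, ← Real.norm_eq_abs]
  refine (norm_setIntegral_le_of_norm_le_const (C := |y - y'| + ∑ i, |a i|)
    (by rw [volume_centredCube]; exact ENNReal.one_lt_top) fun c hc => ?_).trans ?_
  · have h4 := abs_dotProduct_le_of_mem_centredCube a hc
    have h5 : |z - y| ≤ |y - y'| ∧ |z - y'| ≤ |y - y'| := by
      rw [hz]
      split_ifs
      · simp
      · simp [abs_sub_comm]
    rw [Real.norm_eq_abs]
    by_cases h : c ∈ halfSpace v s
    · rw [Set.indicator_of_mem h, Set.indicator_of_notMem (by simpa using h), add_zero,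
        ← sub_sub]
      refine (abs_sub _ _).trans ?_
      linarith [h5.1]
    · rw [Set.indicator_of_notMem h, Set.indicator_of_mem (by simpa using h), zero_add,
        neg_dotProduct, ← sub_eq_add_neg, ← sub_add]
      refine (abs_add_le _ _).trans ?_
      linarith [h5.2]
  · rw [volume_real_centredCube, mul_one]

/-- The difference between the contribution of a lattice point to a sum and that of its unit cube
to an integral. -/
def latticeError (V : Finset (Fin n → ℤ)) (k : ℕ) (c₀ : ℝ) (a : Fin n → ℝ) (m : Fin n → ℤ) : ℝ :=
  (latticePoints V k).indicator (fun m => c₀ + a ⬝ᵥ toReal m) m -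
    ∫ c in centredCube n, (dilate V (k + 1 / 2)).indicator (fun p => c₀ + a ⬝ᵥ p) (toReal m + c)

/-- An upper bound for the widths of the unit cube. -/
def widthBound (V : Finset (Fin n → ℤ)) : ℕ := ∑ v ∈ V, ∑ i, (v i).natAbs

lemma abs_toReal_dotProduct_le {v : Fin n → ℤ} (hv : v ∈ V) {c : Fin n → ℝ}
    (hc : c ∈ centredCube n) : |toReal v ⬝ᵥ c| ≤ widthBound V / 2 := by
  refine (abs_dotProduct_le_of_mem_centredCube _ hc).trans ?_
  have h1 := Finset.single_le_sum (f := fun v : Fin n → ℤ => ∑ i, (v i).natAbs)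
    (fun _ _ => Nat.zero_le _) hv
  have h2 : ∑ i, |toReal v i| = ((∑ i, (v i).natAbs : ℕ) : ℝ) := by
    push_cast
    exact Finset.sum_congr rfl fun i _ => by rw [Nat.cast_natAbs, Int.cast_abs]
  rw [h2]
  have h3 : ((∑ i, (v i).natAbs : ℕ) : ℝ) ≤ widthBound V := by exact_mod_cast h1
  linarith

lemma toReal_dotProduct_add_ge_iff {k : ℕ} (v m : Fin n → ℤ) (c : Fin n → ℝ) :
    -((k : ℝ) + 1 / 2) ≤ toReal v ⬝ᵥ (toReal m + c) ↔
      0 ≤ ((v ⬝ᵥ m + k : ℤ) : ℝ) + 1 / 2 + toReal v ⬝ᵥ c := by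
  rw [dotProduct_add, toReal_dotProduct]
  push_cast
  constructor <;> intro h <;> linarith

lemma nonneg_of_widthBound_lt {v : Fin n → ℤ} (hv : v ∈ V) {c : Fin n → ℝ}
    (hc : c ∈ centredCube n) {s : ℤ} (hs : (widthBound V : ℤ) < s) :
    0 ≤ (s : ℝ) + 1 / 2 + toReal v ⬝ᵥ c := by
  have h1 := (abs_le.mp (abs_toReal_dotProduct_le hv hc)).1
  have h2 : (widthBound V : ℝ) < s := by exact_mod_cast hs
  have h3 : (0 : ℝ) ≤ widthBound V := Nat.cast_nonneg _
  linarith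

open Classical in
/-- Near a single facet the error depends on the distance from the facet only. -/
lemma latticeError_eq {k : ℕ} {m v : Fin n → ℤ} (hv : v ∈ V)
    (h : ∀ v' ∈ V, v' ≠ v → (widthBound V : ℤ) < v' ⬝ᵥ m + k) (c₀ : ℝ) (a : Fin n → ℝ) :
    latticeError V k c₀ a m = (if 0 ≤ v ⬝ᵥ m + k then c₀ + a ⬝ᵥ toReal m else 0) -
      ∫ c in centredCube n, (halfSpace v (v ⬝ᵥ m + k)).indicator
        (fun c => (c₀ + a ⬝ᵥ toReal m) + a ⬝ᵥ c) c := by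
  rw [latticeError]
  congr 1
  · rw [Set.indicator_apply]
    refine if_congr ?_ rfl rfl
    rw [mem_latticePoints]
    constructor
    · intro h'
      have := h' v hv
      omega
    · intro h' v' hv'
      by_cases hne : v' = v
      · rw [hne]
        omega
      · have := h v' hv' hne
        omega
  · refine setIntegral_congr_fun isCompact_centredCube.measurableSet fun c hc => ?_
    have h1 : toReal m + c ∈ dilate V (k + 1 / 2) ↔ c ∈ halfSpace v (v ⬝ᵥ m + k) := by
      rw [mem_dilate]
      simp only [toReal_dotProduct_add_ge_iff]
      constructor
      · intro h'
        exact h' v hv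
      · intro h' v' hv'
        by_cases hne : v' = v
        · rw [hne]
          exact h'
        · exact nonneg_of_widthBound_lt hv' hc (h v' hv' hne)
    rw [Set.indicator_apply, Set.indicator_apply, dotProduct_add, add_assoc]
    exact if_congr h1 rfl rfl

/-- Far from all facets the whole cube lies in the dilate, and the mean of an affine function over a
centred cube is its value at the centre. -/
lemma latticeError_eq_zero {k : ℕ} {m : Fin n → ℤ}
    (h : ∀ v ∈ V, (widthBound V : ℤ) < v ⬝ᵥ m + k) (c₀ : ℝ) (a : Fin n → ℝ) :
    latticeError V k c₀ a m = 0 := by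
  rw [latticeError, Set.indicator_of_mem, sub_eq_zero]
  · refine Eq.trans (integral_affine_centredCube (c₀ + a ⬝ᵥ toReal m) a).symm ?_
    refine setIntegral_congr_fun isCompact_centredCube.measurableSet fun c hc => ?_
    rw [Set.indicator_of_mem, dotProduct_add, add_assoc]
    rw [mem_dilate]
    intro v hv
    rw [toReal_dotProduct_add_ge_iff]
    exact nonneg_of_widthBound_lt hv hc (h v hv)
  · rw [mem_latticePoints]
    intro v hv
    have := h v hv
    omega

open Classical in
lemma abs_latticeError_le (k : ℕ) (m : Fin n → ℤ) (c₀ : ℝ) (a : Fin n → ℝ) {M : ℝ}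
    (hM : ∀ i, |(m i : ℝ)| ≤ M) :
    |latticeError V k c₀ a m| ≤ 2 * (|c₀| + (∑ i, |a i|) * (M + 1)) := by
  have hA : 0 ≤ ∑ i, |a i| := Finset.sum_nonneg fun _ _ => abs_nonneg _
  have h1 : |c₀ + a ⬝ᵥ toReal m| ≤ |c₀| + (∑ i, |a i|) * M := by
    refine (abs_add_le _ _).trans (add_le_add_right ?_ _)
    rw [dotProduct, Finset.sum_mul]
    refine (Finset.abs_sum_le_sum_abs _ _).trans (Finset.sum_le_sum fun i _ => ?_)
    rw [abs_mul]
    exact mul_le_mul_of_nonneg_left (hM i) (abs_nonneg _)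
  have h0 : 0 ≤ |c₀| + (∑ i, |a i|) * M := (abs_nonneg _).trans h1
  have h2 : |∫ c in centredCube n, (dilate V (k + 1 / 2)).indicator
      (fun p => c₀ + a ⬝ᵥ p) (toReal m + c)| ≤ |c₀| + (∑ i, |a i|) * M + ∑ i, |a i| := by
    rw [← Real.norm_eq_abs]
    refine (norm_setIntegral_le_of_norm_le_const (C := |c₀| + (∑ i, |a i|) * M + ∑ i, |a i|)
      (by rw [volume_centredCube]; exact ENNReal.one_lt_top) fun c hc => ?_).trans
      (by rw [volume_real_centredCube, mul_one])
    rw [Real.norm_eq_abs, Set.indicator_apply]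
    split_ifs
    · rw [dotProduct_add, ← add_assoc]
      refine (abs_add_le _ _).trans ?_
      linarith [abs_dotProduct_le_of_mem_centredCube a hc]
    · rw [abs_zero]
      linarith
  have h3 : |(latticePoints V k).indicator (fun m => c₀ + a ⬝ᵥ toReal m) m| ≤
      |c₀| + (∑ i, |a i|) * M := by
    rw [Set.indicator_apply]
    split_ifs
    · exact h1
    · rwa [abs_zero]
  rw [latticeError]
  refine (abs_sub _ _).trans ?_
  nlinarith [abs_nonneg c₀]

/-- Enlarging by `widthBound V + 1` captures every lattice point whose cube meets the dilate by `k +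
1/2`: half a cube has width at most `widthBound V / 2` in the direction of a vertex. -/
lemma sum_latticeError (hV : IsFanoPolytope V) (k : ℕ) (c₀ : ℝ) (a : Fin n → ℝ) :
    ∑ m ∈ latticeFinset hV k, (c₀ + a ⬝ᵥ toReal m) -
      ∫ p in dilate V (k + 1 / 2), (c₀ + a ⬝ᵥ p) =
      ∑ m ∈ latticeFinset hV (k + (widthBound V + 1)), latticeError V k c₀ a m := by
  classical
  simp only [latticeError, Finset.sum_sub_distrib]
  congr 1
  · have h1 : latticeFinset hV k ⊆ latticeFinset hV (k + (widthBound V + 1)) := by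
      intro m hm
      rw [mem_latticeFinset] at hm ⊢
      intro v hv
      have := hm v hv
      push_cast
      omega
    rw [← Finset.sum_subset h1]
    · refine Finset.sum_congr rfl fun m hm => ?_
      rw [Set.indicator_of_mem]
      exact (mem_latticeFinset hV).mp hm
    · intro m _ hm
      exact Set.indicator_of_notMem (s := latticePoints V k)
        (fun h => hm ((mem_latticeFinset hV).mpr h)) _
  · refine setIntegral_eq_sum_centredCube (isClosed_dilate V _).measurableSet
      (ContinuousOn.integrableOn_compact (hV.isCompact_dilate _)
        (continuous_const.add (continuous_dotProduct_right a)).continuousOn) _ ?_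
    intro m c hc hmem
    rw [mem_latticeFinset]
    intro v hv
    have h1 := (toReal_dotProduct_add_ge_iff v m c).mp (hmem v hv)
    have h2 := (abs_le.mp (abs_toReal_dotProduct_le hv hc)).2
    have h3 : (0 : ℝ) ≤ widthBound V := Nat.cast_nonneg _
    have h4 : (-((k + (widthBound V + 1) : ℕ) : ℤ) : ℝ) ≤ ((v ⬝ᵥ m : ℤ) : ℝ) := by
      push_cast at h1 ⊢
      linarith
    exact_mod_cast h4

end Comparison

open Classical in
/-- The sum of an affine function over the lattice points of `k P` is the integral over
`(k + 1/2) P`, up to two orders of magnitude less. -/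
lemma IsFanoPolytope.exists_abs_sum_sub_integral_le (hV : IsFanoPolytope V) :
    ∃ C : ℝ, ∀ (k : ℕ) (c₀ : ℝ) (a : Fin n → ℝ),
      |∑ m ∈ latticeFinset hV k, (c₀ + a ⬝ᵥ toReal m) -
        ∫ p in dilate V (k + 1 / 2), (c₀ + a ⬝ᵥ p)| * (k + 1) ≤
      C * (|c₀| + (∑ i, |a i|) * (k + 1)) * (k + 1) ^ (n - 1) := by
  have hu : ∀ v, ∃ u, v ∈ V → v ⬝ᵥ u = 1 := fun v => by
    by_cases hv : v ∈ V
    · obtain ⟨u, hu⟩ := hV.exists_dotProduct_eq_one hv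
      exact ⟨u, fun _ => hu⟩
    · exact ⟨0, fun h => absurd h hv⟩
  choose u hu using hu
  set W := widthBound V with hW
  let U : ℕ := ∑ v ∈ V, ∑ i, (u v i).natAbs
  let A' : ℕ := ∑ v ∈ V, ∑ v' ∈ V, (v' ⬝ᵥ u v).natAbs
  -- Reflecting a lattice point in a nearby facet moves its height over another facet by at most `(2
  -- W + 1) A'`.
  let L : ℕ := W + (2 * W + 1) * A'
  have hCs : ∀ v, ∃ C : ℕ, v ∈ V → ∀ k, ∀ S ⊆ latticeFinset hV (k + (W + 1)),
      (∀ m ∈ S, v ⬝ᵥ m + k ≤ W) → S.card ≤ C * (k + 1) ^ (n - 1) := fun v => by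
    by_cases hv : v ∈ V
    · obtain ⟨C, hC⟩ := hV.exists_card_slab_le hv (W + 1) W
      exact ⟨C, fun _ => hC⟩
    · exact ⟨0, fun h => absurd h hv⟩
  choose Cs hCs using hCs
  have hCb : ∀ q : (Fin n → ℤ) × (Fin n → ℤ), ∃ C : ℕ, q ∈ V.offDiag → ∀ k,
      ∀ S ⊆ latticeFinset hV (k + (W + 1)), (∀ m ∈ S, q.1 ⬝ᵥ m + k ≤ L ∧ q.2 ⬝ᵥ m + k ≤ L) →
        S.card * (k + 1) ≤ C * (k + 1) ^ (n - 1) := fun q => by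
    by_cases hq : q ∈ V.offDiag
    · obtain ⟨h1, h2, h3⟩ := Finset.mem_offDiag.mp hq
      obtain ⟨C, hC⟩ := hV.exists_card_two_slabs_le h1 h2 h3 (W + 1) L
      exact ⟨C, fun _ => hC⟩
    · exact ⟨0, fun h => absurd h hq⟩
  choose Cb hCb using hCb
  obtain ⟨B, hB⟩ := hV.exists_bound_latticeFinset
  -- `c₁` bounds the error of a reflected pair in units of `∑ |a i|`; `c₂` is the crude bound for a
  -- single lattice point.
  let c₁ : ℝ := (2 * W + 1) * U + 1
  let c₂ : ℝ := 2 * (B * (W + 1) + 1)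
  refine ⟨(∑ v ∈ V, (Cs v : ℝ)) * c₁ + (∑ q ∈ V.offDiag, (Cb q : ℝ)) * c₂, fun k c₀ a => ?_⟩
  set A : ℝ := ∑ i, |a i| with hA
  have hA0 : 0 ≤ A := Finset.sum_nonneg fun _ _ => abs_nonneg _
  have hk0 : (0 : ℝ) ≤ k := Nat.cast_nonneg k
  rw [sum_latticeError hV]
  set F := latticeFinset hV (k + (widthBound V + 1)) with hF
  set D := latticeError V k c₀ a with hD
  -- As `⟨v, u v⟩ = 1`, this lattice involution sends the height `s` over the facet of `v` to `-1 -
  -- s`. It reflects in the level `-1/2`, which is the boundary of the dilate by `k + 1/2`.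
  let σ : (Fin n → ℤ) → (Fin n → ℤ) → (Fin n → ℤ) := fun v m =>
    m - (2 * (v ⬝ᵥ m + k) + 1) • u v
  -- Good lattice points are close to the facet of `v` only, and so are their reflections. There are
  -- `O(k^(n-1))` of them, with bounded error per pair for fixed `a`. Bad points are close to two
  -- facets and are fewer by a factor `k`.
  let Good : (Fin n → ℤ) → Finset (Fin n → ℤ) := fun v => F.filter fun m => v ⬝ᵥ m + k ≤ W ∧
    ∀ v' ∈ V, v' ≠ v → (W : ℤ) < v' ⬝ᵥ m + k ∧ (W : ℤ) < v' ⬝ᵥ σ v m + k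
  let Bad : (Fin n → ℤ) × (Fin n → ℤ) → Finset (Fin n → ℤ) := fun q =>
    F.filter fun m => q.1 ⬝ᵥ m + k ≤ L ∧ q.2 ⬝ᵥ m + k ≤ L
  have hFge : ∀ m ∈ F, ∀ v ∈ V, -(W : ℤ) - 1 ≤ v ⬝ᵥ m + k := by
    intro m hm v hv
    have := (mem_latticeFinset hV).mp hm v hv
    push_cast at this
    omega
  have hσ : ∀ v m v', v' ⬝ᵥ σ v m = v' ⬝ᵥ m - (2 * (v ⬝ᵥ m + k) + 1) * (v' ⬝ᵥ u v) := by
    intro v m v'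
    rw [dotProduct_sub, dotProduct_smul, smul_eq_mul]
  have hσs : ∀ v ∈ V, ∀ m, v ⬝ᵥ σ v m + k = -1 - (v ⬝ᵥ m + k) := by
    intro v hv m
    rw [hσ, hu v hv]
    ring
  have hσσ : ∀ v ∈ V, ∀ m, σ v (σ v m) = m := by
    intro v hv m
    change σ v m - (2 * (v ⬝ᵥ σ v m + k) + 1) • u v = m
    rw [hσs v hv]
    change m - (2 * (v ⬝ᵥ m + k) + 1) • u v - _ • u v = m
    rw [sub_sub, ← add_smul]
    ring_nf
  have hσGood : ∀ v ∈ V, ∀ m ∈ Good v, σ v m ∈ Good v := by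
    intro v hv m hm
    obtain ⟨hmF, h1, h2⟩ := Finset.mem_filter.mp hm
    have h3 := hFge m hmF v hv
    have h4 := hσs v hv m
    refine Finset.mem_filter.mpr ⟨?_, ?_, fun v' hv' hne => ⟨(h2 v' hv' hne).2, ?_⟩⟩
    · rw [mem_latticeFinset]
      intro v' hv'
      push_cast
      by_cases hne : v' = v
      · rw [hne]
        omega
      · have := (h2 v' hv' hne).2
        omega
    · omega
    · rw [hσσ v hv]
      exact (h2 v' hv' hne).1
  have hGoodSum : ∀ v ∈ V, |∑ m ∈ Good v, D m| ≤ Cs v * (k + 1) ^ (n - 1) * (c₁ * A) := by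
    intro v hv
    have hpair : ∀ m ∈ Good v, |D m + D (σ v m)| ≤ c₁ * A := by
      intro m hm
      have hm' := hσGood v hv m hm
      obtain ⟨hmF, h1, h2⟩ := Finset.mem_filter.mp hm
      obtain ⟨-, -, h2'⟩ := Finset.mem_filter.mp hm'
      have h3 := hFge m hmF v hv
      rw [hD, latticeError_eq hv (fun v' hv' hne => (h2 v' hv' hne).1),
        latticeError_eq hv (fun v' hv' hne => (h2' v' hv' hne).1), hσs v hv]
      refine (abs_add_reflect_le (hV.ne_zero hv) _ _ _ a).trans ?_
      have h4 : c₀ + a ⬝ᵥ toReal m - (c₀ + a ⬝ᵥ toReal (σ v m)) =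
          ((2 * (v ⬝ᵥ m + k) + 1 : ℤ) : ℝ) * (a ⬝ᵥ toReal (u v)) := by
        have : toReal (σ v m) = toReal m -
            ((2 * (v ⬝ᵥ m + k) + 1 : ℤ) : ℝ) • toReal (u v) := by
          funext i
          simp [toReal, σ]
        rw [this, dotProduct_sub, dotProduct_smul, smul_eq_mul]
        ring
      have h5 : |((2 * (v ⬝ᵥ m + k) + 1 : ℤ) : ℝ)| ≤ 2 * W + 1 := by
        have : |2 * (v ⬝ᵥ m + k) + 1| ≤ 2 * (W : ℤ) + 1 := by
          rw [abs_le]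
          constructor <;> omega
        rw [← Int.cast_abs]
        exact_mod_cast this
      have h6 : |a ⬝ᵥ toReal (u v)| ≤ A * U := by
        rw [dotProduct, hA, Finset.sum_mul]
        refine (Finset.abs_sum_le_sum_abs _ _).trans (Finset.sum_le_sum fun i _ => ?_)
        rw [abs_mul]
        refine mul_le_mul_of_nonneg_left ?_ (abs_nonneg _)
        have h7 := Finset.single_le_sum (f := fun v : Fin n → ℤ => ∑ i, (u v i).natAbs)
          (fun _ _ => Nat.zero_le _) hv
        have h8 := Finset.single_le_sum (f := fun i => (u v i).natAbs)
          (fun _ _ => Nat.zero_le _) (Finset.mem_univ i)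
        have h9 : (u v i).natAbs ≤ U := h8.trans h7
        rw [← Int.cast_abs, ← Nat.cast_natAbs]
        exact_mod_cast h9
      rw [h4, abs_mul]
      have h10 := mul_le_mul h5 h6 (abs_nonneg _) (by positivity)
      have h11 : c₁ * A = (2 * W + 1) * (A * U) + A := by
        simp only [c₁]
        ring
      rw [h11]
      linarith
    -- The involution permutes the good points, so summing over reflected pairs counts every error
    -- twice.
    have hinv : ∑ m ∈ Good v, D (σ v m) = ∑ m ∈ Good v, D m :=
      Finset.sum_nbij' (σ v) (σ v) (hσGood v hv) (hσGood v hv) (fun m _ => hσσ v hv m)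
        (fun m _ => hσσ v hv m) (fun _ _ => rfl)
    have hcard : ((Good v).card : ℝ) ≤ Cs v * (k + 1) ^ (n - 1) := by
      have := hCs v hv k (Good v) (Finset.filter_subset _ _)
        fun m hm => (Finset.mem_filter.mp hm).2.1
      exact_mod_cast this
    have h1 : |∑ m ∈ Good v, (D m + D (σ v m))| ≤ (Good v).card * (c₁ * A) := by
      refine (Finset.abs_sum_le_sum_abs _ _).trans ((Finset.sum_le_sum hpair).trans ?_)
      rw [Finset.sum_const, nsmul_eq_mul]
    rw [Finset.sum_add_distrib, hinv, ← two_mul, abs_mul, abs_two] at h1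
    have h2 : (Good v).card * (c₁ * A) ≤ Cs v * (k + 1) ^ (n - 1) * (c₁ * A) :=
      mul_le_mul_of_nonneg_right hcard (by positivity)
    linarith [abs_nonneg (∑ m ∈ Good v, D m)]
  have hdisj : (V : Set (Fin n → ℤ)).PairwiseDisjoint Good := by
    intro v hv v' hv' hne
    rw [Function.onFun, Finset.disjoint_left]
    intro m hm hm'
    have h1 := (Finset.mem_filter.mp hm).2.1
    have h2 := ((Finset.mem_filter.mp hm').2.2 v hv hne).1
    omega
  -- A point with an error is close to some facet. If it is not good there, then it or its
  -- reflection is close to a second facet, and in both cases the point itself is within `L` of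
  -- both.
  have hbad : ∀ m ∈ F \ V.biUnion Good, D m ≠ 0 → m ∈ V.offDiag.biUnion Bad := by
    intro m hm hDm
    obtain ⟨hmF, hnot⟩ := Finset.mem_sdiff.mp hm
    obtain ⟨v, hv, hvm⟩ : ∃ v ∈ V, v ⬝ᵥ m + k ≤ W := by
      by_contra! hcon
      exact hDm (latticeError_eq_zero hcon c₀ a)
    have h1 : m ∉ Good v := fun h => hnot (Finset.mem_biUnion.mpr ⟨v, hv, h⟩)
    obtain ⟨v', hv', hne, h2⟩ : ∃ v' ∈ V, v' ≠ v ∧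
        (v' ⬝ᵥ m + k ≤ W ∨ v' ⬝ᵥ σ v m + k ≤ W) := by
      by_contra! hcon
      exact h1 (Finset.mem_filter.mpr ⟨hmF, hvm, hcon⟩)
    have h3 := hFge m hmF v hv
    have hWL : (W : ℤ) ≤ L := by
      simp only [L]
      push_cast
      exact le_add_of_nonneg_right (by positivity)
    refine Finset.mem_biUnion.mpr ⟨(v, v'), Finset.mem_offDiag.mpr ⟨hv, hv', hne.symm⟩,
      Finset.mem_filter.mpr ⟨hmF, hvm.trans hWL, ?_⟩⟩
    rcases h2 with h2 | h2
    · exact h2.trans hWL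
    · rw [hσ] at h2
      have h4 : |v' ⬝ᵥ u v| ≤ A' := by
        have h7 := Finset.single_le_sum (f := fun v => ∑ v' ∈ V, (v' ⬝ᵥ u v).natAbs)
          (fun _ _ => Nat.zero_le _) hv
        have h8 := Finset.single_le_sum (f := fun v' => (v' ⬝ᵥ u v).natAbs)
          (fun _ _ => Nat.zero_le _) hv'
        have h9 : (v' ⬝ᵥ u v).natAbs ≤ A' := h8.trans h7
        rw [Int.abs_eq_natAbs]
        exact_mod_cast h9
      have h5 : |2 * (v ⬝ᵥ m + k) + 1| ≤ 2 * (W : ℤ) + 1 := by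
        rw [abs_le]
        constructor <;> omega
      have h6 := (le_abs_self _).trans ((abs_mul _ _).le.trans
        (mul_le_mul h5 h4 (abs_nonneg _) (by positivity)))
      change v' ⬝ᵥ m + k ≤ _
      simp only [L]
      push_cast
      linarith
  have hDmax : ∀ m ∈ F, |D m| ≤ c₂ * (|c₀| + A * (k + 1)) := by
    intro m hm
    refine (abs_latticeError_le k m c₀ a (M := ((B * (k + (W + 1)) : ℕ) : ℝ)) fun i => ?_).trans ?_
    · rw [← Int.cast_abs]
      exact_mod_cast hB _ m hm i
    · have h1 : ((B * (k + (W + 1)) : ℕ) : ℝ) + 1 ≤ (B * (W + 1) + 1) * (k + 1) := by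
        push_cast
        have : (0 : ℝ) ≤ B * W * k := by positivity
        nlinarith
      have h2 : (0 : ℝ) ≤ B * (W + 1) := by positivity
      have h3 := mul_le_mul_of_nonneg_left h1 hA0
      simp only [c₂]
      nlinarith [mul_nonneg h2 (abs_nonneg c₀)]
  have hrest : |∑ m ∈ F \ V.biUnion Good, D m| * (k + 1) ≤
      (∑ q ∈ V.offDiag, (Cb q : ℝ)) * (k + 1) ^ (n - 1) * (c₂ * (|c₀| + A * (k + 1))) := by
    have h1 : |∑ m ∈ F \ V.biUnion Good, D m| ≤
        (V.offDiag.biUnion Bad).card * (c₂ * (|c₀| + A * (k + 1))) := by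
      rw [← Finset.sum_filter_ne_zero]
      refine (Finset.abs_sum_le_sum_abs _ _).trans ?_
      refine (Finset.sum_le_sum fun m hm => hDmax m
        (Finset.mem_sdiff.mp (Finset.mem_filter.mp hm).1).1).trans ?_
      rw [Finset.sum_const, nsmul_eq_mul]
      refine mul_le_mul_of_nonneg_right ?_ (by positivity)
      exact_mod_cast Finset.card_le_card fun m hm =>
        hbad m (Finset.mem_filter.mp hm).1 (Finset.mem_filter.mp hm).2
    have h2 : ((V.offDiag.biUnion Bad).card : ℝ) * (k + 1) ≤
        (∑ q ∈ V.offDiag, (Cb q : ℝ)) * (k + 1) ^ (n - 1) := by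
      have h3 : (V.offDiag.biUnion Bad).card * (k + 1) ≤
          (∑ q ∈ V.offDiag, Cb q) * (k + 1) ^ (n - 1) := by
        refine (Nat.mul_le_mul_right _ Finset.card_biUnion_le).trans ?_
        rw [Finset.sum_mul, Finset.sum_mul]
        exact Finset.sum_le_sum fun q hq => hCb q hq k (Bad q) (Finset.filter_subset _ _)
          fun m hm => (Finset.mem_filter.mp hm).2
      exact_mod_cast h3
    have h4 : 0 ≤ c₂ * (|c₀| + A * (k + 1)) := by positivity
    calc |∑ m ∈ F \ V.biUnion Good, D m| * (k + 1)
        ≤ (V.offDiag.biUnion Bad).card * (c₂ * (|c₀| + A * (k + 1))) * (k + 1) :=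
          mul_le_mul_of_nonneg_right h1 (by positivity)
      _ = ((V.offDiag.biUnion Bad).card * (k + 1)) * (c₂ * (|c₀| + A * (k + 1))) := by ring
      _ ≤ _ := mul_le_mul_of_nonneg_right h2 h4
  have hsub : V.biUnion Good ⊆ F :=
    Finset.biUnion_subset.mpr fun v _ => Finset.filter_subset _ _
  have hgood : |∑ m ∈ V.biUnion Good, D m| * (k + 1) ≤
      (∑ v ∈ V, (Cs v : ℝ)) * (k + 1) ^ (n - 1) * (c₁ * A) * (k + 1) := by
    refine mul_le_mul_of_nonneg_right ?_ (by positivity)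
    rw [Finset.sum_biUnion hdisj, Finset.sum_mul, Finset.sum_mul]
    exact (Finset.abs_sum_le_sum_abs _ _).trans (Finset.sum_le_sum hGoodSum)
  rw [← Finset.sum_sdiff hsub]
  have hfin : (∑ v ∈ V, (Cs v : ℝ)) * (k + 1) ^ (n - 1) * (c₁ * A) * (k + 1) ≤
      (∑ v ∈ V, (Cs v : ℝ)) * (k + 1) ^ (n - 1) * c₁ * (|c₀| + A * (k + 1)) := by
    have h1 : 0 ≤ (∑ v ∈ V, (Cs v : ℝ)) * (k + 1) ^ (n - 1) * c₁ := by
      have : (0 : ℝ) ≤ ∑ v ∈ V, (Cs v : ℝ) := Finset.sum_nonneg fun _ _ => Nat.cast_nonneg _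
      positivity
    have h2 := mul_le_mul_of_nonneg_left (le_add_of_nonneg_left (a := A * (k + 1))
      (abs_nonneg c₀)) h1
    linarith
  refine (mul_le_mul_of_nonneg_right (abs_add_le _ _) (by positivity)).trans ?_
  rw [add_mul]
  linarith

/-! ### Volume and Donaldson-Futaki invariants -/

section Asymptotics

open MeasureTheory

/-- In dimension zero the only lattice vector is `0`, which is not primitive, and the hull of the
empty set has no interior. -/
lemma IsFanoPolytope.pos (hV : IsFanoPolytope V) : 0 < n := by
  rcases Nat.eq_zero_or_pos n with rfl | h
  · have hV0 : V = ∅ := Finset.eq_empty_iff_forall_notMem.mpr fun v hv =>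
      hV.ne_zero hv (Subsingleton.elim _ _)
    have h0 := interior_subset hV.zero_mem_interior
    rw [hV0] at h0
    simp at h0
  · exact h

/-- The volume of the polytope. -/
def polytopeVolume (V : Finset (Fin n → ℤ)) : ℝ := volume.real (dilate V 1)

/-- The integral of a linear form over the polytope. -/
def polytopeMoment (V : Finset (Fin n → ℤ)) (a : Fin n → ℝ) : ℝ := ∫ p in dilate V 1, a ⬝ᵥ p

lemma IsFanoPolytope.polytopeVolume_pos (hV : IsFanoPolytope V) : 0 < polytopeVolume V := by
  have hopen : IsOpen {p : Fin n → ℝ | ∀ v ∈ V, -1 < toReal v ⬝ᵥ p} := by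
    have : {p : Fin n → ℝ | ∀ v ∈ V, -1 < toReal v ⬝ᵥ p} = ⋂ v ∈ V, {p | -1 < toReal v ⬝ᵥ p} := by
      ext
      simp
    rw [this]
    exact isOpen_biInter_finset fun v _ => isOpen_lt continuous_const
      (continuous_dotProduct_right _)
  refine ENNReal.toReal_pos (ne_of_gt ?_) (hV.isCompact_dilate 1).measure_lt_top.ne
  refine (hopen.measure_pos volume ⟨0, fun v _ => by simp⟩).trans_le (measure_mono ?_)
  exact fun p hp v hv => (hp v hv).le

/-- Normalizing by powers of `k + 1/2` instead of `k` removes the second-order terms of the counting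
function and of the weight, leaving errors that tend to zero even at the scale seen by the
Donaldson-Futaki invariant. -/
lemma IsFanoPolytope.exists_error_bound (hV : IsFanoPolytope V) (ξ : Fin n → ℤ) :
    ∃ C : ℝ, ∀ k : ℕ,
      |((k : ℝ) + 1 / 2) * ((latticeFinset hV k).card / ((k : ℝ) + 1 / 2) ^ n -
        polytopeVolume V)| ≤ C * (1 / ((k : ℝ) + 1)) ∧
      |((∑ m ∈ latticeFinset hV k, ξ ⬝ᵥ m : ℤ) : ℝ) / ((k : ℝ) + 1 / 2) ^ n -
        ((k : ℝ) + 1 / 2) * polytopeMoment V (toReal ξ)| ≤ C * (1 / ((k : ℝ) + 1)) := by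
  obtain ⟨C, hC⟩ := hV.exists_abs_sum_sub_integral_le
  set A : ℝ := ∑ i, |toReal ξ i| with hA
  have hA0 : 0 ≤ A := Finset.sum_nonneg fun _ _ => abs_nonneg _
  have hC0 : 0 ≤ C := by
    have := (hC 0 1 0).trans' (by positivity)
    simpa using this
  refine ⟨C * (1 + A) * 2 ^ n, fun k => ?_⟩
  have hk : (0 : ℝ) ≤ k := Nat.cast_nonneg k
  set t : ℝ := (k : ℝ) + 1 / 2 with ht
  have ht0 : 0 < t := by positivity
  -- The inequality `k + 1 ≤ 2 (k + 1/2)` accounts for the factor `2 ^ n` in the constant.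
  have hpow : ((k : ℝ) + 1) ^ n ≤ 2 ^ n * t ^ n := by
    rw [← mul_pow]
    exact pow_le_pow_left₀ (by positivity) (by rw [ht]; linarith) n
  have hpow1 : ((k : ℝ) + 1) ^ n = (k + 1) ^ (n - 1) * (k + 1) := by
    rw [← pow_succ, Nat.sub_add_cancel hV.pos]
  have hvol := hC k 1 0
  have hmom := hC k 0 (toReal ξ)
  rw [← ht] at hvol hmom
  simp only [zero_dotProduct, add_zero, Finset.sum_const, nsmul_eq_mul, mul_one, abs_one,
    Pi.zero_apply, abs_zero, mul_zero, zero_mul, setIntegral_const, smul_eq_mul] at hvol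
  rw [volume_dilate ht0] at hvol
  simp only [zero_add, abs_zero, toReal_dotProduct] at hmom
  rw [integral_dilate ht0, ← Int.cast_sum, ← hA] at hmom
  change |((_ : ℝ) - t ^ n * polytopeVolume V)| * _ ≤ _ at hvol
  change |((_ : ℝ) - t ^ (n + 1) * polytopeMoment V _)| * _ ≤ _ at hmom
  have hk1 : (0 : ℝ) < k + 1 := by positivity
  have htn : 0 < t ^ n := by positivity
  constructor
  · have h1 : t * ((latticeFinset hV k).card / t ^ n - polytopeVolume V) =
        t * ((latticeFinset hV k).card - t ^ n * polytopeVolume V) / t ^ n := by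
      field_simp
    rw [h1, abs_div, abs_mul, abs_of_pos ht0, abs_of_pos htn, div_le_iff₀ htn]
    have h2 : t * |(latticeFinset hV k).card - t ^ n * polytopeVolume V| ≤
        C * (k + 1) ^ (n - 1) := by
      refine le_trans ?_ hvol
      rw [mul_comm]
      exact mul_le_mul_of_nonneg_left (by rw [ht]; linarith) (abs_nonneg _)
    refine h2.trans ?_
    rw [mul_one_div, div_mul_eq_mul_div, le_div_iff₀ hk1, mul_assoc, ← hpow1]
    have h3 : 0 ≤ C * A * (2 ^ n * t ^ n) := by positivity
    nlinarith [mul_le_mul_of_nonneg_left hpow hC0]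
  · have h1 : ((∑ m ∈ latticeFinset hV k, ξ ⬝ᵥ m : ℤ) : ℝ) / t ^ n -
        t * polytopeMoment V (toReal ξ) =
        (((∑ m ∈ latticeFinset hV k, ξ ⬝ᵥ m : ℤ) : ℝ) -
          t ^ (n + 1) * polytopeMoment V (toReal ξ)) / t ^ n := by
      field_simp
      ring
    rw [h1, abs_div, abs_of_pos htn, div_le_iff₀ htn]
    have h2 := hmom
    rw [← mul_assoc, mul_right_comm (C * A), mul_le_mul_iff_left₀ hk1] at h2
    refine h2.trans ?_
    rw [mul_one_div, div_mul_eq_mul_div, le_div_iff₀ hk1, mul_assoc, ← hpow1]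
    have h3 : 0 ≤ C * (2 ^ n * t ^ n) := by positivity
    nlinarith [mul_le_mul_of_nonneg_left hpow (mul_nonneg hC0 hA0)]

lemma tendsto_const_mul_one_div (C : ℝ) :
    Tendsto (fun k : ℕ => C * (1 / ((k : ℝ) + 1))) atTop (𝓝 0) := by
  simpa using (tendsto_one_div_add_atTop_nhds_zero_nat (𝕜 := ℝ)).const_mul C

lemma IsFanoPolytope.tendsto_card (hV : IsFanoPolytope V) :
    Tendsto (fun k : ℕ => ((latticeFinset hV k).card : ℝ) / ((k : ℝ) + 1 / 2) ^ n) atTop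
      (𝓝 (polytopeVolume V)) := by
  obtain ⟨C, hC⟩ := hV.exists_error_bound 0
  rw [tendsto_iff_norm_sub_tendsto_zero]
  refine squeeze_zero (fun _ => norm_nonneg _) (fun k => ?_) (tendsto_const_mul_one_div (2 * C))
  have h := (hC k).1
  have hk : (0 : ℝ) ≤ k := Nat.cast_nonneg k
  rw [abs_mul, abs_of_pos (by positivity)] at h
  rw [Real.norm_eq_abs]
  nlinarith [abs_nonneg ((latticeFinset hV k).card / ((k : ℝ) + 1 / 2) ^ n - polytopeVolume V)]

lemma IsFanoPolytope.hasAnticanonicalVolume (hV : IsFanoPolytope V) :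
    HasAnticanonicalVolume (toricVariety V) n (polytopeVolume V) := by
  have h1 : Tendsto (fun k : ℕ => (1 + 1 / 2 * (1 / (k : ℝ))) ^ n) atTop (𝓝 1) := by
    have h := (((tendsto_one_div_atTop_nhds_zero_nat (𝕜 := ℝ)).const_mul (1 / 2)).const_add
      1).pow n
    rwa [mul_zero, add_zero, one_pow] at h
  have h2 := hV.tendsto_card.mul h1
  rw [mul_one] at h2
  refine h2.congr' ?_
  filter_upwards [eventually_gt_atTop 0] with k hk
  have hk' : (0 : ℝ) < k := by exact_mod_cast hk
  rw [finrank_anticanonicalSections hV]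
  have h3 : 1 + 1 / 2 * (1 / (k : ℝ)) = (k + 1 / 2) / k := by field_simp
  rw [h3, div_pow]
  have h4 : ((k : ℝ) + 1 / 2) ^ n ≠ 0 := by positivity
  field_simp

/-- The Donaldson-Futaki invariant of a product configuration. -/
lemma hasDonaldsonFutaki_productConfiguration (hV : IsFanoPolytope V) (ξ : Fin n → ℤ) :
    (productConfiguration hV ξ).HasDonaldsonFutaki
      (-(polytopeMoment V (toReal ξ) / polytopeVolume V)) := by
  set b := polytopeMoment V (toReal ξ) / polytopeVolume V with hb
  have hvol := hV.polytopeVolume_pos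
  -- With `t = k + 1/2`, the weight is about `t^(n+1)` times the moment and the dimension about
  -- `t^n` times the volume. The quotient is therefore `b t / k = b + (b / 2) k⁻¹` up to `o(k⁻¹)`.
  refine ⟨1, b, b / 2, one_pos, by ring, ?_⟩
  simp only [one_mul, weight_productConfiguration hV, finrank_anticanonicalSections hV]
  obtain ⟨C, hC⟩ := hV.exists_error_bound ξ
  have hd : Tendsto (fun k : ℕ => ((k : ℝ) + 1 / 2) * ((latticeFinset hV k).card /
      ((k : ℝ) + 1 / 2) ^ n - polytopeVolume V)) atTop (𝓝 0) :=
    squeeze_zero_norm (fun k => (hC k).1) (tendsto_const_mul_one_div C)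
  have he : Tendsto (fun k : ℕ => ((∑ m ∈ latticeFinset hV k, ξ ⬝ᵥ m : ℤ) : ℝ) /
      ((k : ℝ) + 1 / 2) ^ n - ((k : ℝ) + 1 / 2) * polytopeMoment V (toReal ξ)) atTop (𝓝 0) :=
    squeeze_zero_norm (fun k => (hC k).2) (tendsto_const_mul_one_div C)
  have h1 := ((he.sub (hd.const_mul b)).div hV.tendsto_card hvol.ne').add_const (b / 2)
  rw [mul_zero, sub_zero, zero_div, zero_add] at h1
  refine h1.congr' ?_
  filter_upwards [eventually_gt_atTop 0, hV.tendsto_card.eventually_ne hvol.ne'] with k hk hN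
  have hk' : (k : ℝ) ≠ 0 := by exact_mod_cast hk.ne'
  have ht : (k : ℝ) + 1 / 2 ≠ 0 := by positivity
  set t := (k : ℝ) + 1 / 2 with htk
  have htn : t ^ n ≠ 0 := pow_ne_zero n ht
  have hI : polytopeMoment V (toReal ξ) = b * polytopeVolume V := by
    rw [hb, div_mul_cancel₀ _ hvol.ne']
  rw [hI]
  have hN' : ((latticeFinset hV k).card : ℝ) ≠ 0 := fun h => hN (by rw [h, zero_div])
  have hkt : (k : ℝ) = t - 1 / 2 := by rw [htk]; ring
  simp only [Pi.div_apply]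
  set N : ℝ := ((latticeFinset hV k).card : ℝ)
  set S : ℝ := ((∑ m ∈ latticeFinset hV k, ξ ⬝ᵥ m : ℤ) : ℝ)
  have h2 : (k : ℝ) * (S / (k * N) - b) = S / N - k * b := by
    field_simp
  rw [h2, hkt]
  field_simp
  ring

/-- Moments of the polytope of a K-semistable toric Fano variety. -/
lemma polytopeMoment_nonpos (hV : IsFanoPolytope V) (hK : IsKSemistable (toricVariety V) n)
    (ξ : Fin n → ℤ) : polytopeMoment V (toReal ξ) ≤ 0 := by
  have h := hK 1 one_pos _ _ (hasDonaldsonFutaki_productConfiguration hV ξ)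
  have hvol := hV.polytopeVolume_pos
  by_contra! hpos
  have := div_pos hpos hvol
  linarith

end Asymptotics

/-! ### Bounding the volume by that of a simplex -/

section Simplex

open MeasureTheory

/-- The function `c - ∑ xᵢ` on the standard simplex of size `c`. -/
def simplexHeight (n : ℕ) (c : ℝ) (x : Fin n → ℝ) : ENNReal :=
  (Set.Ici 0).indicator (fun x => ENNReal.ofReal (c - ∑ i, x i)) x

lemma measurable_simplexHeight (n : ℕ) (c : ℝ) : Measurable (simplexHeight n c) :=
  Measurable.indicator (by fun_prop) measurableSet_Ici

/-- On `[0, c]` this is the integral of a power. The truncation makes the formula valid for every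
real `c`; with `p = 0` the integrand would not vanish beyond `c`, since `0 ^ 0 = 1`. -/
lemma lintegral_pow_max (c : ℝ) {p : ℕ} (hp : p ≠ 0) :
    ∫⁻ x in Set.Ici (0 : ℝ), ENNReal.ofReal (max (c - x) 0 ^ p / p.factorial) =
      ENNReal.ofReal (max c 0 ^ (p + 1) / (p + 1).factorial) := by
  rcases le_or_gt c 0 with hc | hc
  · rw [max_eq_right hc, zero_pow (by omega), zero_div, ENNReal.ofReal_zero]
    refine (setLIntegral_congr_fun measurableSet_Ici fun x hx => ?_).trans lintegral_zero
    rw [max_eq_right (by linarith [Set.mem_Ici.mp hx]), zero_pow hp, zero_div, ENNReal.ofReal_zero]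
  · have h1 : ∫⁻ x in Set.Ici (0 : ℝ), ENNReal.ofReal (max (c - x) 0 ^ p / p.factorial) =
        ∫⁻ x in Set.Ioc 0 c, ENNReal.ofReal ((c - x) ^ p / p.factorial) := by
      rw [setLIntegral_congr Ioi_ae_eq_Ici.symm, ← lintegral_indicator measurableSet_Ioi,
        ← lintegral_indicator measurableSet_Ioc]
      congr 1
      funext x
      simp only [Set.indicator_apply, Set.mem_Ioi, Set.mem_Ioc]
      by_cases hx0 : 0 < x
      · by_cases hxc : x ≤ c
        · rw [if_pos hx0, if_pos ⟨hx0, hxc⟩, max_eq_left (by linarith)]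
        · rw [if_pos hx0, if_neg (fun h => hxc h.2), max_eq_right (by linarith), zero_pow hp,
            zero_div, ENNReal.ofReal_zero]
      · rw [if_neg hx0, if_neg (fun h => hx0 h.1)]
    have h2 : ∫ x in (0 : ℝ)..c, (c - x) ^ p / p.factorial = c ^ (p + 1) / (p + 1).factorial := by
      rw [intervalIntegral.integral_div, intervalIntegral.integral_comp_sub_left (fun x => x ^ p),
        integral_pow, sub_self, sub_zero, zero_pow (by omega), sub_zero, Nat.factorial_succ]
      push_cast
      rw [div_div]
    rw [h1, ← ofReal_integral_eq_lintegral_ofReal, ← intervalIntegral.integral_of_le hc.le, h2,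
      max_eq_left hc.le]
    · exact (Continuous.integrableOn_Icc (by fun_prop)).mono_set Set.Ioc_subset_Icc_self
    · refine (ae_restrict_mem measurableSet_Ioc).mono fun x hx => ?_
      have : 0 ≤ c - x := by linarith [hx.2]
      exact div_nonneg (pow_nonneg this _) (Nat.cast_nonneg _)

/-- By Tonelli in the first coordinate: the slice at `x ≥ 0` is the height function of size `c - x`.
This size may be negative, so the induction runs over all real `c`. -/
lemma lintegral_simplexHeight (n : ℕ) (c : ℝ) :
    ∫⁻ x, simplexHeight n c x = ENNReal.ofReal (max c 0 ^ (n + 1) / (n + 1).factorial) := by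
  induction n generalizing c with
  | zero =>
    have h1 : ∀ x : Fin 0 → ℝ, simplexHeight 0 c x = ENNReal.ofReal c := by
      intro x
      rw [simplexHeight, Set.indicator_of_mem (Set.mem_Ici.mpr fun i => i.elim0)]
      simp
    simp only [h1, lintegral_const]
    rw [Measure.volume_pi_eq_dirac 0]
    simp
  | succ n ih =>
    have h1 := (volume_preserving_piFinSuccAbove (fun _ : Fin (n + 1) => ℝ) 0).symm
    rw [← h1.lintegral_comp (measurable_simplexHeight _ _), Measure.volume_eq_prod]
    refine (lintegral_prod _ ((measurable_simplexHeight _ _).comp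
      (MeasurableEquiv.measurable _)).aemeasurable).trans ?_
    rw [← lintegral_pow_max c (Nat.succ_ne_zero n), ← lintegral_indicator measurableSet_Ici]
    refine lintegral_congr fun x => ?_
    have h2 : ∀ y : Fin n → ℝ, simplexHeight (n + 1) c
        ((MeasurableEquiv.piFinSuccAbove (fun _ : Fin (n + 1) => ℝ) 0).symm (x, y)) =
        (Set.Ici 0).indicator (fun _ => simplexHeight n (c - x) y) x := by
      intro y
      change simplexHeight (n + 1) c (Fin.insertNth 0 x y) = _
      rw [Fin.insertNth_zero]
      set z : Fin (n + 1) → ℝ := Fin.cons x y with hz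
      have hmem : z ∈ Set.Ici (0 : Fin (n + 1) → ℝ) ↔ 0 ≤ x ∧ y ∈ Set.Ici (0 : Fin n → ℝ) :=
        Fin.forall_fin_succ
      change simplexHeight (n + 1) c z = _
      by_cases hx : 0 ≤ x
      · rw [Set.indicator_of_mem (Set.mem_Ici.mpr hx)]
        by_cases hy : y ∈ Set.Ici (0 : Fin n → ℝ)
        · rw [simplexHeight, simplexHeight, Set.indicator_of_mem (hmem.mpr ⟨hx, hy⟩),
            Set.indicator_of_mem hy, Fin.sum_univ_succ, sub_sub]
          rfl
        · rw [simplexHeight, simplexHeight, Set.indicator_of_notMem hy,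
            Set.indicator_of_notMem fun h => hy (hmem.mp h).2]
      · rw [simplexHeight, Set.indicator_of_notMem fun h => hx (hmem.mp h).1,
          Set.indicator_of_notMem fun h => hx (Set.mem_Ici.mp h)]
    refine (lintegral_congr h2).trans ?_
    by_cases hx : x ∈ Set.Ici (0 : ℝ)
    · simp only [Set.indicator_of_mem hx]
      exact ih (c - x)
    · simp only [Set.indicator_of_notMem hx, lintegral_zero]

/-- In the coordinates `x i = ⟨v i, p⟩ + 1` the polytope lies in the positive orthant, and the
moment inequality bounds its volume by the integral of `n + 1 - ∑ x i`. Replacing this function by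
its positive part and the polytope by the orthant leaves the integral of the height over a simplex
of size `n + 1`, divided by the Jacobian. -/
lemma IsFanoPolytope.polytopeVolume_le (hV : IsFanoPolytope V) {v : Fin n → Fin n → ℤ}
    (hv : ∀ i, v i ∈ V) (hdet : (Matrix.of v).det ≠ 0)
    (hI : polytopeMoment V (toReal (∑ i, v i)) ≤ 0) :
    polytopeVolume V ≤ |(((Matrix.of v).det : ℤ) : ℝ)|⁻¹ * (((n : ℝ) + 1) ^ n / n.factorial) := by
  let M : Matrix (Fin n) (Fin n) ℝ := (Matrix.of v).map (Int.castRingHom ℝ)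
  have hM : M.det = (((Matrix.of v).det : ℤ) : ℝ) :=
    ((Int.castRingHom ℝ).map_det (Matrix.of v)).symm
  have hM0 : M.det ≠ 0 := by
    rw [hM]
    exact_mod_cast hdet
  have hMv : ∀ p i, (Matrix.toLin' M p) i = toReal (v i) ⬝ᵥ p := fun _ _ => rfl
  let T : (Fin n → ℝ) → (Fin n → ℝ) := fun p => Matrix.toLin' M p + 1
  have hint : IntegrableOn (fun p : Fin n → ℝ => toReal (∑ i, v i) ⬝ᵥ p) (dilate V 1) :=
    ContinuousOn.integrableOn_compact (hV.isCompact_dilate 1)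
      (continuous_dotProduct_right _).continuousOn
  have hint1 : IntegrableOn (fun _ : Fin n → ℝ => (1 : ℝ)) (dilate V 1) :=
    integrableOn_const (hV.isCompact_dilate 1).measure_lt_top.ne
  have h1 : polytopeVolume V ≤ ∫ p in dilate V 1, (1 - toReal (∑ i, v i) ⬝ᵥ p) := by
    rw [integral_sub hint1 hint, setIntegral_const, smul_eq_mul, mul_one]
    change _ ≤ polytopeVolume V - polytopeMoment V _
    linarith
  have h2 : ∀ p, 1 - toReal (∑ i, v i) ⬝ᵥ p = ((n : ℝ) + 1) - ∑ i, T p i := by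
    intro p
    have h3 : toReal (∑ i, v i) = ∑ i, toReal (v i) := by
      funext j
      simp [toReal]
    simp only [T, Pi.add_apply, hMv, Pi.one_apply, Finset.sum_add_distrib, Finset.sum_const,
      Finset.card_univ, Fintype.card_fin, nsmul_eq_mul, mul_one]
    rw [h3, sum_dotProduct]
    ring
  have h3 : ENNReal.ofReal (∫ p in dilate V 1, (1 - toReal (∑ i, v i) ⬝ᵥ p)) ≤
      ∫⁻ p, simplexHeight n (n + 1) (T p) := by
    have hg := hint1.sub hint
    have h4 := integral_mono hg hg.pos_part fun p => le_max_left _ (0 : ℝ)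
    refine (ENNReal.ofReal_le_ofReal h4).trans ?_
    rw [ofReal_integral_eq_lintegral_ofReal hg.pos_part (ae_of_all _ fun p => le_max_right _ _),
      ← lintegral_indicator (isClosed_dilate V 1).measurableSet]
    refine lintegral_mono fun p => ?_
    by_cases hp : p ∈ dilate V 1
    · rw [Set.indicator_of_mem hp]
      rw [simplexHeight, Set.indicator_of_mem, ← h2, ENNReal.ofReal_max, ENNReal.ofReal_zero,
        max_eq_left zero_le]
      · exact le_rfl
      intro i
      have := hp (v i) (hv i)
      simp only [T, Pi.add_apply, hMv, Pi.one_apply, Pi.zero_apply]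
      linarith
    · rw [Set.indicator_of_notMem hp]
      exact zero_le
  have hmeas : Measurable fun x : Fin n → ℝ => simplexHeight n (n + 1) (x + 1) :=
    (measurable_simplexHeight n _).comp (measurable_add_const 1)
  have h4 : ∫⁻ p, simplexHeight n (n + 1) (T p) =
      ENNReal.ofReal |M.det|⁻¹ * ENNReal.ofReal (((n : ℝ) + 1) ^ n / n.factorial) := by
    have h5 := lintegral_map (μ := volume) hmeas
      (LinearMap.continuous_of_finiteDimensional (Matrix.toLin' M)).measurable
    refine h5.symm.trans ?_
    -- The translation by `1` does not affect the integral, and `(n + 1)^(n + 1) / (n + 1)!` equals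
    -- `(n + 1)^n / n!`.
    rw [Real.map_matrix_volume_pi_eq_smul_volume_pi hM0, lintegral_smul_measure, abs_inv,
      lintegral_add_right_eq_self (fun x => simplexHeight n (n + 1) x) 1, lintegral_simplexHeight,
      max_eq_left (by positivity), pow_succ, Nat.factorial_succ, smul_eq_mul]
    congr 2
    push_cast
    field_simp
  have h6 := (ENNReal.ofReal_le_ofReal h1).trans (h3.trans h4.le)
  rw [← ENNReal.ofReal_mul (by positivity), ENNReal.ofReal_le_ofReal_iff (by positivity), hM] at h6
  exact h6

end Simplex

/-! ### Unimodular sets of vertices -/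

/-- All maximal minors of the vertices are `0`, `1` or `-1`. -/
def IsUnimodular (V : Finset (Fin n → ℤ)) : Prop :=
  ∀ v : Fin n → Fin n → ℤ, (∀ i, v i ∈ V) → |(Matrix.of v).det| ≤ 1

/-- A functional that vanishes on all vertices would contradict
`IsFanoPolytope.exists_dotProduct_pos`. -/
lemma IsFanoPolytope.span_eq_top (hV : IsFanoPolytope V) :
    Submodule.span ℝ (toReal '' (V : Set (Fin n → ℤ))) = ⊤ := by
  by_contra hne
  obtain ⟨f, hf, hle⟩ := Submodule.exists_le_ker_of_lt_top _ (lt_top_iff_ne_top.mpr hne)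
  have hfp : ∀ p, f p = p ⬝ᵥ fun i => f (Pi.single i 1) := by
    intro p
    rw [f.pi_apply_eq_sum_univ p]
    refine Finset.sum_congr rfl fun i _ => ?_
    rw [smul_eq_mul]
    congr 2
    funext j
    rw [Pi.single_apply]
    exact if_congr eq_comm rfl rfl
  have hμ : (fun i => f (Pi.single i 1)) ≠ 0 := by
    intro h
    refine hf (LinearMap.ext fun p => ?_)
    rw [hfp, h, dotProduct_zero]
    rfl
  obtain ⟨v, hv, hpos⟩ := hV.exists_dotProduct_pos hμ
  rw [← hfp] at hpos
  exact hpos.ne' (hle (Submodule.subset_span ⟨v, hv, rfl⟩))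

lemma det_ne_zero_of_linearIndependent {v : Fin n → Fin n → ℤ}
    (h : LinearIndependent ℝ fun i => toReal (v i)) : (Matrix.of v).det ≠ 0 := by
  have h1 : LinearIndependent ℝ ((Matrix.of v).map (Int.castRingHom ℝ)).row := h
  rw [Matrix.linearIndependent_rows_iff_isUnit, Matrix.isUnit_iff_isUnit_det] at h1
  intro h0
  refine h1.ne_zero ?_
  rw [← RingHom.mapMatrix_apply, ← RingHom.map_det, h0, map_zero]

open Classical in
/-- A subset of the vertices and a basis of vertices which contains a basis of its span. -/
lemma IsFanoPolytope.exists_adapted_basis (hV : IsFanoPolytope V) {S : Finset (Fin n → ℤ)}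
    (hS : S ⊆ V) : ∃ (v : Fin n → Fin n → ℤ) (I : Finset (Fin n)), (∀ i, v i ∈ V) ∧
      (Matrix.of v).det ≠ 0 ∧ (LinearIndependent ℝ fun i => toReal (v i)) ∧ (∀ i ∈ I, v i ∈ S) ∧
      (∀ w ∈ S, toReal w ∈ Submodule.span ℝ ((fun i => toReal (v i)) '' I)) ∧
      ((LinearIndepOn ℝ toReal (S : Set (Fin n → ℤ))) → ∀ w ∈ S, ∃ i ∈ I, v i = w) := by
  have htoReal : Function.Injective (toReal : (Fin n → ℤ) → Fin n → ℝ) := fun a b h =>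
    funext fun i => Int.cast_injective (congrFun h i)
  obtain ⟨T, hTS, hspan, hli⟩ := exists_linearIndependent ℝ (toReal '' (S : Set (Fin n → ℤ)))
  have hliT : LinearIndepOn ℝ id T := hli
  have hTV : T ⊆ toReal '' (V : Set (Fin n → ℤ)) := hTS.trans (Set.image_mono hS)
  let B := hliT.extend hTV
  have hBli : LinearIndependent ℝ ((↑) : B → Fin n → ℝ) := hliT.linearIndepOn_extend hTV
  have hBV : B ⊆ toReal '' (V : Set (Fin n → ℤ)) := hliT.extend_subset hTV
  have hTB : T ⊆ B := hliT.subset_extend hTV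
  have hBspan : ⊤ ≤ Submodule.span ℝ (Set.range ((↑) : B → Fin n → ℝ)) := by
    rw [Subtype.range_coe, ← hV.span_eq_top]
    exact Submodule.span_le.mpr (hliT.subset_span_extend hTV)
  let e := (Module.Basis.mk hBli hBspan).indexEquiv (Pi.basisFun ℝ (Fin n))
  have hv : ∀ i, ∃ v ∈ V, toReal v = (e.symm i).1 := fun i => hBV (e.symm i).2
  choose v hvV hve using hv
  have hvli : LinearIndependent ℝ fun i => toReal (v i) := by
    simp only [hve]
    exact hBli.comp e.symm e.symm.injective
  have himg : ∀ p ∈ T, ∃ i, (e.symm i).1 ∈ T ∧ toReal (v i) = p := by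
    intro p hp
    refine ⟨e ⟨p, hTB hp⟩, ?_, ?_⟩
    · simpa using hp
    · rw [hve]
      simp
  refine ⟨v, Finset.univ.filter fun i => (e.symm i).1 ∈ T, hvV,
    det_ne_zero_of_linearIndependent hvli, hvli, ?_, ?_, ?_⟩
  · intro i hi
    obtain ⟨w, hw, hwe⟩ := hTS (Finset.mem_filter.mp hi).2
    rw [← hve] at hwe
    rwa [← htoReal hwe]
  · intro w hw
    have h1 : toReal w ∈ Submodule.span ℝ T := by
      rw [hspan]
      exact Submodule.subset_span ⟨w, hw, rfl⟩
    refine Submodule.span_mono (fun p hp => ?_) h1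
    obtain ⟨i, hi, hip⟩ := himg p hp
    exact ⟨i, by simpa using hi, hip⟩
  · intro hind w hw
    -- `T` spans the same space as `S`, so an independent `S` cannot have an element outside `T`.
    have h1 : toReal w ∈ T := by
      by_contra hwT
      have h2 : T ⊆ toReal '' ((S : Set (Fin n → ℤ)) \ {w}) := by
        intro p hp
        obtain ⟨w', hw', rfl⟩ := hTS hp
        refine ⟨w', ⟨hw', fun h => hwT ?_⟩, rfl⟩
        rw [Set.mem_singleton_iff] at h
        rwa [← h]
      have h3 : toReal w ∈ Submodule.span ℝ (toReal '' ((S : Set (Fin n → ℤ)) \ {w})) := by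
        refine Submodule.span_mono h2 ?_
        rw [hspan]
        exact Submodule.subset_span ⟨w, hw, rfl⟩
      exact hind.notMem_span hw h3
    obtain ⟨i, hi, hip⟩ := himg _ h1
    exact ⟨i, by simpa using hi, htoReal hip⟩

lemma exists_dual_basis {v : Fin n → Fin n → ℤ} (h : IsUnit (Matrix.of v).det) :
    ∃ u : Fin n → Fin n → ℤ, (∀ i j, v i ⬝ᵥ u j = if i = j then 1 else 0) ∧
      ∀ m, ∑ i, (v i ⬝ᵥ m) • u i = m := by
  refine ⟨fun j k => (Matrix.of v)⁻¹ k j, fun i j => ?_, fun m => ?_⟩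
  · have := congrFun (congrFun (Matrix.mul_nonsing_inv (Matrix.of v) h) i) j
    rw [Matrix.one_apply] at this
    exact this
  · have h1 : (Matrix.of v)⁻¹.mulVec ((Matrix.of v).mulVec m) = m := by
      rw [Matrix.mulVec_mulVec, Matrix.nonsing_inv_mul _ h, Matrix.one_mulVec]
    conv_rhs => rw [← h1]
    funext k
    rw [Finset.sum_apply]
    change _ = ∑ i, (Matrix.of v)⁻¹ k i * _
    refine Finset.sum_congr rfl fun i _ => ?_
    rw [Pi.smul_apply, smul_eq_mul, mul_comm]
    rfl

lemma IsUnimodular.isUnit_det (hU : IsUnimodular V) {v : Fin n → Fin n → ℤ} (hv : ∀ i, v i ∈ V)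
    (h : (Matrix.of v).det ≠ 0) : IsUnit (Matrix.of v).det := by
  have h1 := hU v hv
  rw [Int.isUnit_iff]
  rw [abs_le] at h1
  omega

/-- The canonical divisor is Cartier if the vertices are unimodular. -/
lemma IsUnimodular.isGorenstein (hU : IsUnimodular V) (hV : IsFanoPolytope V) :
    IsGorenstein (toricVariety V) n := by
  intro x
  obtain ⟨v, I, hvV, hdet, -, hvS, hspan, -⟩ :=
    hV.exists_adapted_basis (S := facetSet x) fun _ => mem_of_mem_facetSet
  obtain ⟨u, hu, -⟩ := exists_dual_basis (hU.isUnit_det hvV hdet)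
  obtain ⟨b, i₀, hb, hi₀, hbx⟩ := exists_coneMonomial_notMem x
  obtain ⟨m, hm⟩ : ∃ m : Fin n → ℤ, ∀ w ∈ facetSet x, w ⬝ᵥ m = -1 := by
    -- This vector takes the value `-1` on the basis vectors in `I`. It does so on all of `facetSet
    -- x`, since `b / i₀` is a rational functional that is `-1` there and agrees with it on the span
    -- of that basis.
    refine ⟨-∑ i ∈ I, u i, fun w hw => ?_⟩
    have h1 : ∀ i ∈ I, v i ⬝ᵥ -∑ i ∈ I, u i = -1 := by
      intro i hi
      rw [dotProduct_neg, dotProduct_sum]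
      simp [hu, hi]
    have h2 : (i₀ : ℝ) * (toReal w ⬝ᵥ toReal (-∑ i ∈ I, u i)) = toReal w ⬝ᵥ toReal b := by
      refine Submodule.span_induction (p := fun p _ => (i₀ : ℝ) *
        (p ⬝ᵥ toReal (-∑ i ∈ I, u i)) = p ⬝ᵥ toReal b) ?_ (by simp) ?_ ?_ (hspan w hw)
      · rintro _ ⟨i, hi, rfl⟩
        beta_reduce
        rw [toReal_dotProduct, toReal_dotProduct, h1 i hi,
          dotProduct_of_mem_facetSet (hvS i hi) hb hbx]
        push_cast
        ring
      · intro p q _ _ hp hq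
        rw [add_dotProduct, add_dotProduct, mul_add, hp, hq]
      · intro c p _ hp
        rw [smul_dotProduct, smul_dotProduct, smul_eq_mul, smul_eq_mul, ← hp]
        ring
    rw [toReal_dotProduct, toReal_dotProduct, dotProduct_of_mem_facetSet hw hb hbx] at h2
    have h3 : (i₀ : ℤ) * (w ⬝ᵥ -∑ i ∈ I, u i) = -i₀ := by exact_mod_cast h2
    have h4 : (i₀ : ℤ) * (w ⬝ᵥ -∑ i ∈ I, u i + 1) = 0 := by linarith
    rcases mul_eq_zero.mp h4 with h5 | h5 <;> omega
  refine ⟨sectionOf V 1 (toField V (AddMonoidAlgebra.single m 1)), ?_, fun s hs => ?_⟩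
  · have h1 := sectionOf_mem_stalk hV (x := x) (k := 1) (j := 0)
      (L := AddMonoidAlgebra.single m 1) (D := 1) SetLike.GradedOne.one_mem (one_notMem_primeOf x)
      fun w hw => single_mem_ordGE 1 (by rw [hm w hw]; simp)
    rwa [map_one, map_one, div_one] at h1
  · have h1 := eq_sectionOf hs.1
    set f := s (exteriorPower.ιMulti _ n (dlogBasis V)) with hf
    rw [h1] at hs
    obtain ⟨j, L, D, hD, hx, hfL, hL⟩ := exists_of_mem_stalk hV hs
    obtain ⟨a, ha⟩ := mem_range_stalk_of_ordGE (x := x) (j := j)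
      (L := AddMonoidAlgebra.single (-m) 1 * L) hD hx fun w hw => by
        have h2 : (AddMonoidAlgebra.single (-m) 1 : Laurent n) ∈ ordGE w 1 :=
          single_mem_ordGE 1 (by rw [dotProduct_neg, hm w hw, neg_neg])
        convert mul_mem_ordGE h2 (hL w hw) using 2
        push_cast
        ring
    refine ⟨a, ?_⟩
    rw [h1]
    funext ω
    have h3 : toField V (AddMonoidAlgebra.single (-m) 1) *
        toField V (AddMonoidAlgebra.single m 1) = 1 := by
      rw [← map_mul, AddMonoidAlgebra.single_mul_single, neg_add_cancel, mul_one]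
      exact map_one _
    rw [ha, sectionOf, sectionOf, hfL, map_mul]
    linear_combination -(formCoord (dlogBasis V) ω ^ 1 * (toField V L / toField V (dehom V D))) * h3

/-! ### Smoothness -/

/-- Polynomials in the characters `χ^(u i)`. -/
def polyToCharacters (u : Fin n → Fin n → ℤ) : MvPolynomial (Fin n) ℂ →ₐ[ℂ] Laurent n :=
  AddMonoidAlgebra.mapDomainAlgHom ℂ ℂ
    ({ toFun := fun s => ∑ i, s i • u i
       map_zero' := by simp
       map_add' := fun s t => by simp [add_smul, Finset.sum_add_distrib] } :
      (Fin n →₀ ℕ) →+ (Fin n → ℤ))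

lemma polyToCharacters_monomial (u : Fin n → Fin n → ℤ) (s : Fin n →₀ ℕ) (c : ℂ) :
    polyToCharacters u (MvPolynomial.monomial s c) =
      AddMonoidAlgebra.single (∑ i, s i • u i) c :=
  AddMonoidAlgebra.mapDomain_single

lemma polyToCharacters_X (u : Fin n → Fin n → ℤ) (i : Fin n) :
    polyToCharacters u (MvPolynomial.X i) = AddMonoidAlgebra.single (u i) 1 := by
  rw [MvPolynomial.X, polyToCharacters_monomial]
  congr 1
  rw [Finset.sum_eq_single i]
  · simp
  · intro j _ hj
    simp [Finsupp.single_eq_of_ne hj]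
  · simp

section Dual

variable {u v : Fin n → Fin n → ℤ}

lemma dotProduct_sum_smul_dual
    (huv : ∀ i j, v i ⬝ᵥ u j = if i = j then 1 else 0)
    (s : Fin n → ℕ) (i : Fin n) : v i ⬝ᵥ ∑ j, s j • u j = s i := by
  rw [dotProduct_sum]
  simp only [dotProduct_smul, huv]
  simp

lemma polyToCharacters_injective
    (huv : ∀ i j, v i ⬝ᵥ u j = if i = j then 1 else 0) :
    Function.Injective (polyToCharacters u) := by
  refine AddMonoidAlgebra.mapDomain_injective (fun s t h => Finsupp.ext fun i => ?_)
  have h1 := congrArg (fun m => v i ⬝ᵥ m) h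
  have h2 := (dotProduct_sum_smul_dual huv s i).symm.trans
    (h1.trans (dotProduct_sum_smul_dual huv t i))
  exact_mod_cast h2

lemma polyToCharacters_mem_ordGE
    (huv : ∀ i j, v i ⬝ᵥ u j = if i = j then 1 else 0)
    (p : MvPolynomial (Fin n) ℂ) (i : Fin n) :
    polyToCharacters u p ∈ ordGE (v i) 0 := by
  induction p using MvPolynomial.induction_on'' with
  | C a =>
    rw [MvPolynomial.C_apply, polyToCharacters_monomial]
    exact single_mem_ordGE a (by rw [dotProduct_sum_smul_dual huv]; simp)
  | monomial_add s a p _ _ hp _ =>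
    rw [map_add, polyToCharacters_monomial]
    exact add_mem (single_mem_ordGE a (by rw [dotProduct_sum_smul_dual huv]; simp)) hp
  | mul_X p i hp =>
    rw [map_mul, polyToCharacters_X]
    exact mul_mem_ordGE (k := 0) (l := 0) hp (single_mem_ordGE 1 (by rw [huv]; split_ifs <;> simp))

lemma exists_polyToCharacters (hm : ∀ m, ∑ i, (v i ⬝ᵥ m) • u i = m) {g : Laurent n}
    (hg : ∀ i, g ∈ ordGE (v i) 0) : ∃ p, polyToCharacters u p = g := by
  rw [← AlgHom.mem_range, eq_sum_single g]
  refine Subalgebra.sum_mem _ fun m hms => ?_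
  refine ⟨MvPolynomial.monomial (Finsupp.equivFunOnFinite.symm fun i => (v i ⬝ᵥ m).toNat)
    (g.coeff m), ?_⟩
  refine (polyToCharacters_monomial _ _ _).trans ?_
  congr 1
  conv_rhs => rw [← hm m]
  refine Finset.sum_congr rfl fun i _ => ?_
  rw [Finsupp.equivFunOnFinite_symm_apply_apply, ← natCast_zsmul,
    Int.toNat_of_nonneg (hg i m (Finsupp.mem_support_iff.mp hms))]

/-- A smoothness criterion for rings of Laurent polynomials. -/
lemma smooth_of_range_eq (huv : ∀ i j, v i ⬝ᵥ u j = if i = j then 1 else 0)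
    (hm : ∀ m, ∑ i, (v i ⬝ᵥ m) • u i = m) (I : Finset (Fin n))
    {R : Type} [CommRing R] (θ : R →+* Laurent n) (hθ : Function.Injective θ)
    (hrange : ∀ g, g ∈ θ.range ↔ ∀ i ∈ I, g ∈ ordGE (v i) 0) (φ : ℂ →+* R)
    (hφ : θ.comp φ = algebraMap ℂ (Laurent n)) : φ.Smooth := by
  classical
  have hmem : ∀ p, polyToCharacters u p ∈ θ.range := fun p =>
    (hrange _).mpr fun i _ => polyToCharacters_mem_ordGE huv p i
  let e : R ≃+* θ.range := RingEquiv.ofBijective θ.rangeRestrict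
    ⟨fun a b h => hθ (congrArg Subtype.val h), θ.rangeRestrict_surjective⟩
  let β : MvPolynomial (Fin n) ℂ →+* R :=
    (e.symm : θ.range →+* R).comp ((polyToCharacters u : _ →+* Laurent n).codRestrict _ hmem)
  have hβ : ∀ p, θ (β p) = polyToCharacters u p := fun p =>
    congrArg Subtype.val (e.apply_symm_apply ⟨polyToCharacters u p, hmem p⟩)
  have hcomp : φ = β.comp (algebraMap ℂ (MvPolynomial (Fin n) ℂ)) := by
    refine RingHom.ext fun c => hθ ?_
    rw [RingHom.comp_apply, hβ, AlgHom.commutes, ← hφ, RingHom.comp_apply]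
  rw [hcomp]
  refine (RingHom.smooth_algebraMap.mpr ⟨inferInstance, inferInstance⟩).comp ?_
  let := β.toAlgebra
  -- The variables outside `I` are exactly those allowed negative exponents, so `R` is the
  -- polynomial ring with their product `r` inverted, and a localization at one element is smooth.
  let r : MvPolynomial (Fin n) ℂ := ∏ i ∈ Iᶜ, MvPolynomial.X i
  have hr : polyToCharacters u r = AddMonoidAlgebra.single (∑ i ∈ Iᶜ, u i) 1 := by
    rw [map_prod]
    simp only [polyToCharacters_X]
    induction Iᶜ using Finset.induction_on with
    | empty => rfl
    | insert i s hi ih =>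
      rw [Finset.prod_insert hi, ih, Finset.sum_insert hi, AddMonoidAlgebra.single_mul_single,
        one_mul]
  have hvr : ∀ i, v i ⬝ᵥ ∑ j ∈ Iᶜ, u j = if i ∈ I then 0 else 1 := by
    intro i
    rw [dotProduct_sum]
    simp [huv]
  have hloc : IsLocalization.Away r R := by
    refine (isLocalization_iff _ _).mpr ⟨?_, ?_, ?_⟩
    · rintro ⟨_, k, rfl⟩
      change IsUnit (β (r ^ k))
      rw [map_pow]
      refine IsUnit.pow _ ?_
      obtain ⟨a, ha⟩ : AddMonoidAlgebra.single (-∑ i ∈ Iᶜ, u i) 1 ∈ θ.range :=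
        (hrange _).mpr fun i hi => single_mem_ordGE 1 (by
          rw [dotProduct_neg, hvr, if_pos hi, neg_zero])
      refine IsUnit.of_mul_eq_one a (hθ ?_)
      rw [map_mul, hβ, hr, ha, AddMonoidAlgebra.single_mul_single, add_neg_cancel, one_mul,
        map_one]
      rfl
    · intro z
      obtain ⟨k, hk⟩ : ∃ k : ℕ, ∀ i, θ z * AddMonoidAlgebra.single (k • ∑ i ∈ Iᶜ, u i) 1 ∈
          ordGE (v i) 0 := by
        refine ⟨∑ m ∈ (θ z).coeff.support, ∑ i, (v i ⬝ᵥ m).natAbs, fun i => ?_⟩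
        by_cases hi : i ∈ I
        · refine mul_mem_ordGE (k := 0) (l := 0) ((hrange _).mp ⟨z, rfl⟩ i hi)
            (single_mem_ordGE 1 ?_)
          rw [dotProduct_smul, hvr, if_pos hi, smul_zero]
        · set k := ∑ m ∈ (θ z).coeff.support, ∑ i, (v i ⬝ᵥ m).natAbs with hk
          have h1 : θ z ∈ ordGE (v i) (-k) := by
            intro m hm
            have h2 := Finset.single_le_sum (f := fun i => (v i ⬝ᵥ m).natAbs)
              (fun _ _ => Nat.zero_le _) (Finset.mem_univ i)
            have h3 := Finset.single_le_sum (f := fun m => ∑ i, (v i ⬝ᵥ m).natAbs)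
              (fun _ _ => Nat.zero_le _) (Finsupp.mem_support_iff.mpr hm)
            omega
          convert mul_mem_ordGE h1 (single_mem_ordGE (k := k) 1 ?_) using 2
          · ring
          · rw [dotProduct_smul, hvr, if_neg hi]
            simp
      obtain ⟨p, hp⟩ := exists_polyToCharacters hm hk
      refine ⟨(p, ⟨r ^ k, k, rfl⟩), hθ ?_⟩
      change θ (z * β (r ^ k)) = θ (β p)
      rw [map_mul, hβ, hβ, hp, map_pow, hr, AddMonoidAlgebra.single_pow, one_pow]
    · intro p q h
      refine ⟨1, ?_⟩
      have h1 := congrArg θ (show β p = β q from h)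
      rw [hβ, hβ] at h1
      rw [polyToCharacters_injective huv h1]
  exact RingHom.Smooth.holdsForLocalizationAway R r

end Dual

/-- The coordinate ring of a standard affine chart consists of Laurent polynomials. -/
lemma exists_chart (x : toricVariety V) : ∃ (i : ℕ) (q : coneRing V), 0 < i ∧
    q ∈ coneGrading V i ∧ q ∉ primeOf x ∧
    ∃ θ : HomogeneousLocalization.Away (coneGrading V) q →+* Laurent n, Function.Injective θ ∧
      (∀ g, g ∈ θ.range ↔ ∀ v ∈ facetSet x, g ∈ ordGE v 0) ∧
      ∀ c : ℂ, θ (HomogeneousLocalization.fromZeroRingHom (coneGrading V) _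
        (algebraMap ℂ (coneGrading V 0) c)) = algebraMap ℂ (Laurent n) c := by
  obtain ⟨b, i, h, hi, hbx, hb⟩ := exists_witness x
  set q := coneMonomial b i h with hq
  have hqi : q ∈ coneGrading V i := coneMonomial_mem _ _ _
  have hdq : ∀ e : ℕ, dehom V (q ^ e) = AddMonoidAlgebra.single (e • b) 1 := by
    intro e
    rw [map_pow, hq, dehom_coneMonomial, AddMonoidAlgebra.single_pow, one_pow]
  have hinv : ∀ e : ℕ,
      (AddMonoidAlgebra.single (-(e • b)) 1 : Laurent n) * dehom V (q ^ e) = 1 := by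
    intro e
    rw [hdq, AddMonoidAlgebra.single_mul_single, neg_add_cancel, one_mul]
    rfl
  have hunit : ∀ y : Submonoid.powers q, IsUnit ((dehom V : coneRing V →+* Laurent n) y) := by
    rintro ⟨_, e, rfl⟩
    exact IsUnit.of_mul_eq_one _ ((mul_comm _ _).trans (hinv e))
  let θ : HomogeneousLocalization.Away (coneGrading V) q →+* Laurent n :=
    (IsLocalization.lift (M := Submonoid.powers q) (S := Localization (Submonoid.powers q))
      hunit).comp (algebraMap _ (Localization (Submonoid.powers q)))
  have hθ : ∀ (e : ℕ) (N : coneRing V) (hN : N ∈ coneGrading V (e • i)),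
      θ (HomogeneousLocalization.Away.mk _ hqi e N hN) =
        AddMonoidAlgebra.single (-(e • b)) 1 * dehom V N := by
    intro e N hN
    change IsLocalization.lift (M := Submonoid.powers q) hunit
      (Localization.mk N (⟨q ^ e, e, rfl⟩ : Submonoid.powers q)) = _
    rw [Localization.mk_eq_mk', IsLocalization.lift_mk'_spec]
    change dehom V N = dehom V (q ^ e) * _
    rw [← mul_assoc, mul_comm (dehom V _), hinv, one_mul]
  refine ⟨i, q, hi, hqi, hbx, θ, ?_, fun g => ⟨?_, fun hg => ?_⟩, fun c => ?_⟩
  · rw [injective_iff_map_eq_zero]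
    intro z hz
    obtain ⟨e, N, hN, rfl⟩ := HomogeneousLocalization.Away.mk_surjective _ hqi z
    rw [hθ] at hz
    have h1 : dehom V N = 0 := by
      rw [← one_mul (dehom V N), ← hinv e, mul_right_comm, hz, zero_mul]
    have h2 : N = 0 := by
      by_contra h0
      exact dehom_ne_zero hN h0 h1
    subst h2
    refine HomogeneousLocalization.val_injective _ ?_
    rw [HomogeneousLocalization.Away.val_mk, Localization.mk_zero, HomogeneousLocalization.val_zero]
  · rintro ⟨z, rfl⟩ v hv
    obtain ⟨e, N, hN, rfl⟩ := HomogeneousLocalization.Away.mk_surjective _ hqi z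
    rw [hθ]
    convert mul_mem_ordGE (single_mem_ordGE (k := (e • i : ℕ)) 1 ?_)
      (dehom_mem_ordGE hN (mem_of_mem_facetSet hv)) using 2
    · ring
    · rw [dotProduct_neg, dotProduct_smul, dotProduct_of_mem_facetSet hv h hbx]
      simp
  · obtain ⟨e, N, hN, hNg⟩ := exists_homogeneous_mul (j := 0) h hbx hb (L := g) (by simpa using hg)
    refine ⟨HomogeneousLocalization.Away.mk _ hqi e N hN, ?_⟩
    rw [hθ, hNg, ← mul_assoc, AddMonoidAlgebra.single_mul_single, neg_add_cancel, one_mul]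
    exact one_mul g
  · have h1 : algebraMap ℂ (coneRing V) c ∈ coneGrading V (0 • i) := by
      rw [zero_smul]
      exact (algebraMap ℂ (coneGrading V 0) c).2
    have h2 : HomogeneousLocalization.fromZeroRingHom (coneGrading V) (Submonoid.powers q)
        (algebraMap ℂ (coneGrading V 0) c) =
        HomogeneousLocalization.Away.mk _ hqi 0 (algebraMap ℂ (coneRing V) c) h1 := by
      refine HomogeneousLocalization.val_injective _ ?_
      rw [HomogeneousLocalization.Away.val_mk]
      change Localization.mk _ _ = _
      congr 1
    rw [h2, hθ, AlgHom.commutes, zero_smul, neg_zero]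
    exact one_mul _

/-- Unimodular simplicial toric varieties are smooth. -/
lemma IsUnimodular.isNonsingular (hU : IsUnimodular V) (hV : IsFanoPolytope V)
    (hS : ∀ x : toricVariety V, LinearIndepOn ℝ toReal (facetSet x : Set (Fin n → ℤ))) :
    IsNonsingular (toricVariety V) := by
  choose i q hi hqi hqx hθ using fun x : toricVariety V => exists_chart x
  have : IsZariskiLocalAtSource (@AlgebraicGeometry.Smooth.{0}) :=
    HasRingHomProperty.instIsZariskiLocalAtSource
  refine IsZariskiLocalAtSource.of_iSup_eq_top (P := @Smooth.{0}) (X := Proj (coneGrading V))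
    (fun x => Proj.basicOpen (coneGrading V) (q x)) ?_ fun x => ?_
  · refine top_le_iff.mp fun x _ => TopologicalSpace.Opens.mem_iSup.mpr ⟨x, ?_⟩
    rw [Proj.mem_basicOpen]
    exact hqx x
  · obtain ⟨v, I, hvV, hdet, hli, hvS, hspan, hmem⟩ :=
      hV.exists_adapted_basis (S := facetSet x) fun _ => mem_of_mem_facetSet
    obtain ⟨u, hu, hm⟩ := exists_dual_basis (hU.isUnit_det hvV hdet)
    obtain ⟨θ, hinj, hrange, hc⟩ := hθ x
    -- Unimodularity makes the vertices of the cone part of a lattice basis, and independence of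
    -- `facetSet x` ensures that all of them occur among the `v i` with `i ∈ I`.
    have hsm := smooth_of_range_eq hu hm I θ hinj (fun g => by
      rw [hrange]
      constructor
      · exact fun h i hi => h _ (hvS i hi)
      · intro h w hw
        obtain ⟨i, hi, rfl⟩ := hmem (hS x) w hw
        exact h i hi) ((HomogeneousLocalization.fromZeroRingHom (coneGrading V) _).comp
          (algebraMap ℂ (coneGrading V 0))) (RingHom.ext hc)
    have h1 : Smooth (Spec.map (CommRingCat.ofHom
        ((HomogeneousLocalization.fromZeroRingHom (coneGrading V) (Submonoid.powers (q x))).comp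
          (algebraMap ℂ (coneGrading V 0))))) :=
      (HasRingHomProperty.Spec_iff (P := @Smooth)).mpr hsm
    have h2 : (Proj.basicOpen (coneGrading V) (q x)).ι ≫ (toricVariety V ↘ Spec (.of ℂ)) =
        (Proj.basicOpenIsoSpec (coneGrading V) (q x) (hqi x) (hi x)).hom ≫ Spec.map
          (CommRingCat.ofHom ((HomogeneousLocalization.fromZeroRingHom (coneGrading V)
            (Submonoid.powers (q x))).comp (algebraMap ℂ (coneGrading V 0)))) := by
      rw [← Iso.inv_comp_eq, CommRingCat.ofHom_comp, Spec.map_comp,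
        ← Proj.awayι_toSpecZero _ _ (hqi x) (hi x)]
      rfl
    rw [h2]
    infer_instance

/-! ### Local rings at the generic points of divisors -/

lemma single_notMem_ordGE {v m : Fin n → ℤ} {k : ℤ} (h : v ⬝ᵥ m < k) :
    (AddMonoidAlgebra.single m 1 : Laurent n) ∉ ordGE v k := by
  intro h1
  have := h1 m (by simp)
  omega

lemma toField_single_ne_zero (V : Finset (Fin n → ℤ)) (m : Fin n → ℤ) :
    toField V (AddMonoidAlgebra.single m 1) ≠ 0 := by
  rw [Ne, map_eq_zero_iff _ (toField_injective V), AddMonoidAlgebra.single_eq_zero]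
  exact one_ne_zero

lemma algebraMap_stalkSpecializes {x y : toricVariety V} (h : x ⤳ y)
    (a : (toricVariety V).presheaf.stalk y) :
    algebraMap _ (toricVariety V).functionField
      (((toricVariety V).presheaf.stalkSpecializes h).hom a) = algebraMap _ _ a := by
  obtain ⟨j, N, D, hD, rfl⟩ := exists_stalkFrac y a
  have hD' : D.1 ∉ primeOf x := fun hx => hD (primeOf_le_of_specializes h hx)
  rw [stalkFrac_specializes h N D hD hD', algebraMap_stalkFrac_eq, algebraMap_stalkFrac_eq]

/-- `ξ` is the generic point of the divisor of the vertex `v`. -/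
structure IsDivisorPoint (v : Fin n → ℤ) (ξ : toricVariety V) : Prop where
  facetSet_eq : facetSet ξ = {v}
  mem_primeOf_iff : ∀ j, ∀ N ∈ coneGrading V j, (N ∈ primeOf ξ ↔ dehom V N ∈ ordGE v (-j + 1))

namespace IsDivisorPoint

variable {v : Fin n → ℤ} {ξ : toricVariety V}

lemma mem_facetSet (hξ : IsDivisorPoint v ξ) : v ∈ facetSet ξ := by
  rw [hξ.facetSet_eq]
  exact Finset.mem_singleton_self v

lemma mem_range_stalk (hξ : IsDivisorPoint v ξ) {j : ℕ} {L : Laurent n} {D : coneRing V}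
    (hD : D ∈ coneGrading V j) (hx : D ∉ primeOf ξ) (hL : L ∈ ordGE v (-j)) :
    ∃ a, algebraMap ((toricVariety V).presheaf.stalk ξ) (toricVariety V).functionField a =
      toField V L / toField V (dehom V D) := by
  refine mem_range_stalk_of_ordGE hD hx fun w hw => ?_
  rw [hξ.facetSet_eq, Finset.mem_singleton] at hw
  rwa [hw]

/-- After multiplication by a power of a monomial that does not vanish at `ξ`, the numerator is
homogeneous, and order zero of the quotient means that the new numerator does not vanish at `ξ`
either. So the inverse fraction is regular. -/
lemma isUnit (hξ : IsDivisorPoint v ξ) {j : ℕ} {L : Laurent n} {D : coneRing V}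
    (hD : D ∈ coneGrading V j) (hx : D ∉ primeOf ξ) (hL : L ∈ ordGE v (-j))
    (hL' : L ∉ ordGE v (-j + 1)) {a : (toricVariety V).presheaf.stalk ξ}
    (ha : algebraMap _ (toricVariety V).functionField a =
      toField V L / toField V (dehom V D)) : IsUnit a := by
  obtain ⟨b, i, h, hi, hbx, hb⟩ := exists_witness ξ
  obtain ⟨e, N, hN, hNL⟩ := exists_homogeneous_mul (L := L) (j := j) h hbx hb (fun w hw => by
    rw [hξ.facetSet_eq, Finset.mem_singleton] at hw
    rwa [hw])
  have hvb : v ⬝ᵥ (e • b) = -(e * i : ℕ) := by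
    rw [dotProduct_smul, dotProduct_of_mem_facetSet hξ.mem_facetSet h hbx]
    simp
  have hNξ : N ∉ primeOf ξ := by
    rw [hξ.mem_primeOf_iff _ _ hN, hNL]
    convert mul_notMem_ordGE (single_mem_ordGE 1 hvb.ge) hL
      (single_notMem_ordGE (by rw [hvb]; omega)) hL' using 3
    push_cast
    ring
  have hE : coneMonomial b i h ^ e * D ∈ coneGrading V (e * i + j) :=
    SetLike.mul_mem_graded (by simpa using SetLike.pow_mem_graded e (coneMonomial_mem b i h)) hD
  refine IsUnit.of_mul_eq_one (stalkFrac ξ ⟨_, hE⟩ ⟨N, hN⟩ hNξ) (stalk_algebraMap_injective ξ ?_)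
  rw [map_mul, ha, algebraMap_stalkFrac_eq, map_one, map_mul, map_pow, dehom_coneMonomial,
    AddMonoidAlgebra.single_pow, one_pow, hNL, map_mul, map_mul]
  have h1 := toField_single_ne_zero V (e • b)
  have h2 := toField_dehom_ne_zero hD (ne_zero_of_notMem_primeOf hx)
  have h3 : toField V L ≠ 0 := by
    rw [Ne, map_eq_zero_iff _ (toField_injective V)]
    rintro rfl
    exact hL' (zero_mem _)
  field_simp

lemma not_isUnit (hξ : IsDivisorPoint v ξ) {L : Laurent n} (hL : L ∈ ordGE v 1)
    {a : (toricVariety V).presheaf.stalk ξ}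
    (ha : algebraMap _ (toricVariety V).functionField a = toField V L) : ¬ IsUnit a := by
  intro h
  obtain ⟨c, hc⟩ := h.exists_right_inv
  have h1 := ordGE_of_mem_range_stalk hξ.mem_facetSet (f := algebraMap _ _ c) ⟨c, rfl⟩ (a := 1) hL
    (by rw [← ha, ← map_mul, mul_comm, hc, map_one, map_one])
  exact single_notMem_ordGE (m := 0) (by simp) h1

/-- The monomial `χ^u` has order one along the divisor, and dividing a function of order `k` by its
`k`-th power leaves a unit. Hence it is a uniformizer. -/
lemma exists_irreducible (hξ : IsDivisorPoint v ξ) {u : Fin n → ℤ} (hu : v ⬝ᵥ u = 1) :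
    ∃ ϖ : (toricVariety V).presheaf.stalk ξ, Irreducible ϖ ∧
      algebraMap _ (toricVariety V).functionField ϖ = toField V (AddMonoidAlgebra.single u 1) ∧
      IsDiscreteValuationRing ((toricVariety V).presheaf.stalk ξ) := by
  obtain ⟨ϖ, hϖ⟩ := hξ.mem_range_stalk (j := 0) (L := AddMonoidAlgebra.single u 1)
    SetLike.GradedOne.one_mem (one_notMem_primeOf ξ) (single_mem_ordGE 1 (by rw [hu]; simp))
  rw [map_one, map_one, div_one] at hϖ
  have hnu : ¬ IsUnit ϖ := hξ.not_isUnit (single_mem_ordGE 1 hu.ge) hϖ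
  have hϖ0 : ϖ ≠ 0 := by
    rintro rfl
    rw [map_zero] at hϖ
    exact toField_single_ne_zero V u hϖ.symm
  have hfac : ∀ a : (toricVariety V).presheaf.stalk ξ, a ≠ 0 →
      ∃ k : ℕ, Associated (ϖ ^ k) a := by
    intro a ha
    obtain ⟨j, N, D, hD, rfl⟩ := exists_stalkFrac ξ a
    have hN0 : N.1 ≠ 0 := by
      intro h
      refine ha (stalk_algebraMap_injective ξ ?_)
      rw [algebraMap_stalkFrac_eq, h, map_zero, map_zero, zero_div, map_zero]
    obtain ⟨o, ho, ho'⟩ := exists_ord (v := v) (dehom_ne_zero N.2 hN0)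
    have hoj : 0 ≤ o + j := by
      by_contra! h
      exact ho' (ordGE_mono (by omega) (dehom_mem_ordGE N.2 (mem_of_mem_facetSet hξ.mem_facetSet)))
    lift o + j to ℕ using hoj with k hk
    have hku : v ⬝ᵥ (-(k • u)) = -k := by
      rw [dotProduct_neg, dotProduct_smul, hu]
      simp
    have hL : AddMonoidAlgebra.single (-(k • u)) 1 * dehom V N.1 ∈ ordGE v (-j) := by
      convert mul_mem_ordGE (single_mem_ordGE 1 hku.ge) ho using 2
      omega
    have hL' : AddMonoidAlgebra.single (-(k • u)) 1 * dehom V N.1 ∉ ordGE v (-j + 1) := by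
      convert mul_notMem_ordGE (single_mem_ordGE 1 hku.ge) ho
        (single_notMem_ordGE (by rw [hku]; omega)) ho' using 3
      omega
    obtain ⟨c, hc⟩ := hξ.mem_range_stalk D.2 hD hL
    obtain ⟨c', hc'⟩ := hξ.isUnit D.2 hD hL hL' hc
    refine ⟨k, c', stalk_algebraMap_injective ξ ?_⟩
    rw [hc', map_mul, map_pow, hϖ, hc, algebraMap_stalkFrac_eq, ← mul_div_assoc, ← map_pow,
      ← map_mul, AddMonoidAlgebra.single_pow, one_pow, ← mul_assoc,
      AddMonoidAlgebra.single_mul_single, add_neg_cancel, one_mul]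
    rw [show (AddMonoidAlgebra.single 0 1 : Laurent n) = 1 from rfl, one_mul]
  have hirr : Irreducible ϖ := by
    refine ⟨hnu, fun a b hab => ?_⟩
    by_contra! hcon
    have ha0 : a ≠ 0 := by
      rintro rfl
      exact hϖ0 (by rw [hab, zero_mul])
    have hb0 : b ≠ 0 := by
      rintro rfl
      exact hϖ0 (by rw [hab, mul_zero])
    have hdvd : ∀ a : (toricVariety V).presheaf.stalk ξ, a ≠ 0 → ¬ IsUnit a → ϖ ∣ a := by
      intro a ha hau
      obtain ⟨k, hk⟩ := hfac a ha
      rcases k with _ | k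
      · rw [pow_zero] at hk
        exact (hau (hk.isUnit isUnit_one)).elim
      · exact (dvd_pow_self ϖ k.succ_ne_zero).trans hk.dvd
    obtain ⟨a', rfl⟩ := hdvd a ha0 hcon.1
    obtain ⟨b', rfl⟩ := hdvd b hb0 hcon.2
    refine hnu (IsUnit.of_mul_eq_one (a' * b') (mul_left_cancel₀ hϖ0 ?_))
    rw [mul_one]
    conv_rhs => rw [hab]
    ring
  exact ⟨ϖ, hirr, hϖ, IsDiscreteValuationRing.ofHasUnitMulPowIrreducibleFactorization
    ⟨ϖ, hirr, fun {a} ha => hfac a ha⟩⟩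

lemma specializes (hξ : IsDivisorPoint v ξ) {x : toricVariety V} (hv : v ∈ facetSet x) :
    ξ ⤳ x := by
  classical
  refine specializes_of_primeOf_le fun f hf => ?_
  rw [← DirectSum.sum_support_decompose (coneGrading V) f]
  refine Ideal.sum_mem _ fun i _ => ?_
  have h1 : (DirectSum.decompose (coneGrading V) f i : coneRing V) ∈ primeOf ξ :=
    HomogeneousIdeal.isHomogeneous (ProjectiveSpectrum.asHomogeneousIdeal (𝒜 := coneGrading V) ξ)
      i hf
  have hi := (DirectSum.decompose (coneGrading V) f i).2
  by_contra hx
  exact dehom_notMem_ordGE hv hi hx ((hξ.mem_primeOf_iff i _ hi).mp h1)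

/-- The functions regular at `x` that vanish to order at least `k` along a divisor. -/
lemma mem_comap_pow_iff (hV : IsFanoPolytope V) (hξ : IsDivisorPoint v ξ) {x : toricVariety V}
    (h : ξ ⤳ x) (k : ℕ)
    {j : ℕ} {L : Laurent n} {D : coneRing V} (hD : D ∈ coneGrading V j) (hx : D ∉ primeOf x)
    {a : (toricVariety V).presheaf.stalk x} (ha : algebraMap _ (toricVariety V).functionField a =
      toField V L / toField V (dehom V D)) :
    a ∈ ((IsLocalRing.maximalIdeal ((toricVariety V).presheaf.stalk ξ)) ^ k).comap
        ((toricVariety V).presheaf.stalkSpecializes h).hom ↔ L ∈ ordGE v (k - j) := by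
  obtain ⟨u, hu⟩ := hV.exists_dotProduct_eq_one (mem_of_mem_facetSet hξ.mem_facetSet)
  obtain ⟨ϖ, hirr, hϖ, hdvr⟩ := hξ.exists_irreducible hu
  have hDξ : D ∉ primeOf ξ := fun h' => hx (primeOf_le_of_specializes h h')
  have hD0 := toField_dehom_ne_zero hD (ne_zero_of_notMem_primeOf hx)
  rw [Ideal.mem_comap, hirr.maximalIdeal_eq, Ideal.span_singleton_pow,
    Ideal.mem_span_singleton]
  have hϖk : algebraMap _ (toricVariety V).functionField (ϖ ^ k) =
      toField V (AddMonoidAlgebra.single (k • u) 1) := by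
    rw [map_pow, hϖ, ← map_pow, AddMonoidAlgebra.single_pow, one_pow]
  have hku : v ⬝ᵥ (k • u) = k := by
    rw [dotProduct_smul, hu]
    simp
  constructor
  · rintro ⟨c, hc⟩
    have h1 := congrArg (algebraMap _ (toricVariety V).functionField) hc
    rw [algebraMap_stalkSpecializes, ha, map_mul, hϖk, div_eq_iff hD0] at h1
    refine ordGE_of_mem_range_stalk hξ.mem_facetSet (f := algebraMap _ _ c) ⟨c, rfl⟩
      (b := AddMonoidAlgebra.single (k • u) 1 * dehom V D) ?_ ?_
    · convert mul_mem_ordGE (single_mem_ordGE 1 hku.ge)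
        (dehom_mem_ordGE hD (mem_of_mem_facetSet hξ.mem_facetSet)) using 2
      ring
    · rw [h1, map_mul]
      ring
  · intro hL
    obtain ⟨c, hc⟩ := hξ.mem_range_stalk hD hDξ
      (L := AddMonoidAlgebra.single (-(k • u)) 1 * L) (by
        convert mul_mem_ordGE (single_mem_ordGE 1
          (show -(k : ℤ) ≤ v ⬝ᵥ (-(k • u)) by rw [dotProduct_neg, hku])) hL using 2
        ring)
    refine ⟨c, stalk_algebraMap_injective ξ ?_⟩
    rw [algebraMap_stalkSpecializes, ha, map_mul, hϖk, hc, ← mul_div_assoc, ← map_mul, ← mul_assoc,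
      AddMonoidAlgebra.single_mul_single, add_neg_cancel, one_mul,
      show (AddMonoidAlgebra.single 0 1 : Laurent n) = 1 from rfl, one_mul]

end IsDivisorPoint

lemma IsFanoPolytope.exists_isDivisorPoint (hV : IsFanoPolytope V) {v : Fin n → ℤ} (hv : v ∈ V) :
    ∃ ξ : toricVariety V, IsDivisorPoint v ξ := by
  obtain ⟨ξ, h1, h2⟩ := hV.exists_divisor_point hv
  exact ⟨ξ, h1, h2⟩

/-! ### The divisors through a point of a `ℚ`-factorial toric variety -/

/-- The quotients `t m / s` add up to one, and in a local ring one of them must be a unit. This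
replaces the generator of a monomial ideal by a monomial. -/
lemma exists_isUnit_of_sum_mul {R ι : Type*} [CommRing R] [IsDomain R] [IsLocalRing R]
    {S : Finset ι} {s : R} {t : ι → R} (hs : s ≠ 0) (ht : ∀ m ∈ S, s ∣ t m)
    (hsum : s = ∑ m ∈ S, t m) : ∃ m ∈ S, t m ∣ s := by
  choose! a ha using ht
  have h1 : ∑ m ∈ S, a m = 1 := by
    refine mul_left_cancel₀ hs ?_
    rw [Finset.mul_sum, mul_one]
    conv_rhs => rw [hsum]
    exact Finset.sum_congr rfl fun m hm => (ha m hm).symm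
  obtain ⟨m, hm, hu⟩ : ∃ m ∈ S, IsUnit (a m) := by
    by_contra! hcon
    have h2 : ∑ m ∈ S, a m ∈ IsLocalRing.maximalIdeal R :=
      Ideal.sum_mem _ fun m hm => (IsLocalRing.mem_maximalIdeal _).mpr (hcon m hm)
    rw [h1] at h2
    exact (IsLocalRing.mem_maximalIdeal _).mp h2 isUnit_one
  refine ⟨m, hm, ?_⟩
  rw [ha m hm]
  obtain ⟨c, hc⟩ := hu.exists_right_inv
  exact ⟨c, by rw [mul_assoc, hc, mul_one]⟩

/-- If a multiple of the divisor of `v` is Cartier, then `v` is separated by a linear form from the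
other vertices of the cone. -/
lemma IsFanoPolytope.exists_dotProduct_eq_zero (hV : IsFanoPolytope V)
    (hQ : IsQFactorial (toricVariety V)) {x : toricVariety V} {v : Fin n → ℤ}
    (hv : v ∈ facetSet x) :
    ∃ p : Fin n → ℤ, 0 < v ⬝ᵥ p ∧ ∀ v' ∈ facetSet x, v' ≠ v → v' ⬝ᵥ p = 0 := by
  obtain ⟨ξ, hξ⟩ := hV.exists_isDivisorPoint (mem_of_mem_facetSet hv)
  obtain ⟨u, hu⟩ := hV.exists_dotProduct_eq_one (mem_of_mem_facetSet hv)
  obtain ⟨-, -, -, hdvr⟩ := hξ.exists_irreducible hu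
  -- A discrete valuation ring has Krull dimension one, so the condition of `ℚ`-factoriality applies
  -- to `ξ`.
  obtain ⟨k, hk, hprin⟩ := hQ ξ (IsDiscreteValuationRing.ringKrullDim_eq_one _)
  have hsp := hξ.specializes hv
  obtain ⟨s, hs⟩ := (hprin x hsp).principal
  obtain ⟨j, N, D, hD, rfl⟩ := exists_stalkFrac x s
  have hsJ := (hξ.mem_comap_pow_iff hV hsp k D.2 hD (algebraMap_stalkFrac_eq x N D hD)).mp
    (by rw [hs]; exact Submodule.mem_span_singleton_self _)
  by_cases hex : ∃ v' ∈ facetSet x, v' ≠ v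
  swap
  · push Not at hex
    exact ⟨u, by omega, fun v' hv' hne => (hne (hex v' hv')).elim⟩
  -- For each other `v'` there is a monomial of order zero along `v'` that lies in the ideal of `k`
  -- times the divisor of `v`, hence is divisible by the generator.
  have hray : ∀ v' ∈ facetSet x, v' ≠ v → ∃ w : Fin n → ℤ, v' ⬝ᵥ w = 0 ∧
      ∃ a : (toricVariety V).presheaf.stalk x, algebraMap _ (toricVariety V).functionField a =
        toField V (AddMonoidAlgebra.single w 1) ∧ stalkFrac x N D hD ∣ a := by
    intro v' hv' hne
    obtain ⟨w, hw, hpos⟩ := hV.exists_ray hv'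
    have hkw : ∀ v'' ∈ facetSet x, 0 ≤ v'' ⬝ᵥ (k • w) := by
      intro v'' hv''
      rw [dotProduct_smul]
      by_cases h : v'' = v'
      · rw [h, hw, smul_zero]
      · exact nsmul_nonneg (hpos v'' hv'' h).le k
    obtain ⟨a, ha⟩ := mem_range_stalk_of_ordGE (j := 0) (L := AddMonoidAlgebra.single (k • w) 1)
      SetLike.GradedOne.one_mem (one_notMem_primeOf x) fun v'' hv'' =>
        single_mem_ordGE 1 (by simpa using hkw v'' hv'')
    refine ⟨k • w, by rw [dotProduct_smul, hw, smul_zero], a, ?_, ?_⟩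
    · rw [ha, map_one, map_one, div_one]
    · rw [← Ideal.mem_span_singleton]
      refine hs.le ((hξ.mem_comap_pow_iff hV hsp k SetLike.GradedOne.one_mem
        (one_notMem_primeOf x) ha).mpr (single_mem_ordGE 1 ?_))
      rw [dotProduct_smul, nsmul_eq_mul]
      have := hpos v hv hne.symm
      have := mul_le_mul_of_nonneg_left (show 1 ≤ v ⬝ᵥ w by omega) (Int.natCast_nonneg k)
      simpa using this
  have hs0 : stalkFrac x N D hD ≠ 0 := by
    intro h0
    obtain ⟨v', hv', hne⟩ := hex
    obtain ⟨w, -, a, ha, hdvd⟩ := hray v' hv' hne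
    rw [h0, zero_dvd_iff] at hdvd
    rw [hdvd, map_zero] at ha
    exact toField_single_ne_zero V w ha.symm
  have hNord : ∀ m ∈ (dehom V N.1).coeff.support, ∀ v' ∈ facetSet x, -(j : ℤ) ≤ v' ⬝ᵥ m :=
    fun m hm v' hv' => dehom_mem_ordGE N.2 (mem_of_mem_facetSet hv') m
      (Finsupp.mem_support_iff.mp hm)
  have hterm : ∀ m ∈ (dehom V N.1).coeff.support, ∃ t : (toricVariety V).presheaf.stalk x,
      algebraMap _ (toricVariety V).functionField t =
        toField V (AddMonoidAlgebra.single m ((dehom V N.1).coeff m)) /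
          toField V (dehom V D.1) := fun m hm =>
    mem_range_stalk_of_ordGE D.2 hD fun v' hv' => single_mem_ordGE _ (hNord m hm v' hv')
  choose! t ht using hterm
  -- Membership in the ideal is tested monomial by monomial, so each term of the generator lies in
  -- the ideal, and one of these terms already generates it.
  obtain ⟨μ, hμ, hμs⟩ := exists_isUnit_of_sum_mul (S := (dehom V N.1).coeff.support) (t := t) hs0
    (fun m hm => by
      rw [← Ideal.mem_span_singleton]
      exact hs.le ((hξ.mem_comap_pow_iff hV hsp k D.2 hD (ht m hm)).mpr
        (single_mem_ordGE _ (hsJ m (Finsupp.mem_support_iff.mp hm)))))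
    (stalk_algebraMap_injective x (by
      rw [algebraMap_stalkFrac_eq, map_sum, Finset.sum_congr rfl ht, ← Finset.sum_div, ← map_sum,
        ← eq_sum_single]))
  obtain ⟨b, i, h, hi, hbx, -⟩ := exists_witness x
  -- Subtracting the multiple of `b` removes the degree of the denominator: `⟨v', p⟩` is `i` times
  -- the order along `v'` of the monomial generator.
  have hp : ∀ v' ∈ facetSet x, v' ⬝ᵥ ((i : ℤ) • μ - (j : ℤ) • b) = i * (v' ⬝ᵥ μ + j) := by
    intro v' hv'
    rw [dotProduct_sub, dotProduct_smul, dotProduct_smul, dotProduct_of_mem_facetSet hv' h hbx,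
      smul_eq_mul, smul_eq_mul]
    ring
  refine ⟨(i : ℤ) • μ - (j : ℤ) • b, ?_, fun v' hv' hne => ?_⟩
  · rw [hp v hv]
    have := hsJ μ (Finsupp.mem_support_iff.mp hμ)
    exact mul_pos (by exact_mod_cast hi) (by omega)
  · obtain ⟨w, hw, a, ha, hdvd⟩ := hray v' hv' hne
    obtain ⟨c, hc⟩ := hμs.trans hdvd
    have hD0 := toField_dehom_ne_zero D.2 (ne_zero_of_notMem_primeOf hD)
    have h1 := ordGE_of_mem_range_stalk hv' (f := algebraMap _ _ c) ⟨c, rfl⟩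
      (a := AddMonoidAlgebra.single w 1 * dehom V D.1)
      (single_mem_ordGE ((dehom V N.1).coeff μ) (le_refl (v' ⬝ᵥ μ))) (by
        rw [map_mul, ← ha, hc, map_mul, ht μ hμ]
        field_simp)
    -- The monomial `χ^w` has order zero along `v'` and is a multiple of the generator, so the
    -- generator cannot vanish there.
    have h2 := mul_notMem_ordGE (single_mem_ordGE 1 hw.ge)
      (dehom_mem_ordGE D.2 (mem_of_mem_facetSet hv')) (single_notMem_ordGE (by omega))
      (dehom_notMem_ordGE hv' D.2 hD)
    have h3 : v' ⬝ᵥ μ ≤ -j := by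
      by_contra! hlt
      exact h2 (ordGE_mono (by omega) h1)
    have h4 := hNord μ hμ v' hv'
    rw [hp v' hv', show v' ⬝ᵥ μ + j = 0 by omega, mul_zero]

lemma linearIndepOn_of_exists_dotProduct_eq_zero {S : Finset (Fin n → ℤ)}
    (h : ∀ v ∈ S, ∃ p : Fin n → ℤ, 0 < v ⬝ᵥ p ∧ ∀ v' ∈ S, v' ≠ v → v' ⬝ᵥ p = 0) :
    LinearIndepOn ℝ toReal (S : Set (Fin n → ℤ)) := by
  rw [linearIndepOn_finset_iff]
  intro c hc v hv
  obtain ⟨p, hpos, hp⟩ := h v hv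
  have h1 := congrArg (fun q => q ⬝ᵥ toReal p) hc
  simp only [sum_dotProduct, smul_dotProduct, toReal_dotProduct, zero_dotProduct] at h1
  rw [Finset.sum_eq_single v (fun v' hv' hne => by rw [hp v' hv' hne, Int.cast_zero, smul_zero])
    (fun h => (h hv).elim), smul_eq_mul] at h1
  exact (mul_eq_zero.mp h1).resolve_right (by exact_mod_cast hpos.ne')

/-- The cones of a fan in the plane are simplicial. -/
lemma IsFanoPolytope.exists_dotProduct_eq_zero_of_plane {V : Finset (Fin 2 → ℤ)}
    (hV : IsFanoPolytope V) {x : toricVariety V} {v : Fin 2 → ℤ} (hv : v ∈ facetSet x) :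
    ∃ p : Fin 2 → ℤ, 0 < v ⬝ᵥ p ∧ ∀ v' ∈ facetSet x, v' ≠ v → v' ⬝ᵥ p = 0 := by
  by_cases hex : ∃ v' ∈ facetSet x, v' ≠ v
  swap
  · obtain ⟨u, hu⟩ := hV.exists_dotProduct_eq_one (mem_of_mem_facetSet hv)
    push Not at hex
    exact ⟨u, by omega, fun v' hv' hne => (hne (hex v' hv')).elim⟩
  -- The ray of `a` is extremal, so the other vertices of the cone lie strictly on one side of its
  -- line, and their cross products with `a` have equal signs.
  have hcross : ∀ a ∈ facetSet x, ∀ b ∈ facetSet x, ∀ c ∈ facetSet x, b ≠ a → c ≠ a →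
      0 < (a 0 * b 1 - a 1 * b 0) * (a 0 * c 1 - a 1 * c 0) := by
    intro a ha b hb c hc hba hca
    obtain ⟨w, hw, hpos⟩ := hV.exists_ray ha
    have hb' := hpos b hb hba
    have hc' := hpos c hc hca
    rw [dotProduct, Fin.sum_univ_two] at hw hb' hc'
    have ha0 : 0 < a 0 ^ 2 + a 1 ^ 2 := by
      have h0 : a 0 ≠ 0 ∨ a 1 ≠ 0 := by
        by_contra! h
        refine hV.ne_zero (mem_of_mem_facetSet ha) (funext fun i => ?_)
        fin_cases i
        exacts [h.1, h.2]
      rcases h0 with h0 | h0 <;> positivity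
    have key : ∀ d : Fin 2 → ℤ, (a 0 * d 1 - a 1 * d 0) * (a 0 * w 1 - a 1 * w 0) =
        (a 0 ^ 2 + a 1 ^ 2) * (d 0 * w 0 + d 1 * w 1) := by
      intro d
      linear_combination -(a 0 * d 0 + a 1 * d 1) * hw
    have h1 := mul_pos (mul_pos ha0 hb') (mul_pos ha0 hc')
    rw [← key, ← key] at h1
    have h2 : 0 ≤ (a 0 * w 1 - a 1 * w 0) ^ 2 := sq_nonneg _
    by_contra! hle
    nlinarith [mul_nonneg (neg_nonneg.mpr hle) h2]
  obtain ⟨v', hv', hne⟩ := hex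
  obtain ⟨w, hw, hpos⟩ := hV.exists_ray hv'
  refine ⟨w, hpos v hv hne.symm, fun v'' hv'' hne'' => ?_⟩
  by_cases h : v'' = v'
  · rw [h, hw]
  exfalso
  have h1 := hcross v hv v' hv' v'' hv'' hne hne''
  have h2 := hcross v' hv' v hv v'' hv'' hne.symm h
  have h3 := hcross v'' hv'' v hv v' hv' hne''.symm (Ne.symm h)
  -- By antisymmetry of the cross product, the product of the three positive quantities is minus a
  -- square, so a plane cone has at most two rays.
  have h4 := mul_pos (mul_pos h1 h2) h3
  have h5 := sq_nonneg ((v 0 * v' 1 - v 1 * v' 0) * (v 0 * v'' 1 - v 1 * v'' 0) *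
    (v' 0 * v'' 1 - v' 1 * v'' 0))
  linarith

/-! ### The volume bound -/

/-- A determinant is an integer, so failure of unimodularity provides a minor of absolute value at
least `2`, which is the source of the factor `1/2`. -/
lemma IsFanoPolytope.polytopeVolume_le_half (hV : IsFanoPolytope V)
    (hK : IsKSemistable (toricVariety V) n) (hU : ¬ IsUnimodular V) :
    polytopeVolume V ≤ 1 / 2 * ((n : ℝ) + 1) ^ n / (n.factorial : ℝ) := by
  rw [IsUnimodular] at hU
  push Not at hU
  obtain ⟨v, hv, hdet⟩ := hU
  have hdet2 : (2 : ℝ) ≤ |(((Matrix.of v).det : ℤ) : ℝ)| := by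
    rw [← Int.cast_abs]
    exact_mod_cast hdet
  have h0 : (Matrix.of v).det ≠ 0 := by
    intro h
    rw [h, abs_zero] at hdet
    omega
  refine (hV.polytopeVolume_le hv h0 (polytopeMoment_nonpos hV hK _)).trans ?_
  rw [mul_div_assoc]
  refine mul_le_mul_of_nonneg_right ?_ (by positivity)
  rw [one_div]
  exact inv_anti₀ two_pos hdet2

end ToricFano

end

open ComplexVariety ToricFano in
theorem lemma3p7 (n : ℕ) (V : Finset (Fin n → ℤ)) (hV : IsFanoPolytope V)
    (hsing : IsSingular (toricVariety V))
    (hK : IsKSemistable (toricVariety V) n)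
    (h : IsQFactorial (toricVariety V) ∨ ¬ IsGorenstein (toricVariety V) n ∨ n = 2) :
    ∃ v : ℝ, HasAnticanonicalVolume (toricVariety V) n v ∧
      v ≤ 1 / 2 * ((n : ℝ) + 1) ^ n / (n.factorial : ℝ) := by
  refine ⟨polytopeVolume V, hV.hasAnticanonicalVolume, hV.polytopeVolume_le_half hK fun hU => ?_⟩
  have hsmooth : (∀ x : toricVariety V, ∀ v ∈ facetSet x, ∃ p : Fin n → ℤ, 0 < v ⬝ᵥ p ∧
      ∀ v' ∈ facetSet x, v' ≠ v → v' ⬝ᵥ p = 0) → False := fun h =>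
    hsing (hU.isNonsingular hV fun x => linearIndepOn_of_exists_dotProduct_eq_zero (h x))
  rcases h with hQ | hG | rfl
  · exact hsmooth fun x v hv => hV.exists_dotProduct_eq_zero hQ hv
  · exact hG (hU.isGorenstein hV)
  · exact hsmooth fun x v hv => hV.exists_dotProduct_eq_zero_of_plane hv
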